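/- Let $(\Omega,\mathcal F,\mathbb P)$ be a probability space and $\alpha\in(0,1)$. Let $Y\in\mathbb R^d$ and $Z\in\mathbb R^q$ be independent random variables, $\varphi:\mathbb R^d\times\mathbb R^q\to\mathbb R$ a measurable function with $\mathbb E[|\varphi(Y,Z)|^{2+\delta}]<\infty$ for some $\delta>0$, and $X_0=\mathbb E[\varphi(Y,Z)\mid Y]$. Let $\mathcal H=\{1/K: K\in\mathbb N, K\ge 1\}$ and, for $h=1/K\in\mathcal H$, let $X_h=\frac1K\sum_{k=1}^K\varphi(Y,Z^{(k)})$, where $Z^{(1)},Z^{(2)},\dots$ are i.i.d. copies of $Z$, independent of $Y$. Write $F_X$ for the cdf of $X$ and put $$\mathrm{VaR}_a(X_0)=\inf\{\xi\in\mathbb R:\mathbb P(X_0\le\xi)\ge a\},\qquad \xi^0_\star=\mathrm{VaR}_\alpha(X_0),\qquad \chi^0_\star=\frac1{1-\alpha}\int_\alpha^1\mathrm{VaR}_a(X_0)\,\mathrm da,$$ $$V_0(\xi)=\xi+\frac1{1-\alpha}\mathbb E[(X_0-\xi)^+].$$ Assume: (i) there are functions $v,w(\cdot,h):\mathbb R\to\mathbb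 R$ with $F_{X_h}(\xi)-F_{X_0}(\xi)=v(\xi)h+w(\xi,h)h$ for all $\xi\in\mathbb R$, $h\in\mathcal H$, such that for every $x\in\operatorname{Argmin}V_0$, $v$ is integrable on $(x,\infty)$ and $\lim_{\mathcal H\ni h\downarrow0}w(x,h)=\lim_{\mathcal H\ni h\downarrow0}\int_x^\infty w(\xi,h)\,\mathrm d\xi=0$; (ii) for every $h\in\mathcal H\cup\{0\}$ the law of $X_h$ has a continuous density $f_{X_h}$, and $f_{X_h}\to f_{X_0}$ locally uniformly as $\mathcal H\ni h\downarrow0$; (iii) for every $R>0$, $\inf\{f_{X_h}(\xi): h\in\mathcal H\cup\{0\},\ |\xi-\xi^0_\star|<R\}>0$; (iv) the densities $f_{X_h}$, $h\in\mathcal H\cup\{0\}$, are bounded and Lipschitz, with a common bound and a common Lipschitz constant. For each $h\in\mathcal H$, let $X_h^{(1)},X_h^{(2)},\dots$ be i.i.d. copies of $X_h$, and let $\xi^h_0$ be a real random variable independent of $\{X_h^{(n)},n\ge1\}$. Assume, with $c_\alpha=\max\big(1,\frac{\alpha}{1-\alpha}\big)$, (v) $\displaystyle\sup_{h\in\mathcal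 H}\mathbb E\Big[|\xi^h_0|^2\exp\Big(\tfrac4{1-\alpha}\,c_\alpha\,\sup_{h'\in\mathcal H}\|f_{X_{h'}}\|_\infty\,|\xi^h_0|\Big)\Big]<\infty.$ Let $\gamma_n=\gamma_1n^{-\beta}$, $n\ge1$, with $\gamma_1>0$ and $\beta\in(\frac12,1)$. Put $\chi_0^h=0$ and, for $n\ge0$, $$\xi^h_{n+1}=\xi^h_n-\gamma_{n+1}\Big(1-\tfrac1{1-\alpha}\mathbf 1_{X_h^{(n+1)}\ge\xi^h_n}\Big),\qquad \chi^h_{n+1}=\chi^h_n-\tfrac1{n+1}\Big(\chi^h_n-\xi^h_n-\tfrac1{1-\alpha}(X_h^{(n+1)}-\xi^h_n)^+\Big),$$ and let $\overline\xi^h_n=\frac1n\sum_{k=1}^n\xi^h_k$ for $n\ge1$. Then, as $\mathcal H\ni h\downarrow0$, $$h^{-1}\begin{pmatrix}\overline\xi^h_{\lceil h^{-2}\rceil}-\xi^0_\star\\ \chi^h_{\lceil h^{-2}\rceil}-\chi^0_\star\end{pmatrix}\ \xrightarrow{\ \mathcal L\ }\ \mathcal N\left(\begin{pmatrix}-\dfrac{v(\xi^0_\star)}{f_{X_0}(\xi^0_\star)}\\[2mm]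 -\displaystyle\int_{\xi^0_\star}^\infty\frac{v(\xi)}{1-\alpha}\,\mathrm d\xi\end{pmatrix},\ \overline\Sigma\right),$$ where $$\overline\Sigma=\begin{pmatrix}\dfrac{\alpha(1-\alpha)}{f_{X_0}(\xi^0_\star)^2}&\dfrac{\alpha}{1-\alpha}\,\dfrac{\mathbb E[(X_0-\xi^0_\star)^+]}{f_{X_0}(\xi^0_\star)}\\[3mm] \dfrac{\alpha}{1-\alpha}\,\dfrac{\mathbb E[(X_0-\xi^0_\star)^+]}{f_{X_0}(\xi^0_\star)}&\dfrac{\mathrm{Var}\big((X_0-\xi^0_\star)^+\big)}{(1-\alpha)^2}\end{pmatrix}.$$ -/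

import Mathlib

open MeasureTheory ProbabilityTheory Filter Topology

noncomputable section

namespace NestedSA

/-- The bias parameter `h = 1/K`. The set `𝓗 = {1/K : K ≥ 1}` is parametrized by `K : ℕ+`, and
`𝓗 ∋ h ↓ 0` means `K → ∞`. -/
def bias (K : ℕ+) : ℝ := 1 / (K : ℝ)

section RiskMeasures

variable {Ω : Type*} [MeasurableSpace Ω]

/-- The cumulative distribution function of `X` under `P`. -/
def cdfOf (P : Measure Ω) (X : Ω → ℝ) (ξ : ℝ) : ℝ := P.real {ω | X ω ≤ ξ}

/-- Value-at-risk at level `a`: `inf {ξ : P(X ≤ ξ) ≥ a}`. -/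
def VaR (P : Measure Ω) (a : ℝ) (X : Ω → ℝ) : ℝ := sInf {ξ : ℝ | a ≤ cdfOf P X ξ}

/-- Expected shortfall at level `α`: `(1 - α)⁻¹ ∫_α^1 VaR_a(X) da`. -/
def ES (P : Measure Ω) (α : ℝ) (X : Ω → ℝ) : ℝ :=
  (1 / (1 - α)) * ∫ a in α..1, VaR P a X

/-- The objective function `V(ξ) = ξ + (1 - α)⁻¹ E[(X - ξ)⁺]`. -/
def objective (P : Measure Ω) (α : ℝ) (X : Ω → ℝ) (ξ : ℝ) : ℝ :=
  ξ + (1 / (1 - α)) * ∫ ω, max (X ω - ξ) 0 ∂P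

/-- `f` is a continuous probability density function of the law of `X`. -/
structure HasContinuousPDF (P : Measure Ω) (X : Ω → ℝ) (f : ℝ → ℝ) : Prop where
  continuous : Continuous f
  nonneg : ∀ x, 0 ≤ f x
  map_eq : P.map X = (volume : Measure ℝ).withDensity (fun x => ENNReal.ofReal (f x))

end RiskMeasures

section Losses

variable {Ω : Type*} [MeasurableSpace Ω] {d q : ℕ}

/-- The loss `X₀ = E[φ(Y, Z) | Y]`. -/
def loss (P : Measure Ω) (φ : EuclideanSpace ℝ (Fin d) × EuclideanSpace ℝ (Fin q) → ℝ)
    (Y : Ω → EuclideanSpace ℝ (Fin d)) (Z : Ω → EuclideanSpace ℝ (Fin q)) : Ω → ℝ :=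
  P[fun ω => φ (Y ω, Z ω) | MeasurableSpace.comap Y inferInstance]

/-- The nested Monte Carlo loss `X_h = K⁻¹ ∑_{k=1}^K φ(Y, Z^{(k)})`, `h = 1/K`; here
`Z^{(k)}` is `Zs (k - 1)`. -/
def nestedLoss (φ : EuclideanSpace ℝ (Fin d) × EuclideanSpace ℝ (Fin q) → ℝ)
    (Y : Ω → EuclideanSpace ℝ (Fin d)) (Zs : ℕ → Ω → EuclideanSpace ℝ (Fin q))
    (K : ℕ+) (ω : Ω) : ℝ :=
  (1 / (K : ℝ)) * ∑ k ∈ Finset.range (K : ℕ), φ (Y ω, Zs k ω)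

end Losses

section Assumptions

variable {Ω : Type*} [MeasurableSpace Ω]

/-- First order expansion in `h` of the cdf of `X_h`:
`F_{X_h}(ξ) - F_{X_0}(ξ) = v(ξ) h + w(ξ, h) h`, with the integrability of `v` and the vanishing
conditions on the remainder `w` at the minimizers of `V_0`. -/
def CdfExpansion (P : Measure Ω) (α : ℝ) (X0 : Ω → ℝ) (X : ℕ+ → Ω → ℝ) (v : ℝ → ℝ) : Prop :=
  ∃ w : ℝ → ℕ+ → ℝ,
    (∀ K ξ, cdfOf P (X K) ξ - cdfOf P X0 ξ = v ξ * bias K + w ξ K * bias K) ∧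
    ∀ x : ℝ, IsMinOn (objective P α X0) Set.univ x →
      IntegrableOn v (Set.Ioi x) ∧
      Tendsto (fun K => w x K) atTop (𝓝 0) ∧
      Tendsto (fun K => ∫ ξ in Set.Ioi x, w ξ K) atTop (𝓝 0)

/-- The standing regularity assumptions on the losses `X_h`, `h ∈ 𝓗 ∪ {0}`, with densities
`f K` (for `h = 1/K`) and `f0` (for `h = 0`). -/
structure Regularity (P : Measure Ω) (α : ℝ) (X0 : Ω → ℝ) (X : ℕ+ → Ω → ℝ)
    (f0 : ℝ → ℝ) (f : ℕ+ → ℝ → ℝ) (v : ℝ → ℝ) : Prop where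
  expansion : CdfExpansion P α X0 X v
  pdf_zero : HasContinuousPDF P X0 f0
  pdf : ∀ K, HasContinuousPDF P (X K) (f K)
  pdf_tendsto : TendstoLocallyUniformly f f0 atTop
  pdf_lower : ∀ R : ℝ, 0 < R → ∃ c : ℝ, 0 < c ∧
    ∀ ξ ∈ Metric.ball (VaR P α X0) R, c ≤ f0 ξ ∧ ∀ K, c ≤ f K ξ
  pdf_bounded_lipschitz : ∃ C : NNReal,
    ((∀ x, |f0 x| ≤ C) ∧ LipschitzWith C f0) ∧
    ∀ K, (∀ x, |f K x| ≤ C) ∧ LipschitzWith C (f K)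

/-- The moment condition on the initial values `ξ₀^h`: with `c_α = max 1 (α/(1-α))`,
`sup_h E[|ξ₀^h|² exp(4/(1-α) c_α (sup_h ‖f_{X_h}‖_∞) |ξ₀^h|)] < ∞`. -/
def InitialMoment (P : Measure Ω) (α : ℝ) (f : ℕ+ → ℝ → ℝ) (ξ₀ : ℕ+ → Ω → ℝ) : Prop :=
  (⨆ K : ℕ+, ∫⁻ ω, ENNReal.ofReal (|ξ₀ K ω| ^ 2 *
    Real.exp (4 / (1 - α) * max 1 (α / (1 - α)) * (⨆ K' : ℕ+, ⨆ x : ℝ, |f K' x|) *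
      |ξ₀ K ω|)) ∂P) < ⊤

end Assumptions

section Algorithm

/-- `H₁(ξ, x) = 1 - (1 - α)⁻¹ 1_{x ≥ ξ}`. -/
def H₁ (α ξ x : ℝ) : ℝ := 1 - (1 / (1 - α)) * (Set.Ici ξ).indicator (fun _ => (1 : ℝ)) x

/-- `H₂(ξ, χ, x) = χ - (ξ + (1 - α)⁻¹ (x - ξ)⁺)`. -/
def H₂ (α ξ χ x : ℝ) : ℝ := χ - (ξ + (1 / (1 - α)) * max (x - ξ) 0)

/-- The learning rate `γ_n = γ₁ n^{-β}` (used for `n ≥ 1`). -/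
def stepSize (γ₁ β : ℝ) (n : ℕ) : ℝ := γ₁ * (n : ℝ) ^ (-β)

/-- The VaR iterates `ξ_{n+1} = ξ_n - γ_{n+1} H₁(ξ_n, x^{(n+1)})`; the innovation `x^{(n+1)}` is
`x n`. -/
def xiIter (α : ℝ) (γ : ℕ → ℝ) (ξ₀ : ℝ) (x : ℕ → ℝ) : ℕ → ℝ
  | 0 => ξ₀
  | n + 1 => xiIter α γ ξ₀ x n - γ (n + 1) * H₁ α (xiIter α γ ξ₀ x n) (x n)

/-- The ES iterates `χ_{n+1} = χ_n - (n+1)⁻¹ H₂(ξ_n, χ_n, x^{(n+1)})`, `χ_0 = 0`. -/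
def chiIter (α : ℝ) (γ : ℕ → ℝ) (ξ₀ : ℝ) (x : ℕ → ℝ) : ℕ → ℝ
  | 0 => 0
  | n + 1 => chiIter α γ ξ₀ x n -
      (1 / ((n : ℝ) + 1)) * H₂ α (xiIter α γ ξ₀ x n) (chiIter α γ ξ₀ x n) (x n)

/-- The averaged VaR iterates `n⁻¹ ∑_{k=1}^n ξ_k`. -/
def xiAvg (α : ℝ) (γ : ℕ → ℝ) (ξ₀ : ℝ) (x : ℕ → ℝ) (n : ℕ) : ℝ :=
  (1 / (n : ℝ)) * ∑ k ∈ Finset.Icc 1 n, xiIter α γ ξ₀ x k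

/-- The number of iterations `⌈h⁻²⌉`. -/
def numIter (K : ℕ+) : ℕ := ⌈((bias K) ^ 2)⁻¹⌉₊

end Algorithm

section Limit

variable {Ω : Type*} [MeasurableSpace Ω]

/-- The limiting mean
`(-v(ξ⁰⋆) / f_{X₀}(ξ⁰⋆), -∫_{ξ⁰⋆}^∞ v(ξ)/(1-α) dξ)`, where `ξ⁰⋆ = VaR_α(X₀)`. -/
def limitMean (P : Measure Ω) (α : ℝ) (X0 : Ω → ℝ) (f0 v : ℝ → ℝ) : EuclideanSpace ℝ (Fin 2) :=
  !₂[-(v (VaR P α X0) / f0 (VaR P α X0)), -∫ ξ in Set.Ioi (VaR P α X0), v ξ / (1 - α)]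

/-- The limiting covariance matrix. -/
def limitCov (P : Measure Ω) (α : ℝ) (X0 : Ω → ℝ) (f0 : ℝ → ℝ) : Matrix (Fin 2) (Fin 2) ℝ :=
  let ξs := VaR P α X0
  let c := α / (1 - α) * ((∫ ω, max (X0 ω - ξs) 0 ∂P) / f0 ξs)
  !![α * (1 - α) / f0 ξs ^ 2, c;
     c, variance (fun ω => max (X0 ω - ξs) 0) P / (1 - α) ^ 2]

end Limit

end NestedSA

end

/-! Write `s` for the unbiased value-at-risk, `c = 1/(1-α)`, `h = 1/K`, `D_k = ξ_k - s`; then `N =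
⌈h⁻²⌉ = K²` and `h⁻¹ = √N`. Everything is expanded around `s` itself, not around the value-at-risk
of `X_h`, so the bias enters only through two numbers: the mean field `drift` at `s`, equal to `c
(F_{X_h}(s) - α) ≈ c v(s) h`, and `V_h(s) - V_0(s) ≈ -h ∫_s^∞ v/(1-α)`. Multiplied by `K`, they give
the limiting mean.

VaR component. The recursion reads `H₁(ξ_k, x_k) = (D_k - D_{k+1})/γ_{k+1}`. Splitting `H₁(ξ_k,
x_k)` into `H₁(s, x_k)`, the linearized mean field `c f_{X_h}(s) D_k`, a quadratic error and a
martingale difference, then summing, shows that `c f_{X_h}(s) ∑ D_k + ∑ H₁(s, x_k)` consists of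
boundary and Abel summation terms, `∑ D_k²`, and a martingale. All are `o(√N)` in `L¹` once `E[D_k²]
= O(γ_k)` uniformly in `h`; the range `1/2 < β < 1` is what makes these orders work
(`Controlled.integral_xi_remainder_le`, `tendsto_inv_mul_rate`).

ES component. `χ_N` is the average of `rho(ξ_k, x_k)`. Since `H₁(s, ·)` is the derivative of `rho`
at `s` and has mean `O(h)`, replacing `ξ_k` by `s` costs `o(√N)` after summation
(`Controlled.integral_chi_remainder_le`). The centering uses the Rockafellar–Uryasev identity
`ES_eq_objective`.

Mean square rate. The mean field is bounded, so it pulls back only like `min(|ξ - s|, 1)`, too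
weakly for a quadratic Lyapunov function. The function `cosh(l(ξ - s)) - 1` does contract
(`integral_cosh_step_le`), and a discrete Gronwall argument gives `exists_moment_bound`.

Limit law. What remains is a triangular array of i.i.d. vectors built from `H₁(s, X_h)` and `rho(s,
X_h)`. Under the nested coupling of `X_h` and `X_0`, where `E[(X_h - X_0)²] = O(h)`, these converge
in `L²` to their values at `X_0`. Only laws of innovations matter, so characteristic functions can
be compared through this coupling (`tendstoInDistribution_rows`), and Slutsky's lemma absorbs the
remainders. -/

open MeasureTheory ProbabilityTheory Filter Topology

noncomputable section

namespace NestedSA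

/-! ### Central limit theorem for triangular arrays, by characteristic functions -/

section TriangularArray

variable {Ω : Type*} [MeasurableSpace Ω] {P : Measure Ω} [IsProbabilityMeasure P]

omit [IsProbabilityMeasure P] in
lemma integral_abs_mul_le_sqrt_mul_sqrt {U V : Ω → ℝ} (hU : MemLp U 2 P) (hV : MemLp V 2 P) :
    ∫ ω, |U ω| * |V ω| ∂P ≤ √(∫ ω, U ω ^ 2 ∂P) * √(∫ ω, V ω ^ 2 ∂P) := by
  have h := integral_mul_norm_le_Lp_mul_Lq (μ := P) (f := U) (g := V)
    Real.HolderConjugate.two_two (by simpa using hU) (by simpa using hV)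
  simpa [Real.sqrt_eq_rpow] using h

lemma integral_abs_le_sqrt {U : Ω → ℝ} (hU : MemLp U 2 P) :
    ∫ ω, |U ω| ∂P ≤ √(∫ ω, U ω ^ 2 ∂P) := by
  simpa using integral_abs_mul_le_sqrt_mul_sqrt hU (memLp_const (1 : ℝ))

/-- Telescoping inside the unit disc. It makes the replacement of one characteristic function by
another in a row of length `n` cost only `n` times their distance. -/
lemma norm_pow_sub_pow_le_mul {z w : ℂ} (hz : ‖z‖ ≤ 1) (hw : ‖w‖ ≤ 1) (n : ℕ) :
    ‖z ^ n - w ^ n‖ ≤ n * ‖z - w‖ := by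
  induction n with
  | zero => simp
  | succ n ih =>
    have h : z ^ (n + 1) - w ^ (n + 1) = z ^ n * (z - w) + (z ^ n - w ^ n) * w := by ring
    rw [h]
    refine (norm_add_le _ _).trans ?_
    rw [norm_mul, norm_mul, norm_pow]
    have h1 : ‖z‖ ^ n ≤ 1 := pow_le_one₀ (norm_nonneg _) hz
    have h2 : ‖z ^ n - w ^ n‖ * ‖w‖ ≤ ‖z ^ n - w ^ n‖ :=
      mul_le_of_le_one_right (norm_nonneg _) hw
    have h3 : ‖z‖ ^ n * ‖z - w‖ ≤ ‖z - w‖ := mul_le_of_le_one_left (norm_nonneg _) h1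
    push_cast
    linarith

lemma norm_cexp_sub_one_sub_le (x : ℝ) :
    ‖Complex.exp (Complex.I * x) - 1 - Complex.I * x‖ ≤ 2 * x ^ 2 := by
  rcases le_or_gt |x| 1 with h | h
  · have := Complex.norm_exp_sub_one_sub_id_le (x := Complex.I * x) (by simpa using h)
    refine this.trans ?_
    simp only [norm_mul, Complex.norm_I, one_mul, Complex.norm_real, Real.norm_eq_abs, sq_abs]
    nlinarith [sq_nonneg x]
  · refine (norm_sub_le _ _).trans ?_
    have h1 := Real.norm_exp_I_mul_ofReal_sub_one_le (x := x)
    simp only [norm_mul, Complex.norm_I, one_mul, Complex.norm_real, Real.norm_eq_abs] at h1 ⊢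
    nlinarith [sq_abs x]

/-- Factoring out `exp(ib)` makes both error terms vanish with `a - b`; expanding the two
exponentials separately would leave errors `a²` and `b²`. -/
lemma norm_cexp_sub_cexp_sub_le (a b : ℝ) :
    ‖Complex.exp (Complex.I * a) - Complex.exp (Complex.I * b) - Complex.I * (a - b)‖
      ≤ 2 * (a - b) ^ 2 + |a - b| * |b| := by
  have h : Complex.exp (Complex.I * a) - Complex.exp (Complex.I * b) - Complex.I * (a - b)
      = Complex.exp (Complex.I * b) *
          (Complex.exp (Complex.I * ((a - b : ℝ) : ℂ)) - 1 - Complex.I * ((a - b : ℝ) : ℂ))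
        + Complex.I * ((a - b : ℝ) : ℂ) * (Complex.exp (Complex.I * b) - 1) := by
    have e : Complex.exp (Complex.I * a) =
        Complex.exp (Complex.I * b) * Complex.exp (Complex.I * ((a - b : ℝ) : ℂ)) := by
      rw [← Complex.exp_add]
      push_cast
      congr 1
      ring
    rw [e]
    push_cast
    ring
  rw [h]
  refine (norm_add_le _ _).trans ?_
  rw [norm_mul, Complex.norm_exp_I_mul_ofReal, one_mul, norm_mul, norm_mul, Complex.norm_I, one_mul,
    Complex.norm_real, Real.norm_eq_abs]
  have h1 := Real.norm_exp_I_mul_ofReal_sub_one_le (x := b)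
  rw [Real.norm_eq_abs] at h1
  exact add_le_add (norm_cexp_sub_one_sub_le _) (mul_le_mul_of_nonneg_left h1 (abs_nonneg _))

lemma integrable_cexp_I_mul {A : Ω → ℝ} (hA : AEMeasurable A P) (u : ℝ) :
    Integrable (fun ω => Complex.exp (Complex.I * ((u * A ω : ℝ) : ℂ))) P := by
  refine Integrable.of_bound (C := 1) ?_ (ae_of_all _ fun ω => ?_)
  · exact (Measurable.comp_aemeasurable (g := fun x : ℝ => Complex.exp (Complex.I * ((u * x : ℝ) : ℂ)))
      (by fun_prop) hA).aestronglyMeasurable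
  · rw [Complex.norm_exp_I_mul_ofReal]

omit [IsProbabilityMeasure P] in
lemma charFun_map_eq_integral {A : Ω → ℝ} (hA : AEMeasurable A P) (u : ℝ) :
    charFun (P.map A) u = ∫ ω, Complex.exp (Complex.I * ((u * A ω : ℝ) : ℂ)) ∂P := by
  rw [charFun_apply_real, integral_map hA (by fun_prop)]
  congr 1 with ω
  congr 1
  push_cast
  ring

/-- Centering kills the linear term, so the difference is `u²` times a quantity tending to zero with
the `L²` distance of `A` and `B`. At `u = 1/K` the factor `u²` compensates exactly the `K²` entries
of a row. -/
lemma norm_charFun_map_sub_le {A B : Ω → ℝ} (hA : MemLp A 2 P) (hB : MemLp B 2 P)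
    (hA0 : ∫ ω, A ω ∂P = 0) (hB0 : ∫ ω, B ω ∂P = 0) (u : ℝ) :
    ‖charFun (P.map A) u - charFun (P.map B) u‖ ≤
      u ^ 2 * (2 * ∫ ω, (A ω - B ω) ^ 2 ∂P
        + √(∫ ω, (A ω - B ω) ^ 2 ∂P) * √(∫ ω, B ω ^ 2 ∂P)) := by
  have iA := hA.integrable one_le_two
  have iB := hB.integrable one_le_two
  have hAB : MemLp (fun ω => A ω - B ω) 2 P := hA.sub hB
  have e0 : ∫ ω, (Complex.I * (((u * A ω : ℝ) : ℂ) - ((u * B ω : ℝ) : ℂ))) ∂P = 0 := by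
    rw [integral_const_mul]
    simp_rw [← Complex.ofReal_sub]
    rw [integral_complex_ofReal, integral_sub (iA.const_mul u) (iB.const_mul u),
      integral_const_mul, integral_const_mul, hA0, hB0]
    simp
  have ie : Integrable (fun ω => Complex.I * (((u * A ω : ℝ) : ℂ) - ((u * B ω : ℝ) : ℂ))) P :=
    (((iA.const_mul u).ofReal).sub ((iB.const_mul u).ofReal)).const_mul _
  have key : charFun (P.map A) u - charFun (P.map B) u =
      ∫ ω, (Complex.exp (Complex.I * ((u * A ω : ℝ) : ℂ)) -
        Complex.exp (Complex.I * ((u * B ω : ℝ) : ℂ)) -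
        Complex.I * (((u * A ω : ℝ) : ℂ) - ((u * B ω : ℝ) : ℂ))) ∂P := by
    have id : Integrable (fun ω => Complex.exp (Complex.I * ((u * A ω : ℝ) : ℂ)) -
        Complex.exp (Complex.I * ((u * B ω : ℝ) : ℂ))) P :=
      (integrable_cexp_I_mul iA.aemeasurable u).sub (integrable_cexp_I_mul iB.aemeasurable u)
    rw [integral_sub id ie, e0, sub_zero,
      integral_sub (integrable_cexp_I_mul iA.aemeasurable u)
        (integrable_cexp_I_mul iB.aemeasurable u),
      charFun_map_eq_integral iA.aemeasurable, charFun_map_eq_integral iB.aemeasurable]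
  rw [key]
  have iP : Integrable (fun ω => |A ω - B ω| * |B ω|) P := by
    have := (hAB.abs).integrable_mul hB.abs
    exact this
  have i2 : Integrable (fun ω => (A ω - B ω) ^ 2) P := hAB.integrable_sq
  calc _ ≤ ∫ ω, u ^ 2 * (2 * (A ω - B ω) ^ 2 + |A ω - B ω| * |B ω|) ∂P := by
        refine norm_integral_le_of_norm_le (((i2.const_mul 2).add iP).const_mul _)
          (ae_of_all _ fun ω => ?_)
        refine (norm_cexp_sub_cexp_sub_le _ _).trans (le_of_eq ?_)
        rw [← mul_sub, abs_mul, abs_mul]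
        linear_combination |A ω - B ω| * |B ω| * sq_abs u
    _ = u ^ 2 * (2 * ∫ ω, (A ω - B ω) ^ 2 ∂P + ∫ ω, |A ω - B ω| * |B ω| ∂P) := by
        rw [integral_const_mul, integral_add (i2.const_mul 2) iP, integral_const_mul]
    _ ≤ _ := by
        gcongr
        exact integral_abs_mul_le_sqrt_mul_sqrt hAB hB

/-- The standardized central limit theorem evaluated at the frequency `s`, the standard deviation.
The degenerate case `s = 0`, where standardization fails, is a Dirac mass. -/
lemma tendsto_charFun_pow_of_memLp {B : Ω → ℝ} (hB : MemLp B 2 P) (hB0 : ∫ ω, B ω ∂P = 0) :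
    Tendsto (fun n : ℕ => charFun (P.map B) ((√n)⁻¹) ^ n) atTop
      (𝓝 (Complex.exp (-(∫ ω, B ω ^ 2 ∂P : ℝ) / 2))) := by
  set s : ℝ := √(∫ ω, B ω ^ 2 ∂P) with hs
  have hnn : 0 ≤ ∫ ω, B ω ^ 2 ∂P := integral_nonneg fun ω => sq_nonneg _
  have hs2 : s ^ 2 = ∫ ω, B ω ^ 2 ∂P := Real.sq_sqrt hnn
  rcases eq_or_ne s 0 with h0 | h0
  · have hz : ∫ ω, B ω ^ 2 ∂P = 0 := by rw [← hs2, h0]; simp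
    have hB' : B =ᵐ[P] 0 := by
      have := (integral_eq_zero_iff_of_nonneg (fun ω => sq_nonneg (B ω)) hB.integrable_sq).1 hz
      filter_upwards [this] with ω hω
      simpa using hω
    rw [Measure.map_congr hB', hz]
    have : Measure.map (0 : Ω → ℝ) P = Measure.dirac 0 := by
      rw [show (0 : Ω → ℝ) = fun _ => (0 : ℝ) from rfl, Measure.map_const]
      simp
    simp [this, charFun_dirac]
  · have hm := hB.aestronglyMeasurable.aemeasurable
    have key := tendsto_charFun_inv_sqrt_mul_pow (P := P) (X := fun ω => s⁻¹ * B ω)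
      (hm.const_mul _) (by rw [integral_const_mul, hB0, mul_zero])
      (by
        simp only [Pi.pow_apply, mul_pow]
        rw [integral_const_mul, ← hs2]
        field_simp) s
    have e : ∀ n : ℕ, charFun (P.map fun ω => s⁻¹ * B ω) ((√n)⁻¹ * s)
        = charFun (P.map B) ((√n)⁻¹) := by
      intro n
      rw [charFun_map_mul_comp hm]
      congr 1
      field_simp
    simp_rw [e] at key
    convert key using 3
    rw [← hs2]
    push_cast
    ring

/-- The characteristic function form of the central limit theorem for rows of centered variables
converging in `L²`; the `K`-th row has `K ^ 2` entries. -/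
lemma tendsto_charFun_pow_sq {A : ℕ+ → Ω → ℝ} {B : Ω → ℝ} (hA : ∀ K, MemLp (A K) 2 P)
    (hB : MemLp B 2 P) (hA0 : ∀ K, ∫ ω, A K ω ∂P = 0) (hB0 : ∫ ω, B ω ∂P = 0)
    (hAB : Tendsto (fun K => ∫ ω, (A K ω - B ω) ^ 2 ∂P) atTop (𝓝 0)) :
    Tendsto (fun K : ℕ+ => charFun (P.map (A K)) ((K : ℝ)⁻¹) ^ ((K : ℕ) ^ 2)) atTop
      (𝓝 (Complex.exp (-(∫ ω, B ω ^ 2 ∂P : ℝ) / 2))) := by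
  have h1 : Tendsto (fun K : ℕ+ => charFun (P.map B) ((K : ℝ)⁻¹) ^ ((K : ℕ) ^ 2)) atTop
      (𝓝 (Complex.exp (-(∫ ω, B ω ^ 2 ∂P : ℝ) / 2))) := by
    have := (tendsto_charFun_pow_of_memLp hB hB0).comp
      ((tendsto_pow_atTop (two_ne_zero)).comp tendsto_PNat_val_atTop_atTop)
    refine this.congr fun K => ?_
    simp [Function.comp_def, Real.sqrt_sq]
  have h2 : Tendsto (fun K : ℕ+ => charFun (P.map (A K)) ((K : ℝ)⁻¹) ^ ((K : ℕ) ^ 2)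
      - charFun (P.map B) ((K : ℝ)⁻¹) ^ ((K : ℕ) ^ 2)) atTop (𝓝 0) := by
    have hb : Tendsto (fun K => 2 * ∫ ω, (A K ω - B ω) ^ 2 ∂P
        + √(∫ ω, (A K ω - B ω) ^ 2 ∂P) * √(∫ ω, B ω ^ 2 ∂P)) atTop (𝓝 0) := by
      have := (hAB.const_mul 2).add (hAB.sqrt.mul_const (√(∫ ω, B ω ^ 2 ∂P)))
      simpa using this
    refine squeeze_zero_norm (fun K => ?_) hb
    have iA : IsProbabilityMeasure (P.map (A K)) :=
      Measure.isProbabilityMeasure_map (hA K).aestronglyMeasurable.aemeasurable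
    have iB : IsProbabilityMeasure (P.map B) :=
      Measure.isProbabilityMeasure_map hB.aestronglyMeasurable.aemeasurable
    refine (norm_pow_sub_pow_le_mul (norm_charFun_le_one _) (norm_charFun_le_one _) _).trans ?_
    have hK : (0 : ℝ) < K := by exact_mod_cast K.pos
    have := norm_charFun_map_sub_le (hA K) hB (hA0 K) hB0 ((K : ℝ)⁻¹)
    calc _ ≤ (((K : ℕ) ^ 2 : ℕ) : ℝ) * _ := mul_le_mul_of_nonneg_left this (by positivity)
      _ = _ := by push_cast; field_simp
  simpa using h2.add h1

/-- Lévy's continuity theorem for sequences, transported to `ℕ+` along the successor map and its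
inverse. -/
lemma tendsto_pnat_of_tendsto_charFun {E : Type*} [NormedAddCommGroup E] [InnerProductSpace ℝ E]
    [FiniteDimensional ℝ E] [MeasurableSpace E] [BorelSpace E]
    {μ : ℕ+ → ProbabilityMeasure E} {μ₀ : ProbabilityMeasure E}
    (h : ∀ t : E, Tendsto (fun K => charFun (μ K) t) atTop (𝓝 (charFun μ₀ t))) :
    Tendsto μ atTop (𝓝 μ₀) := by
  have hs : Tendsto Nat.succPNat atTop atTop :=
    tendsto_atTop_atTop.2 fun K => ⟨K, fun n hn => by
      rw [← PNat.coe_le_coe]; simp; lia⟩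
  have hp : Tendsto PNat.natPred atTop atTop :=
    tendsto_atTop_atTop.2 fun n => ⟨n.succPNat, fun K hK => by
      have := PNat.natPred_le_natPred.2 hK
      simpa using this⟩
  have := ProbabilityMeasure.tendsto_of_tendsto_charFun (μ := fun n => μ n.succPNat) (μ₀ := μ₀)
    (fun t => (h t).comp hs)
  refine (this.comp hp).congr fun K => ?_
  simp

/-- Covariance matrix of a pair of centered variables. -/
def secondMomentMatrix (P : Measure Ω) (a b : Ω → ℝ) : Matrix (Fin 2) (Fin 2) ℝ :=
  !![∫ ω, a ω ^ 2 ∂P, ∫ ω, a ω * b ω ∂P; ∫ ω, a ω * b ω ∂P, ∫ ω, b ω ^ 2 ∂P]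

-- Serves twice: it yields positive semidefiniteness, and it identifies the exponent of the Gaussian
-- characteristic function with the variance of the scalar projection.
omit [IsProbabilityMeasure P] in
lemma secondMomentMatrix_quadratic {a b : Ω → ℝ} (ha : MemLp a 2 P) (hb : MemLp b 2 P)
    (x : Fin 2 → ℝ) :
    x ⬝ᵥ (secondMomentMatrix P a b).mulVec x = ∫ ω, (x 0 * a ω + x 1 * b ω) ^ 2 ∂P := by
  have i1 := ha.integrable_sq
  have i2 := hb.integrable_sq
  have i3 : Integrable (fun ω => a ω * b ω) P := ha.integrable_mul hb
  have : ∀ ω, (x 0 * a ω + x 1 * b ω) ^ 2 =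
      x 0 ^ 2 * a ω ^ 2 + (2 * x 0 * x 1) * (a ω * b ω) + x 1 ^ 2 * b ω ^ 2 := fun ω => by ring
  simp_rw [this]
  have i4 : Integrable (fun ω => x 0 ^ 2 * a ω ^ 2 + (2 * x 0 * x 1) * (a ω * b ω)) P :=
    (i1.const_mul _).add (i3.const_mul _)
  rw [integral_add i4 (i2.const_mul _), integral_add (i1.const_mul _) (i3.const_mul _), integral_const_mul, integral_const_mul,
    integral_const_mul]
  simp [secondMomentMatrix, Matrix.mulVec, dotProduct, Fin.sum_univ_two]
  ring

omit [IsProbabilityMeasure P] in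
lemma secondMomentMatrix_posSemidef {a b : Ω → ℝ} (ha : MemLp a 2 P) (hb : MemLp b 2 P) :
    (secondMomentMatrix P a b).PosSemidef := by
  refine Matrix.PosSemidef.of_dotProduct_mulVec_nonneg ?_ fun x => ?_
  · ext i j
    fin_cases i <;> fin_cases j <;> simp [secondMomentMatrix]
  · simp only [star_trivial]
    rw [secondMomentMatrix_quadratic ha hb]
    exact integral_nonneg fun ω => sq_nonneg _

/-- A bivariate central limit theorem for triangular arrays whose `K`-th row consists of `K ^ 2`
i.i.d. centered vectors, distributed as `(a K, b K)`, where `(a K, b K) → (a, b)` in `L²`. -/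
theorem tendstoInDistribution_rows {a b : ℕ+ → Ω → ℝ} {a0 b0 : Ω → ℝ}
    (ha : ∀ K, MemLp (a K) 2 P) (hb : ∀ K, MemLp (b K) 2 P)
    (ha0 : MemLp a0 2 P) (hb0 : MemLp b0 2 P)
    (hma : ∀ K, ∫ ω, a K ω ∂P = 0) (hmb : ∀ K, ∫ ω, b K ω ∂P = 0)
    (hma0 : ∫ ω, a0 ω ∂P = 0) (hmb0 : ∫ ω, b0 ω ∂P = 0)
    (hla : Tendsto (fun K => ∫ ω, (a K ω - a0 ω) ^ 2 ∂P) atTop (𝓝 0))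
    (hlb : Tendsto (fun K => ∫ ω, (b K ω - b0 ω) ^ 2 ∂P) atTop (𝓝 0))
    (ζ : ℕ+ → ℕ → Ω → ℝ × ℝ) (hζm : ∀ K n, Measurable (ζ K n))
    (hζi : ∀ K, iIndepFun (ζ K) P)
    (hζ : ∀ K n, IdentDistrib (ζ K n) (fun ω => (a K ω, b K ω)) P P)
    (m : EuclideanSpace ℝ (Fin 2)) :
    TendstoInDistribution
      (fun (K : ℕ+) ω => (!₂[(K : ℝ)⁻¹ * ∑ k ∈ Finset.range ((K : ℕ) ^ 2), (ζ K k ω).1,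
        (K : ℝ)⁻¹ * ∑ k ∈ Finset.range ((K : ℕ) ^ 2), (ζ K k ω).2] : EuclideanSpace ℝ (Fin 2)) + m)
      atTop (id : EuclideanSpace ℝ (Fin 2) → EuclideanSpace ℝ (Fin 2)) (fun _ => P)
      (multivariateGaussian m (secondMomentMatrix P a0 b0)) := by
  have hmeas : ∀ K : ℕ+, Measurable (fun ω =>
      (!₂[(K : ℝ)⁻¹ * ∑ k ∈ Finset.range ((K : ℕ) ^ 2), (ζ K k ω).1,
        (K : ℝ)⁻¹ * ∑ k ∈ Finset.range ((K : ℕ) ^ 2), (ζ K k ω).2] : EuclideanSpace ℝ (Fin 2))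
        + m) := by
    intro K
    refine Measurable.add_const ?_ _
    refine (WithLp.measurable_toLp 2 _).comp (measurable_pi_lambda _ fun i => ?_)
    fin_cases i
    · exact (Finset.measurable_fun_sum _ fun k _ => (hζm K k).fst).const_mul _
    · exact (Finset.measurable_fun_sum _ fun k _ => (hζm K k).snd).const_mul _
  refine ⟨fun K => (hmeas K).aemeasurable, by fun_prop, ?_⟩
  refine tendsto_pnat_of_tendsto_charFun fun t => ?_
  simp only [ProbabilityMeasure.coe_mk, Measure.map_id]
  rw [charFun_multivariateGaussian (secondMomentMatrix_posSemidef ha0 hb0)]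
  -- Cramér–Wold: pairing with `t` turns each row into a sum of `K²` scalar variables distributed as
  -- `A K`, tested at frequency `1/K`.
  set A : ℕ+ → Ω → ℝ := fun K ω => t 0 * a K ω + t 1 * b K ω with hA
  set B : Ω → ℝ := fun ω => t 0 * a0 ω + t 1 * b0 ω with hB
  have hAm : ∀ K, MemLp (A K) 2 P := fun K => ((ha K).const_mul _).add ((hb K).const_mul _)
  have hBm : MemLp B 2 P := (ha0.const_mul _).add (hb0.const_mul _)
  have hA0 : ∀ K, ∫ ω, A K ω ∂P = 0 := fun K => by
    rw [integral_add (((ha K).integrable one_le_two).const_mul _)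
      (((hb K).integrable one_le_two).const_mul _), integral_const_mul, integral_const_mul,
      hma, hmb]
    simp
  have hB0 : ∫ ω, B ω ∂P = 0 := by
    rw [integral_add ((ha0.integrable one_le_two).const_mul _)
      ((hb0.integrable one_le_two).const_mul _), integral_const_mul, integral_const_mul,
      hma0, hmb0]
    simp
  have hAB : Tendsto (fun K => ∫ ω, (A K ω - B ω) ^ 2 ∂P) atTop (𝓝 0) := by
    have hl : Tendsto (fun K => 2 * t 0 ^ 2 * ∫ ω, (a K ω - a0 ω) ^ 2 ∂P
        + 2 * t 1 ^ 2 * ∫ ω, (b K ω - b0 ω) ^ 2 ∂P) atTop (𝓝 0) := by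
      simpa using (hla.const_mul (2 * t 0 ^ 2)).add (hlb.const_mul (2 * t 1 ^ 2))
    refine squeeze_zero (fun K => integral_nonneg fun ω => sq_nonneg _) (fun K => ?_) hl
    have i1 : Integrable (fun ω => (a K ω - a0 ω) ^ 2) P := ((ha K).sub ha0).integrable_sq
    have i2 : Integrable (fun ω => (b K ω - b0 ω) ^ 2) P := ((hb K).sub hb0).integrable_sq
    rw [← integral_const_mul, ← integral_const_mul,
      ← integral_add (i1.const_mul _) (i2.const_mul _)]
    refine integral_mono ((hAm K).sub hBm).integrable_sq ((i1.const_mul _).add (i2.const_mul _))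
      fun ω => ?_
    simp only [hA, hB]
    nlinarith [sq_nonneg (t 0 * (a K ω - a0 ω) - t 1 * (b K ω - b0 ω))]
  have key := tendsto_charFun_pow_sq hAm hBm hA0 hB0 hAB
  have hc : ∀ K : ℕ+, charFun (P.map fun ω =>
      (!₂[(K : ℝ)⁻¹ * ∑ k ∈ Finset.range ((K : ℕ) ^ 2), (ζ K k ω).1,
        (K : ℝ)⁻¹ * ∑ k ∈ Finset.range ((K : ℕ) ^ 2), (ζ K k ω).2] : EuclideanSpace ℝ (Fin 2))
        + m) t
      = Complex.exp (Complex.I * (inner ℝ t m : ℝ)) *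
        charFun (P.map (A K)) ((K : ℝ)⁻¹) ^ ((K : ℕ) ^ 2) := by
    intro K
    have hW : iIndepFun (fun k ω => t 0 * (ζ K k ω).1 + t 1 * (ζ K k ω).2) P :=
      (hζi K).comp (fun _ p => t 0 * p.1 + t 1 * p.2) (fun _ => by fun_prop)
    have hWm : ∀ k, Measurable fun ω => t 0 * (ζ K k ω).1 + t 1 * (ζ K k ω).2 := fun k =>
      ((hζm K k).fst.const_mul _).add ((hζm K k).snd.const_mul _)
    have hWd : ∀ k, P.map (fun ω => t 0 * (ζ K k ω).1 + t 1 * (ζ K k ω).2) = P.map (A K) :=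
      fun k => ((hζ K k).comp (u := fun p : ℝ × ℝ => t 0 * p.1 + t 1 * p.2) (by fun_prop)).map_eq
    have h1 := (hW.restrict (Finset.range ((K : ℕ) ^ 2))).charFun_map_fun_finsetSum_eq_prod
      (fun k _ => (hWm k).aemeasurable)
    have h2 := congrFun h1 ((K : ℝ)⁻¹)
    simp only [hWd, Finset.prod_const, Finset.card_range, Pi.pow_apply] at h2
    rw [← h2, charFun_map_eq_integral
      (Finset.measurable_fun_sum _ fun k _ => hWm k).aemeasurable, charFun_apply,
      integral_map (hmeas K).aemeasurable (by fun_prop), ← integral_const_mul]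
    congr 1 with ω
    rw [← Complex.exp_add]
    congr 1
    rw [inner_add_left, real_inner_comm t m]
    have : inner ℝ (!₂[(K : ℝ)⁻¹ * ∑ k ∈ Finset.range ((K : ℕ) ^ 2), (ζ K k ω).1,
        (K : ℝ)⁻¹ * ∑ k ∈ Finset.range ((K : ℕ) ^ 2), (ζ K k ω).2] : EuclideanSpace ℝ (Fin 2)) t
        = (K : ℝ)⁻¹ * ∑ k ∈ Finset.range ((K : ℕ) ^ 2),
          (t 0 * (ζ K k ω).1 + t 1 * (ζ K k ω).2) := by
      simp only [PiLp.inner_apply, Fin.sum_univ_two]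
      simp only [Finset.sum_add_distrib, ← Finset.mul_sum]
      simp
      ring
    rw [this]
    push_cast
    ring
  simp_rw [hc]
  have := key.const_mul (Complex.exp (Complex.I * (inner ℝ t m : ℝ)))
  convert this using 2
  rw [← Complex.exp_add]
  have q := secondMomentMatrix_quadratic ha0 hb0 t.ofLp
  congr 1
  rw [q]
  ring

end TriangularArray

/-! ### Independence of the past and the next innovation -/

section Independence

variable {Ω : Type*} [MeasurableSpace Ω] {P : Measure Ω} [IsProbabilityMeasure P]

/-- Associativity of product measures: both hypotheses together say that the joint law of `(A, B,
C)` is a product. -/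
lemma indepFun_prodMk_of_indepFun {α β γ : Type*} [MeasurableSpace α] [MeasurableSpace β]
    [MeasurableSpace γ] {A : Ω → α} {B : Ω → β} {C : Ω → γ} (hA : Measurable A)
    (hB : Measurable B) (hC : Measurable C)
    (h : IndepFun A (fun ω => (B ω, C ω)) P) (h' : IndepFun B C P) :
    IndepFun (fun ω => (A ω, B ω)) C P := by
  have iA : IsProbabilityMeasure (P.map A) := Measure.isProbabilityMeasure_map hA.aemeasurable
  have iB : IsProbabilityMeasure (P.map B) := Measure.isProbabilityMeasure_map hB.aemeasurable
  have iC : IsProbabilityMeasure (P.map C) := Measure.isProbabilityMeasure_map hC.aemeasurable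
  have e1 := (indepFun_iff_map_prod_eq_prod_map_map hA.aemeasurable
    (hB.prodMk hC).aemeasurable).1 h
  have e2 := (indepFun_iff_map_prod_eq_prod_map_map hB.aemeasurable hC.aemeasurable).1 h'
  have e3 : IndepFun A B P := h.comp measurable_id measurable_fst
  have e4 := (indepFun_iff_map_prod_eq_prod_map_map hA.aemeasurable hB.aemeasurable).1 e3
  rw [indepFun_iff_map_prod_eq_prod_map_map (hA.prodMk hB).aemeasurable hC.aemeasurable, e4]
  have e5 : P.map (fun ω => ((A ω, B ω), C ω)) =
      (P.map (fun ω => (A ω, (B ω, C ω)))).map MeasurableEquiv.prodAssoc.symm := by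
    rw [Measure.map_map (MeasurableEquiv.measurable _) (hA.prodMk (hB.prodMk hC))]
    rfl
  rw [e5, e1, e2]
  exact ((measurePreserving_prodAssoc (P.map A) (P.map B) (P.map C)).symm _).map_eq

/-- Freezing `U` and integrating out `V` by Fubini replaces conditioning on the past, so no
filtration is needed below. -/
lemma integrable_and_integral_of_indepFun {E F : Type*} [MeasurableSpace E] [MeasurableSpace F]
    {U : Ω → E} {V : Ω → F}
    (hU : Measurable U) (hV : Measurable V) (h : IndepFun U V P) {Φ : E × F → ℝ}
    (hΦ : Measurable Φ) (hi : Integrable (fun ω => Φ (U ω, V ω)) P) :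
    Integrable (fun ω => ∫ y, Φ (U ω, y) ∂(P.map V)) P ∧
      ∫ ω, Φ (U ω, V ω) ∂P = ∫ ω, ∫ y, Φ (U ω, y) ∂(P.map V) ∂P := by
  have iU : IsProbabilityMeasure (P.map U) := Measure.isProbabilityMeasure_map hU.aemeasurable
  have iV : IsProbabilityMeasure (P.map V) := Measure.isProbabilityMeasure_map hV.aemeasurable
  have e := (indepFun_iff_map_prod_eq_prod_map_map hU.aemeasurable hV.aemeasurable).1 h
  have hi' : Integrable Φ ((P.map U).prod (P.map V)) := by
    rw [← e, integrable_map_measure hΦ.aestronglyMeasurable (hU.prodMk hV).aemeasurable]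
    exact hi
  have hm : StronglyMeasurable fun u => ∫ y, Φ (u, y) ∂(P.map V) :=
    hΦ.stronglyMeasurable.integral_prod_right'
  constructor
  · have := hi'.integral_prod_left
    rwa [integrable_map_measure hm.aestronglyMeasurable hU.aemeasurable] at this
  · calc ∫ ω, Φ (U ω, V ω) ∂P = ∫ p, Φ p ∂(P.map fun ω => (U ω, V ω)) :=
        (integral_map (hU.prodMk hV).aemeasurable hΦ.aestronglyMeasurable).symm
      _ = ∫ u, ∫ y, Φ (u, y) ∂(P.map V) ∂(P.map U) := by rw [e, integral_prod _ hi']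
      _ = _ := integral_map hU.aemeasurable hm.aestronglyMeasurable

/-- The map `T` sets all coordinates from `n` on to zero; by `hdep`, `Ψ` does not notice. Hence the
left-hand variable is a function of `ξ₀` and the first `n` innovations, which are jointly
independent of the `n`-th. -/
lemma indepFun_of_depends_on_past {E : Type*} [MeasurableSpace E] {ξ₀ : Ω → ℝ} {x : ℕ → Ω → ℝ}
    (hξ₀ : Measurable ξ₀) (hx : ∀ n, Measurable (x n)) (hxi : iIndepFun x P)
    (h0 : IndepFun ξ₀ (fun ω n => x n ω) P) (n : ℕ) {Ψ : ℝ × (ℕ → ℝ) → E} (hΨ : Measurable Ψ)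
    (hdep : ∀ a s s', (∀ i < n, s i = s' i) → Ψ (a, s) = Ψ (a, s')) :
    IndepFun (fun ω => Ψ (ξ₀ ω, fun k => x k ω)) (x n) P := by
  have hxm : Measurable fun ω k => x k ω := measurable_pi_lambda _ hx
  let T : (ℕ → ℝ) → ℕ → ℝ := fun s i => if i < n then s i else 0
  have hT : Measurable T := measurable_pi_lambda _ fun i => by
    by_cases hi : i < n
    · simpa [T, hi] using measurable_pi_apply i
    · simp [T, hi]
  have h1 : IndepFun (fun ω => T fun k => x k ω) (x n) P := by
    have h := hxi.indepFun_finset (Finset.range n) {n} (by simp) hx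
    let G : ((i : Finset.range n) → ℝ) → ℕ → ℝ := fun s i =>
      if hi : i < n then s ⟨i, Finset.mem_range.2 hi⟩ else 0
    have hG : Measurable G := measurable_pi_lambda _ fun i => by
      by_cases hi : i < n
      · simpa [G, hi] using measurable_pi_apply _
      · simp [G, hi]
    have := h.comp hG (measurable_pi_apply (⟨n, by simp⟩ : ({n} : Finset ℕ)))
    have e : (fun ω => T fun k => x k ω) = G ∘ fun a (i : Finset.range n) => x i a := by
      ext ω i
      simp [T, G]
    rw [e]
    exact this
  have h2 : IndepFun ξ₀ (fun ω => (T fun k => x k ω, x n ω)) P :=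
    h0.comp (φ := id) (ψ := fun s => (T s, s n)) measurable_id
      (hT.prodMk (measurable_pi_apply n))
  have h3 := indepFun_prodMk_of_indepFun hξ₀ (hT.comp hxm) (hx n) h2 h1
  have h4 := h3.comp hΨ measurable_id
  have e : (fun ω => Ψ (ξ₀ ω, fun k => x k ω)) =
      Ψ ∘ fun ω => (ξ₀ ω, (T ∘ fun ω k => x k ω) ω) := by
    ext1 ω
    exact hdep _ _ _ fun i hi => by simp [T, hi]
  rw [e]
  exact h4

end Independence

/-! ### Measurability and crude bounds for the VaR iterates -/

section Iterates

variable {α : ℝ} {γ : ℕ → ℝ}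

lemma xiIter_congr {a : ℝ} {s s' : ℕ → ℝ} (n : ℕ) (h : ∀ i < n, s i = s' i) :
    xiIter α γ a s n = xiIter α γ a s' n := by
  induction n with
  | zero => rfl
  | succ n ih =>
    simp only [xiIter, ih fun i hi => h i (by lia), h n (by lia)]

lemma measurable_H₁ : Measurable fun p : ℝ × ℝ => H₁ α p.1 p.2 := by
  have hs : MeasurableSet {p : ℝ × ℝ | p.1 ≤ p.2} := measurableSet_le measurable_fst measurable_snd
  have : (fun p : ℝ × ℝ => H₁ α p.1 p.2) =
      fun p => 1 - (1 / (1 - α)) * ({p : ℝ × ℝ | p.1 ≤ p.2}.indicator (fun _ => (1 : ℝ)) p) := by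
    ext p
    simp [H₁, Set.indicator]
  rw [this]
  exact ((measurable_const.indicator hs).const_mul _).const_sub _

lemma measurable_xiIter (n : ℕ) :
    Measurable fun p : ℝ × (ℕ → ℝ) => xiIter α γ p.1 p.2 n := by
  induction n with
  | zero => exact measurable_fst
  | succ n ih =>
    have : Measurable fun p : ℝ × (ℕ → ℝ) => H₁ α (xiIter α γ p.1 p.2 n) (p.2 n) :=
      measurable_H₁.comp (ih.prodMk ((measurable_pi_apply n).comp measurable_snd))
    exact ih.sub (this.const_mul _)

lemma abs_H₁_le (hα : α ∈ Set.Ioo (0 : ℝ) 1) (ξ x : ℝ) : |H₁ α ξ x| ≤ 1 / (1 - α) := by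
  have h1 : 0 < 1 - α := by linarith [hα.2]
  have h2 : 1 ≤ 1 / (1 - α) := by rw [le_div_iff₀ h1]; linarith [hα.1]
  unfold H₁
  by_cases h : x ∈ Set.Ici ξ
  · rw [Set.indicator_of_mem h, abs_le]; constructor <;> linarith
  · rw [Set.indicator_of_notMem h, abs_le]; constructor <;> linarith

/-- The increments are bounded. The bound grows with `n`; it serves to carry exponential
integrability from the initial value to each later iterate. -/
lemma abs_xiIter_sub_le (hα : α ∈ Set.Ioo (0 : ℝ) 1) (a : ℝ) (s : ℕ → ℝ) (n : ℕ) :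
    |xiIter α γ a s n - a| ≤ (1 / (1 - α)) * ∑ k ∈ Finset.range n, |γ (k + 1)| := by
  induction n with
  | zero => simp [xiIter]
  | succ n ih =>
    have h := abs_H₁_le hα (xiIter α γ a s n) (s n)
    have e : xiIter α γ a s (n + 1) - a =
        (xiIter α γ a s n - a) - γ (n + 1) * H₁ α (xiIter α γ a s n) (s n) := by
      simp only [xiIter]; ring
    rw [e, Finset.sum_range_succ, mul_add]
    refine (abs_sub _ _).trans (add_le_add ih ?_)
    rw [abs_mul, mul_comm]
    gcongr

end Iterates

/-! ### Martingale differences along a run -/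

section Noise

variable {Ω : Type*} [MeasurableSpace Ω] {P : Measure Ω} [IsProbabilityMeasure P]

/-- Data of one run of the algorithm: an initial value independent of i.i.d. innovations of
law `ν`. -/
structure Run (P : Measure Ω) (ξ₀ : Ω → ℝ) (x : ℕ → Ω → ℝ) (ν : Measure ℝ) : Prop where
  meas_init : Measurable ξ₀
  meas : ∀ n, Measurable (x n)
  indep : iIndepFun x P
  indep_init : IndepFun ξ₀ (fun ω n => x n ω) P
  law : ∀ n, P.map (x n) = ν

variable {ξ₀ : Ω → ℝ} {x : ℕ → Ω → ℝ} {ν : Measure ℝ} {α : ℝ} {γ : ℕ → ℝ}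

/-- The VaR iterates as random variables. -/
def xiProc (α : ℝ) (γ : ℕ → ℝ) (ξ₀ : Ω → ℝ) (x : ℕ → Ω → ℝ) (n : ℕ) (ω : Ω) : ℝ :=
  xiIter α γ (ξ₀ ω) (fun k => x k ω) n

omit [IsProbabilityMeasure P] in
lemma Run.measurable_xiProc (R : Run P ξ₀ x ν) (n : ℕ) : Measurable (xiProc α γ ξ₀ x n) :=
  (measurable_xiIter n).comp (R.meas_init.prodMk (measurable_pi_lambda _ R.meas))

lemma Run.isProbabilityMeasure (R : Run P ξ₀ x ν) : IsProbabilityMeasure ν := by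
  rw [← R.law 0]
  exact Measure.isProbabilityMeasure_map (R.meas 0).aemeasurable

lemma Run.indepFun_xiProc (R : Run P ξ₀ x ν) (n : ℕ) : IndepFun (xiProc α γ ξ₀ x n) (x n) P :=
  indepFun_of_depends_on_past R.meas_init R.meas R.indep R.indep_init n (measurable_xiIter n)
    fun _ _ _ h => xiIter_congr n h

/-- The partial sum and the current iterate must be kept as a pair: both occur in the cross term of
the orthogonality argument. -/
lemma Run.indepFun_sum_xiProc (R : Run P ξ₀ x ν) (n : ℕ) {d : ℝ × ℝ → ℝ} (hd : Measurable d) :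
    IndepFun (fun ω => (∑ k ∈ Finset.range n, d (xiProc α γ ξ₀ x k ω, x k ω), xiProc α γ ξ₀ x n ω))
      (x n) P := by
  refine indepFun_of_depends_on_past R.meas_init R.meas R.indep R.indep_init n
    (Ψ := fun p => (∑ k ∈ Finset.range n, d (xiIter α γ p.1 p.2 k, p.2 k), xiIter α γ p.1 p.2 n))
    ?_ ?_
  · refine (Finset.measurable_fun_sum _ fun k _ => hd.comp ?_).prodMk (measurable_xiIter n)
    exact (measurable_xiIter k).prodMk ((measurable_pi_apply k).comp measurable_snd)
  · intro a s s' h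
    have e : ∑ k ∈ Finset.range n, d (xiIter α γ a s k, s k) =
        ∑ k ∈ Finset.range n, d (xiIter α γ a s' k, s' k) :=
      Finset.sum_congr rfl fun k hk => by
        have hk := Finset.mem_range.1 hk
        rw [h k hk, xiIter_congr k fun i hi => h i (by lia)]
    simp only [e, xiIter_congr n h]

/-- Orthogonality of martingale differences: freezing the past integrates the last increment to
zero, so cross terms vanish. -/
lemma Run.integral_sq_sum_eq (R : Run P ξ₀ x ν) {d : ℝ × ℝ → ℝ} (hd : Measurable d)
    (hd0 : ∀ ξ, ∫ y, d (ξ, y) ∂ν = 0)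
    (hd2 : ∀ k, MemLp (fun ω => d (xiProc α γ ξ₀ x k ω, x k ω)) 2 P) (n : ℕ) :
    MemLp (fun ω => ∑ k ∈ Finset.range n, d (xiProc α γ ξ₀ x k ω, x k ω)) 2 P ∧
    ∫ ω, (∑ k ∈ Finset.range n, d (xiProc α γ ξ₀ x k ω, x k ω)) ^ 2 ∂P
      = ∑ k ∈ Finset.range n, ∫ ω, d (xiProc α γ ξ₀ x k ω, x k ω) ^ 2 ∂P := by
  have hM : ∀ n, MemLp (fun ω => ∑ k ∈ Finset.range n, d (xiProc α γ ξ₀ x k ω, x k ω)) 2 P :=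
    fun n => memLp_finsetSum _ fun k _ => hd2 k
  refine ⟨hM n, ?_⟩
  induction n with
  | zero => simp
  | succ n ih =>
    have hc : Integrable (fun ω => (∑ k ∈ Finset.range n, d (xiProc α γ ξ₀ x k ω, x k ω)) *
        d (xiProc α γ ξ₀ x n ω, x n ω)) P := (hM n).integrable_mul (hd2 n)
    have h0 : ∫ ω, (∑ k ∈ Finset.range n, d (xiProc α γ ξ₀ x k ω, x k ω)) *
        d (xiProc α γ ξ₀ x n ω, x n ω) ∂P = 0 := by
      have hU : Measurable fun ω =>
          (∑ k ∈ Finset.range n, d (xiProc α γ ξ₀ x k ω, x k ω), xiProc α γ ξ₀ x n ω) :=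
        (Finset.measurable_fun_sum _ fun k _ =>
          hd.comp ((R.measurable_xiProc k).prodMk (R.meas k))).prodMk (R.measurable_xiProc n)
      have := (integrable_and_integral_of_indepFun hU (R.meas n) (R.indepFun_sum_xiProc n hd)
        (Φ := fun p => p.1.1 * d (p.1.2, p.2)) (by fun_prop) hc).2
      simp only at this
      rw [this, R.law n]
      simp_rw [integral_const_mul, hd0]
      simp
    have e : ∀ ω, (∑ k ∈ Finset.range (n + 1), d (xiProc α γ ξ₀ x k ω, x k ω)) ^ 2 =
        (∑ k ∈ Finset.range n, d (xiProc α γ ξ₀ x k ω, x k ω)) ^ 2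
        + 2 * ((∑ k ∈ Finset.range n, d (xiProc α γ ξ₀ x k ω, x k ω)) *
          d (xiProc α γ ξ₀ x n ω, x n ω))
        + d (xiProc α γ ξ₀ x n ω, x n ω) ^ 2 := fun ω => by
      rw [Finset.sum_range_succ]; ring
    have i1 : Integrable (fun ω => (∑ k ∈ Finset.range n, d (xiProc α γ ξ₀ x k ω, x k ω)) ^ 2
        + 2 * ((∑ k ∈ Finset.range n, d (xiProc α γ ξ₀ x k ω, x k ω)) *
          d (xiProc α γ ξ₀ x n ω, x n ω))) P := (hM n).integrable_sq.add (hc.const_mul 2)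
    simp_rw [e]
    rw [integral_add i1 (hd2 n).integrable_sq, integral_add (hM n).integrable_sq (hc.const_mul 2),
      integral_const_mul, h0, ih, Finset.sum_range_succ]
    ring

/-- Mean square bound for sums of centered increments `ψ(ξ_k, x_k) - ∫ ψ(ξ_k, y) ν(dy)`. -/
lemma Run.integral_sq_centered_sum_le (R : Run P ξ₀ x ν) {ψ : ℝ × ℝ → ℝ} (hψ : Measurable ψ)
    {s B : ℝ} (hB : ∀ ξ y, |ψ (ξ, y)| ≤ B * (1 + |ξ - s|))
    (hD : ∀ k, MemLp (fun ω => xiProc α γ ξ₀ x k ω - s) 2 P)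
    {q : ℝ → ℝ} (hq : ∀ ξ, ∫ y, ψ (ξ, y) ^ 2 ∂ν ≤ q ξ)
    (hqi : ∀ k, Integrable (fun ω => q (xiProc α γ ξ₀ x k ω)) P) (n : ℕ) :
    MemLp (fun ω => ∑ k ∈ Finset.range n, (ψ (xiProc α γ ξ₀ x k ω, x k ω)
        - ∫ y, ψ (xiProc α γ ξ₀ x k ω, y) ∂ν)) 2 P ∧
    ∫ ω, (∑ k ∈ Finset.range n, (ψ (xiProc α γ ξ₀ x k ω, x k ω)
        - ∫ y, ψ (xiProc α γ ξ₀ x k ω, y) ∂ν)) ^ 2 ∂P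
      ≤ ∑ k ∈ Finset.range n, ∫ ω, q (xiProc α γ ξ₀ x k ω) ∂P := by
  have := R.isProbabilityMeasure
  have hm : ∀ ξ, MemLp (fun y => ψ (ξ, y)) 2 ν := fun ξ =>
    MemLp.of_bound (hψ.comp (measurable_const.prodMk measurable_id)).aestronglyMeasurable
      (B * (1 + |ξ - s|)) (ae_of_all _ fun y => hB ξ y)
  let d : ℝ × ℝ → ℝ := fun p => ψ p - ∫ y, ψ (p.1, y) ∂ν
  have hmi : Measurable fun ξ => ∫ y, ψ (ξ, y) ∂ν :=
    hψ.stronglyMeasurable.integral_prod_right'.measurable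
  have hd : Measurable d := hψ.sub (hmi.comp measurable_fst)
  have hd0 : ∀ ξ, ∫ y, d (ξ, y) ∂ν = 0 := fun ξ => by
    simp only [d]
    rw [integral_sub ((hm ξ).integrable one_le_two) (integrable_const _)]
    simp
  have hdb : ∀ ξ y, |d (ξ, y)| ≤ 2 * B * (1 + |ξ - s|) := fun ξ y => by
    have h1 : |∫ y, ψ (ξ, y) ∂ν| ≤ B * (1 + |ξ - s|) := by
      have := norm_integral_le_of_norm_le_const (μ := ν) (f := fun y => ψ (ξ, y))
        (ae_of_all _ fun y => hB ξ y)
      simpa using this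
    refine (abs_sub _ _).trans ?_
    have := hB ξ y
    linarith
  have hd2 : ∀ k, MemLp (fun ω => d (xiProc α γ ξ₀ x k ω, x k ω)) 2 P := fun k => by
    have hg : MemLp (fun ω => 2 * B * (1 + |xiProc α γ ξ₀ x k ω - s|)) 2 P := by
      have h1 : MemLp (fun _ : Ω => (1 : ℝ)) 2 P := memLp_const 1
      have h2 : MemLp (fun ω => |xiProc α γ ξ₀ x k ω - s|) 2 P := (hD k).abs
      have h3 : MemLp (fun ω => 1 + |xiProc α γ ξ₀ x k ω - s|) 2 P := h1.add h2
      exact h3.const_mul (2 * B)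
    exact MemLp.mono' hg
      (hd.comp ((R.measurable_xiProc k).prodMk (R.meas k))).aestronglyMeasurable
      (ae_of_all _ fun ω => hdb _ _)
  obtain ⟨h1, h2⟩ := R.integral_sq_sum_eq hd hd0 hd2 n
  refine ⟨h1, ?_⟩
  refine h2.le.trans (Finset.sum_le_sum fun k _ => ?_)
  obtain ⟨j1, j2⟩ := integrable_and_integral_of_indepFun (R.measurable_xiProc k) (R.meas k)
    (R.indepFun_xiProc (α := α) (γ := γ) k) (Φ := fun p => d p ^ 2) (hd.pow_const 2)
    (hd2 k).integrable_sq
  rw [j2]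
  refine integral_mono j1 (hqi k) fun ω => ?_
  rw [R.law k]
  refine le_trans ?_ (hq _)
  have hmm := hm (xiProc α γ ξ₀ x k ω)
  -- Centering can only decrease the second moment, so `q`, a bound for the uncentered one,
  -- suffices.
  have v1 := variance_eq_integral (μ := ν) hmm.aestronglyMeasurable.aemeasurable
  have v2 := variance_le_expectation_sq (μ := ν) hmm.aestronglyMeasurable
  rw [v1] at v2
  simpa [d] using v2

end Noise

/-! ### Step sizes and a discrete Gronwall estimate -/

section StepSizes

variable {γ₁ β : ℝ}

lemma stepSize_pos (hγ₁ : 0 < γ₁) {k : ℕ} (hk : 0 < k) : 0 < stepSize γ₁ β k := by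
  have : (0 : ℝ) < k := by exact_mod_cast hk
  unfold stepSize
  positivity

lemma stepSize_le (hγ₁ : 0 < γ₁) (hβ : 0 ≤ β) {k : ℕ} (hk : 0 < k) : stepSize γ₁ β k ≤ γ₁ := by
  have : (1 : ℝ) ≤ k := by exact_mod_cast hk
  unfold stepSize
  have := Real.rpow_le_one_of_one_le_of_nonpos this (neg_nonpos.2 hβ)
  nlinarith

lemma tendsto_stepSize (hβ : 0 < β) : Tendsto (stepSize γ₁ β) atTop (𝓝 0) := by
  have := ((tendsto_rpow_neg_atTop hβ).comp tendsto_natCast_atTop_atTop).const_mul γ₁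
  rw [mul_zero] at this
  exact this

/-- The ratio is `(1 + 1/k)^β`, at most `1 + 1/k` because `β ≤ 1`. -/
lemma stepSize_ratio (hγ₁ : 0 < γ₁) (hβ : β ≤ 1) {k : ℕ} (hk : 0 < k) :
    stepSize γ₁ β k ≤ (1 + 1 / (k : ℝ)) * stepSize γ₁ β (k + 1) := by
  have hk' : (0 : ℝ) < k := by exact_mod_cast hk
  unfold stepSize
  have h1 : ((k : ℝ) + 1) ^ β ≤ (1 + 1 / (k : ℝ)) * (k : ℝ) ^ β := by
    have e : (k : ℝ) + 1 = (1 + 1 / (k : ℝ)) * k := by field_simp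
    rw [e, Real.mul_rpow (by positivity) hk'.le]
    gcongr
    have : (1 : ℝ) ≤ 1 + 1 / (k : ℝ) := by
      have : (0 : ℝ) < 1 / k := by positivity
      linarith
    simpa using Real.rpow_le_rpow_of_exponent_le this hβ
  rw [Real.rpow_neg hk'.le, Real.rpow_neg (by positivity)]
  push_cast
  have h2 : 0 < (k : ℝ) ^ β := by positivity
  have h3 : 0 < ((k : ℝ) + 1) ^ β := by positivity
  rw [show (1 + 1 / (k : ℝ)) * (γ₁ * (((k : ℝ) + 1) ^ β)⁻¹)
    = γ₁ * ((1 + 1 / (k : ℝ)) * (((k : ℝ) + 1) ^ β)⁻¹) by ring]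
  gcongr
  rw [inv_le_iff_one_le_mul₀ h2]
  calc (1 : ℝ) = ((k : ℝ) + 1) ^ β * (((k : ℝ) + 1) ^ β)⁻¹ := by field_simp
    _ ≤ ((1 + 1 / (k : ℝ)) * (k : ℝ) ^ β) * (((k : ℝ) + 1) ^ β)⁻¹ := by gcongr
    _ = _ := by ring

/-- These differences are the weights produced by Abel summation of `(D_k - D_{k+1})/γ_{k+1}`. -/
lemma inv_stepSize_sub_le (hγ₁ : 0 < γ₁) (hβ : β ≤ 1) {k : ℕ} (hk : 0 < k) :
    (stepSize γ₁ β (k + 1))⁻¹ - (stepSize γ₁ β k)⁻¹ ≤ γ₁⁻¹ * (k : ℝ) ^ (β - 1) := by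
  have hk' : (0 : ℝ) < k := by exact_mod_cast hk
  have h0 := stepSize_pos (β := β) hγ₁ hk
  have h1 := stepSize_pos (β := β) hγ₁ (Nat.succ_pos k)
  have h2 := stepSize_ratio hγ₁ hβ hk
  have h3 : (stepSize γ₁ β (k + 1))⁻¹ ≤ (1 + 1 / (k : ℝ)) * (stepSize γ₁ β k)⁻¹ := by
    rw [inv_le_iff_one_le_mul₀ h1]
    calc (1 : ℝ) = stepSize γ₁ β k * (stepSize γ₁ β k)⁻¹ := by field_simp
      _ ≤ ((1 + 1 / (k : ℝ)) * stepSize γ₁ β (k + 1)) * (stepSize γ₁ β k)⁻¹ := by gcongr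
      _ = _ := by ring
  have h4 : 1 / (k : ℝ) * (stepSize γ₁ β k)⁻¹ = γ₁⁻¹ * (k : ℝ) ^ (β - 1) := by
    rw [Real.rpow_sub_one hk'.ne', stepSize, Real.rpow_neg hk'.le, mul_inv, inv_inv]
    field_simp
  linarith

lemma stepSize_antitone (hγ₁ : 0 < γ₁) (hβ : 0 ≤ β) {k : ℕ} (hk : 0 < k) :
    stepSize γ₁ β (k + 1) ≤ stepSize γ₁ β k := by
  have hk' : (0 : ℝ) < k := by exact_mod_cast hk
  refine mul_le_mul_of_nonneg_left ?_ hγ₁.le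
  exact Real.rpow_le_rpow_of_nonpos hk' (by push_cast; linarith : (k : ℝ) ≤ ((k + 1 : ℕ) : ℝ))
    (by linarith)

/-- Comparison with `∫₀ⁿ t^{-s} dt`, done by induction; Bernoulli's inequality for the concave power
`1 - s` gives the induction step. -/
lemma sum_rpow_neg_le {s : ℝ} (hs0 : 0 ≤ s) (hs1 : s < 1) (n : ℕ) :
    ∑ k ∈ Finset.Icc 1 n, (k : ℝ) ^ (-s) ≤ (n : ℝ) ^ (1 - s) / (1 - s) := by
  have h1s : 0 < 1 - s := by linarith
  induction n with
  | zero => simp [Real.zero_rpow h1s.ne']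
  | succ n ih =>
    rw [Finset.sum_Icc_succ_top (by lia)]
    have hn : (0 : ℝ) < (n : ℝ) + 1 := by positivity
    have hb : ((n : ℝ) / (n + 1)) ^ (1 - s) ≤ 1 - (1 - s) / ((n : ℝ) + 1) := by
      have := rpow_one_add_le_one_add_mul_self (s := -(1 / ((n : ℝ) + 1))) (p := 1 - s)
        (by rw [neg_le_neg_iff, div_le_one hn]; linarith [(Nat.cast_nonneg n : (0 : ℝ) ≤ n)])
        h1s.le (by linarith)
      calc _ = (1 + -(1 / ((n : ℝ) + 1))) ^ (1 - s) := by congr 1; field_simp; ring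
        _ ≤ _ := this
        _ = _ := by ring
    have hm : (n : ℝ) ^ (1 - s) ≤ ((n : ℝ) + 1) ^ (1 - s) - (1 - s) * ((n : ℝ) + 1) ^ (-s) := by
      have e : (n : ℝ) = ((n : ℝ) / (n + 1)) * (n + 1) := by field_simp
      calc (n : ℝ) ^ (1 - s) = ((n : ℝ) / (n + 1)) ^ (1 - s) * ((n : ℝ) + 1) ^ (1 - s) := by
            rw [← Real.mul_rpow (by positivity) hn.le, ← e]
        _ ≤ (1 - (1 - s) / ((n : ℝ) + 1)) * ((n : ℝ) + 1) ^ (1 - s) := by gcongr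
        _ = _ := by
            rw [show -s = (1 - s) - 1 by ring, Real.rpow_sub_one hn.ne']
            field_simp
            try ring
    push_cast
    calc _ ≤ (n : ℝ) ^ (1 - s) / (1 - s) + ((n : ℝ) + 1) ^ (-s) := by gcongr
      _ ≤ (((n : ℝ) + 1) ^ (1 - s) - (1 - s) * ((n : ℝ) + 1) ^ (-s)) / (1 - s)
          + ((n : ℝ) + 1) ^ (-s) := by gcongr
      _ = _ := by field_simp; ring

/-- A discrete Gronwall estimate: sequences contracted at rate `γ_k` up to errors of order `γ_k²`
are of order `γ_k`. -/
lemma exists_bound_of_recursion (hγ₁ : 0 < γ₁) (hβ0 : 0 < β) (hβ1 : β < 1) {c₁ C₂ : ℝ}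
    (hc₁ : 0 < c₁) (hC₂ : 0 ≤ C₂) (A : ℝ) :
    ∃ B : ℝ, 0 ≤ B ∧ ∀ (N : ℕ) (a : ℕ → ℝ), (∀ k, 0 ≤ a k) → a 0 ≤ A →
      (∀ k < N, a (k + 1) ≤ (1 - c₁ * stepSize γ₁ β (k + 1) + C₂ * stepSize γ₁ β (k + 1) ^ 2) * a k
        + C₂ * stepSize γ₁ β (k + 1) ^ 2) →
      ∀ k, 1 ≤ k → k ≤ N → a k ≤ B * stepSize γ₁ β k := by
  -- A bound at each fixed time, uniform over the sequences `a` and the horizons `N`. It handles the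
  -- initial segment on which the steps are still too large to contract.
  have hcrude : ∀ k : ℕ, ∃ Bk : ℝ, ∀ (N : ℕ) (a : ℕ → ℝ), (∀ k, 0 ≤ a k) → a 0 ≤ A →
      (∀ k < N, a (k + 1) ≤ (1 - c₁ * stepSize γ₁ β (k + 1) + C₂ * stepSize γ₁ β (k + 1) ^ 2) * a k
        + C₂ * stepSize γ₁ β (k + 1) ^ 2) → k ≤ N → a k ≤ Bk := by
    intro k
    induction k with
    | zero => exact ⟨A, fun N a _ h0 _ _ => h0⟩
    | succ k ih =>
      obtain ⟨Bk, hBk⟩ := ih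
      refine ⟨(1 + C₂ * stepSize γ₁ β (k + 1) ^ 2) * Bk + C₂ * stepSize γ₁ β (k + 1) ^ 2,
        fun N a hn h0 hr hk => ?_⟩
      have h1 := hBk N a hn h0 hr (by lia)
      have h2 := hr k (by lia)
      have h3 := stepSize_pos (β := β) hγ₁ (Nat.succ_pos k)
      have h4 : 0 ≤ C₂ * stepSize γ₁ β (k + 1) ^ 2 := by positivity
      have h5 : 0 ≤ c₁ * stepSize γ₁ β (k + 1) * a k := by have := hn k; positivity
      nlinarith
  choose Bf hBf using hcrude
  have hev1 : ∀ᶠ k : ℕ in atTop, C₂ * stepSize γ₁ β (k + 1) ≤ c₁ / 4 := by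
    have := ((tendsto_stepSize (γ₁ := γ₁) hβ0).comp (tendsto_add_atTop_nat 1)).const_mul C₂
    rw [mul_zero] at this
    exact this.eventually_le_const (by positivity)
  have hev2 : ∀ᶠ k : ℕ in atTop, c₁ * stepSize γ₁ β (k + 1) ≤ 1 := by
    have := ((tendsto_stepSize (γ₁ := γ₁) hβ0).comp (tendsto_add_atTop_nat 1)).const_mul c₁
    rw [mul_zero] at this
    exact this.eventually_le_const (by positivity)
  -- Here `β < 1` enters: the loss `1/k` in the ratio of steps is negligible against `γ_{k+1}`. The
  -- constant `8` is `4` doubled, to pass from `k + 1` to `k`.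
  have hev3 : ∀ᶠ k : ℕ in atTop, 1 / (k : ℝ) ≤ c₁ / 4 * stepSize γ₁ β (k + 1) := by
    have ht : Tendsto (fun k : ℕ => γ₁ * (((k + 1 : ℕ) : ℝ)) ^ (1 - β)) atTop atTop :=
      (((tendsto_rpow_atTop (by linarith : 0 < 1 - β)).comp tendsto_natCast_atTop_atTop).comp
        (tendsto_add_atTop_nat 1)).const_mul_atTop hγ₁
    filter_upwards [ht.eventually_ge_atTop (8 / c₁), eventually_ge_atTop 1] with k hk hk1
    have hk' : (1 : ℝ) ≤ k := by exact_mod_cast hk1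
    have hk0 : (0 : ℝ) < (k : ℝ) + 1 := by linarith
    have e : γ₁ * (((k + 1 : ℕ) : ℝ)) ^ (1 - β) = stepSize γ₁ β (k + 1) * ((k : ℝ) + 1) := by
      push_cast
      rw [show 1 - β = -β + 1 by ring, Real.rpow_add_one hk0.ne', stepSize]
      push_cast
      ring
    rw [e, div_le_iff₀ hc₁] at hk
    rw [div_le_iff₀ (by linarith)]
    have h3 := stepSize_pos (β := β) hγ₁ (Nat.succ_pos k)
    nlinarith [mul_nonneg (mul_nonneg hc₁.le h3.le) (by linarith : (0 : ℝ) ≤ k - 1)]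
  obtain ⟨k₁, hk₁⟩ := eventually_atTop.1 (hev1.and (hev2.and hev3))
  obtain ⟨M, hM⟩ := ((Finset.range (k₁ + 2)).image fun k => Bf k / stepSize γ₁ β k).exists_le
  have hM' : ∀ k, k ≤ k₁ + 1 → Bf k / stepSize γ₁ β k ≤ M := fun k hk =>
    hM _ (Finset.mem_image_of_mem _ (Finset.mem_range.2 (by lia)))
  -- `M` covers times up to `k₁ + 1`. Beyond them the net contraction left after the ratio loss is
  -- `c₁/2`, and `2 C₂/c₁` is the value from which it absorbs the source term `C₂ γ²`.
  refine ⟨max M (2 * C₂ / c₁), le_max_of_le_right (by positivity), fun N a hn h0 hr k => ?_⟩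
  induction k with
  | zero => intro h; lia
  | succ k ih =>
    intro _ hkN
    have hg := stepSize_pos (β := β) hγ₁ (Nat.succ_pos k)
    rcases le_or_gt (k + 1) (k₁ + 1) with hk | hk
    · have h1 := hBf (k + 1) N a hn h0 hr hkN
      have h2 := hM' (k + 1) hk
      rw [div_le_iff₀ hg] at h2
      calc a (k + 1) ≤ M * stepSize γ₁ β (k + 1) := h1.trans h2
        _ ≤ _ := by gcongr; exact le_max_left _ _
    · have hak := ih (by lia) (by lia)
      obtain ⟨e1, e2, e3⟩ := hk₁ k (by lia)
      have hrk := hr k (by lia)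
      have hrat := stepSize_ratio (γ₁ := γ₁) (β := β) hγ₁ hβ1.le (show 0 < k by lia)
      have hB : 2 * C₂ / c₁ ≤ max M (2 * C₂ / c₁) := le_max_right _ _
      have hB0 : 0 ≤ max M (2 * C₂ / c₁) := le_trans (by positivity) hB
      rw [div_le_iff₀ hc₁] at hB
      generalize max M (2 * C₂ / c₁) = B at *
      generalize stepSize γ₁ β (k + 1) = g at *
      have f1 : a k ≤ B * ((1 + c₁ / 4 * g) * g) := hak.trans (by
        gcongr
        refine hrat.trans ?_
        gcongr)
      have f2 : 1 - c₁ * g + C₂ * g ^ 2 ≤ 1 - 3 / 4 * c₁ * g := by nlinarith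
      have f3 : 0 ≤ 1 - 3 / 4 * c₁ * g := by nlinarith
      calc a (k + 1) ≤ (1 - c₁ * g + C₂ * g ^ 2) * a k + C₂ * g ^ 2 := hrk
        _ ≤ (1 - 3 / 4 * c₁ * g) * (B * ((1 + c₁ / 4 * g) * g)) + C₂ * g ^ 2 := by
            have := (mul_le_mul_of_nonneg_right f2 (hn k)).trans (mul_le_mul_of_nonneg_left f1 f3)
            linarith
        _ ≤ B * g := by
            have : 0 ≤ B * g * (c₁ * g) ^ 2 := by positivity
            nlinarith [mul_le_mul_of_nonneg_right hB (sq_nonneg g)]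

end StepSizes

/-! ### Hyperbolic inequalities for the Lyapunov function -/

section Cosh

lemma cosh_le_one_add_sq {b : ℝ} (hb : |b| ≤ 1) : Real.cosh b ≤ 1 + b ^ 2 := by
  have h1 := abs_le.1 (Real.abs_exp_sub_one_sub_id_le hb)
  have h2 := abs_le.1 (Real.abs_exp_sub_one_sub_id_le (x := -b) (by rwa [abs_neg]))
  rw [Real.cosh_eq]
  linarith [h1.2, h2.2, neg_sq b]

lemma abs_sinh_sub_self_le {b : ℝ} (hb : |b| ≤ 1) : |Real.sinh b - b| ≤ b ^ 2 := by
  have h1 := abs_le.1 (Real.abs_exp_sub_one_sub_id_le hb)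
  have h2 := abs_le.1 (Real.abs_exp_sub_one_sub_id_le (x := -b) (by rwa [abs_neg]))
  rw [Real.sinh_eq, abs_le]
  constructor <;> linarith [h1.1, h1.2, h2.1, h2.2, neg_sq b]

lemma abs_sinh_le_cosh (a : ℝ) : |Real.sinh a| ≤ Real.cosh a := by
  refine abs_le_of_sq_le_sq ?_ (Real.cosh_pos a).le
  linarith [Real.cosh_sq a]

/-- A second-order expansion whose error is relative to `cosh a`, so that the Lyapunov function
controls its own error. -/
lemma cosh_sub_le {a b : ℝ} (hb : |b| ≤ 1) :
    Real.cosh (a - b) ≤ Real.cosh a - b * Real.sinh a + 2 * b ^ 2 * Real.cosh a := by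
  rw [Real.cosh_sub]
  have h1 := cosh_le_one_add_sq hb
  have h2 := abs_sinh_sub_self_le hb
  have h3 := abs_sinh_le_cosh a
  have h4 : -(Real.sinh a * (Real.sinh b - b)) ≤ Real.cosh a * b ^ 2 := by
    refine (neg_le_abs _).trans ?_
    rw [abs_mul]
    gcongr
  nlinarith [Real.cosh_pos a]

/-- The reason for choosing `cosh - 1`: a restoring force saturating at distance one, multiplied by
the derivative `sinh`, still dominates the function itself, near zero and at infinity alike. -/
lemma cosh_sub_one_le_min_mul_sinh {t : ℝ} (ht : 0 ≤ t) :
    Real.cosh t - 1 ≤ min t 1 * Real.sinh t := by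
  rcases le_total t 1 with h | h
  · rw [min_eq_left h]
    have h1 := cosh_le_one_add_sq (b := t) (by rwa [abs_of_nonneg ht])
    have h2 := Real.self_le_sinh_iff.2 ht
    nlinarith
  · rw [min_eq_right h, one_mul]
    have h1 := Real.cosh_sub_sinh t
    have h2 : Real.exp (-t) ≤ 1 := Real.exp_le_one_iff.2 (by linarith)
    linarith

/-- A Young inequality based on `sinh² = (cosh - 1)² + 2(cosh - 1)`. It absorbs a nonzero mean field
`G` at the centre, at the price of a term quadratic in `G`. -/
lemma mul_abs_sinh_le {G ε : ℝ} (hG : 0 ≤ G) (hε : 0 < ε) (h : G ≤ ε) (a : ℝ) :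
    G * |Real.sinh a| ≤ ε * (Real.cosh a - 1) + G ^ 2 / ε := by
  have hc := Real.one_le_cosh a
  refine abs_le_of_sq_le_sq' ?_ (by have : 0 ≤ Real.cosh a - 1 := by linarith
                                    positivity) |>.2
  rw [mul_pow, sq_abs, Real.sinh_sq]
  have e : (ε * (Real.cosh a - 1) + G ^ 2 / ε) ^ 2
      = ε ^ 2 * (Real.cosh a - 1) ^ 2 + 2 * G ^ 2 * (Real.cosh a - 1) + (G ^ 2 / ε) ^ 2 := by
    field_simp
    ring
  rw [e]
  have : G ^ 2 ≤ ε ^ 2 := by gcongr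
  nlinarith [mul_le_mul_of_nonneg_right this (sq_nonneg (Real.cosh a - 1)), sq_nonneg (G ^ 2 / ε)]

/-- From `cosh a - 1 = 2 sinh²(a/2)`; it converts Lyapunov bounds into mean square bounds. -/
lemma sq_le_two_mul_cosh_sub_one (a : ℝ) : a ^ 2 ≤ 2 * (Real.cosh a - 1) := by
  have h1 : Real.cosh a - 1 = 2 * Real.sinh (a / 2) ^ 2 := by
    have := Real.cosh_two_mul (a / 2)
    rw [show 2 * (a / 2) = a by ring] at this
    linarith [Real.cosh_sq (a / 2)]
  have h2 : |a / 2| ≤ |Real.sinh (a / 2)| := by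
    rw [Real.abs_sinh]
    exact Real.self_le_sinh_iff.2 (abs_nonneg _)
  have h3 := sq_le_sq.2 h2
  rw [h1]
  nlinarith

end Cosh

/-! ### The mean field and its one-step contraction -/

section Law

/-- Quantitative regularity around `s` of the distribution function `F` of `ν`, with slope `b`
at `s`. -/
structure LawRegular (ν : Measure ℝ) (s b L κ : ℝ) : Prop where
  lip : ∀ ξ η, |ν.real (Set.Iio η) - ν.real (Set.Iio ξ)| ≤ L * |η - ξ|
  taylor : ∀ ξ, |ν.real (Set.Iio ξ) - ν.real (Set.Iio s) - b * (ξ - s)| ≤ L * (ξ - s) ^ 2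
  lower : ∀ ξ, κ * min |ξ - s| 1 ≤ |ν.real (Set.Iio ξ) - ν.real (Set.Iio s)|

/-- The mean field `E[H₁(ξ, X)]` of the VaR recursion, `X ∼ ν`. -/
def drift (α : ℝ) (ν : Measure ℝ) (ξ : ℝ) : ℝ := (1 / (1 - α)) * (ν.real (Set.Iio ξ) - α)

variable {α : ℝ} {ν : Measure ℝ} [IsProbabilityMeasure ν]

lemma integrable_H₁ (hα : α ∈ Set.Ioo (0 : ℝ) 1) (ξ : ℝ) : Integrable (fun y => H₁ α ξ y) ν :=
  Integrable.of_bound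
    (measurable_H₁.comp (measurable_const.prodMk measurable_id)).aestronglyMeasurable _
    (ae_of_all _ fun y => abs_H₁_le hα ξ y)

lemma integral_H₁ (hα : α ∈ Set.Ioo (0 : ℝ) 1) (ξ : ℝ) :
    ∫ y, H₁ α ξ y ∂ν = drift α ν ξ := by
  have h1 : 0 < 1 - α := by linarith [hα.2]
  have hi : Integrable ((Set.Ici ξ).indicator fun _ : ℝ => (1 : ℝ)) ν :=
    (integrable_const 1).indicator measurableSet_Ici
  simp only [H₁, drift]
  rw [integral_sub (integrable_const _) (hi.const_mul _), integral_const_mul,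
    integral_indicator measurableSet_Ici]
  have : ν.real (Set.Ici ξ) = 1 - ν.real (Set.Iio ξ) := by
    rw [← Set.compl_Iio, probReal_compl_eq_one_sub measurableSet_Iio]
  simp [this]
  field_simp
  ring

/-- By monotonicity of the distribution function, `drift ξ - drift s` has the sign of `ξ - s`, and
its size is at least of order `min(|ξ - s|, 1)`. The factor `min 1 l⁻¹` pays for rescaling this to
`min(l|ξ - s|, 1)`; the subtracted term is the mean field at `s`, nonzero for the biased laws. -/
lemma drift_mul_sinh_ge (hα : α ∈ Set.Ioo (0 : ℝ) 1) {s b L κ l : ℝ} (hκ : 0 < κ) (hl : 0 < l)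
    (hν : LawRegular ν s b L κ) (ξ : ℝ) :
    (1 / (1 - α) * κ * min 1 l⁻¹) * (Real.cosh (l * (ξ - s)) - 1)
      - |drift α ν s| * |Real.sinh (l * (ξ - s))| ≤ drift α ν ξ * Real.sinh (l * (ξ - s)) := by
  have h1 : 0 < 1 - α := by linarith [hα.2]
  have hc : 0 < 1 / (1 - α) := by positivity
  have hs : -(|drift α ν s| * |Real.sinh (l * (ξ - s))|)
      ≤ drift α ν s * Real.sinh (l * (ξ - s)) := by
    rw [← abs_mul]; exact neg_abs_le _
  have hdiff : drift α ν ξ - drift α ν s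
      = 1 / (1 - α) * (ν.real (Set.Iio ξ) - ν.real (Set.Iio s)) := by simp only [drift]; ring
  have hsign : (ν.real (Set.Iio ξ) - ν.real (Set.Iio s)) * Real.sinh (l * (ξ - s))
      = |ν.real (Set.Iio ξ) - ν.real (Set.Iio s)| * Real.sinh (l * |ξ - s|) := by
    rcases le_total s ξ with h | h
    · rw [abs_of_nonneg (sub_nonneg.2 h), abs_of_nonneg (sub_nonneg.2
        (measureReal_mono (Set.Iio_subset_Iio h)))]
    · rw [abs_of_nonpos (sub_nonpos.2 h), abs_of_nonpos (sub_nonpos.2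
        (measureReal_mono (Set.Iio_subset_Iio h))), mul_neg, Real.sinh_neg]
      ring
  have hsinh : 0 ≤ Real.sinh (l * |ξ - s|) := Real.sinh_nonneg_iff.2 (by positivity)
  have hmin : min 1 l⁻¹ * min (l * |ξ - s|) 1 ≤ min |ξ - s| 1 := by
    have a0 := abs_nonneg (ξ - s)
    refine le_min ?_ ?_
    · calc min 1 l⁻¹ * min (l * |ξ - s|) 1 ≤ l⁻¹ * (l * |ξ - s|) := by
            gcongr
            · exact min_le_right _ _
            · exact min_le_left _ _
        _ = |ξ - s| := by field_simp
    · calc min 1 l⁻¹ * min (l * |ξ - s|) 1 ≤ 1 * 1 := by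
            gcongr
            · exact min_le_left _ _
            · exact min_le_right _ _
        _ = 1 := by ring
  have hcosh : Real.cosh (l * (ξ - s)) = Real.cosh (l * |ξ - s|) := by
    rw [← Real.cosh_abs (l * (ξ - s)), abs_mul, abs_of_pos hl]
  have hW := cosh_sub_one_le_min_mul_sinh (t := l * |ξ - s|) (by positivity)
  have hlow := hν.lower ξ
  have hmain : 1 / (1 - α) * κ * min 1 l⁻¹ * (Real.cosh (l * (ξ - s)) - 1)
      ≤ (drift α ν ξ - drift α ν s) * Real.sinh (l * (ξ - s)) := by
    rw [hdiff, mul_assoc (1 / (1 - α)) (_ - _), hsign, hcosh, mul_assoc, mul_assoc]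
    refine mul_le_mul_of_nonneg_left ?_ hc.le
    have hm0 : (0 : ℝ) ≤ min 1 l⁻¹ := by positivity
    calc κ * (min 1 l⁻¹ * (Real.cosh (l * |ξ - s|) - 1))
        ≤ κ * (min 1 l⁻¹ * (min (l * |ξ - s|) 1 * Real.sinh (l * |ξ - s|))) := by gcongr
      _ = κ * (min 1 l⁻¹ * min (l * |ξ - s|) 1) * Real.sinh (l * |ξ - s|) := by ring
      _ ≤ κ * min |ξ - s| 1 * Real.sinh (l * |ξ - s|) := by gcongr
      _ ≤ _ := by gcongr
  linarith

/-- One-step estimate for the Lyapunov function `cosh (l (ξ - s)) - 1`. -/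
lemma integral_cosh_step_le (hα : α ∈ Set.Ioo (0 : ℝ) 1) {s b L κ l g M : ℝ} (hκ : 0 < κ)
    (hl : 0 < l) (hν : LawRegular ν s b L κ) (hg : 0 ≤ g) (hgl : l * g * (1 / (1 - α)) ≤ 1)
    (hd : |drift α ν s| ≤ 1 / (1 - α) * κ * min 1 l⁻¹ / 2) (hM : drift α ν s ^ 2 ≤ M * g) (ξ : ℝ) :
    ∫ y, (Real.cosh (l * (ξ - g * H₁ α ξ y - s)) - 1) ∂ν ≤
      (1 - l * (1 / (1 - α) * κ * min 1 l⁻¹ / 2) * g +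
        (2 * l ^ 2 * (1 / (1 - α)) ^ 2 + l * M / (1 / (1 - α) * κ * min 1 l⁻¹ / 2)) * g ^ 2)
          * (Real.cosh (l * (ξ - s)) - 1)
      + (2 * l ^ 2 * (1 / (1 - α)) ^ 2 + l * M / (1 / (1 - α) * κ * min 1 l⁻¹ / 2)) * g ^ 2 := by
  have h1 : 0 < 1 - α := by linarith [hα.2]
  have hc : 0 < 1 / (1 - α) := by positivity
  set c := 1 / (1 - α) with hcdef
  have he : 0 < c * κ * min 1 l⁻¹ / 2 := by positivity
  have hdr := drift_mul_sinh_ge hα hκ hl hν ξ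
  have hms := mul_abs_sinh_le (abs_nonneg (drift α ν s)) he hd (l * (ξ - s))
  rw [sq_abs] at hms
  set ε := c * κ * min 1 l⁻¹ / 2 with hε
  have hε2 : c * κ * min 1 l⁻¹ = 2 * ε := by rw [hε]; ring
  rw [← hcdef, hε2] at hdr
  set W := Real.cosh (l * (ξ - s)) with hW
  have hW1 : 1 ≤ W := Real.one_le_cosh _
  set S := Real.sinh (l * (ξ - s)) with hS
  have hpt : ∀ y, Real.cosh (l * (ξ - g * H₁ α ξ y - s)) - 1 ≤
      (W - 1 + 2 * (l * g * c) ^ 2 * W) - (l * g * S) * H₁ α ξ y := fun y => by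
    have hH := abs_H₁_le hα ξ y
    rw [← hcdef] at hH
    have hb' : |l * g * H₁ α ξ y| ≤ l * g * c := by
      rw [abs_mul, abs_of_nonneg (by positivity : 0 ≤ l * g)]
      gcongr
    have := cosh_sub_le (a := l * (ξ - s)) (hb'.trans hgl)
    have e : l * (ξ - g * H₁ α ξ y - s) = l * (ξ - s) - l * g * H₁ α ξ y := by ring
    have hsq : (l * g * H₁ α ξ y) ^ 2 ≤ (l * g * c) ^ 2 := by
      rw [← sq_abs]; gcongr
    rw [e]
    have := mul_le_mul_of_nonneg_right hsq (by linarith : (0 : ℝ) ≤ W)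
    simp only [← hW, ← hS] at *
    nlinarith
  have hi := integrable_H₁ (ν := ν) hα ξ
  have hint : ∫ y, (Real.cosh (l * (ξ - g * H₁ α ξ y - s)) - 1) ∂ν ≤
      (W - 1 + 2 * (l * g * c) ^ 2 * W) - (l * g * S) * drift α ν ξ := by
    have e : ∫ y, ((W - 1 + 2 * (l * g * c) ^ 2 * W) - (l * g * S) * H₁ α ξ y) ∂ν
        = (W - 1 + 2 * (l * g * c) ^ 2 * W) - (l * g * S) * drift α ν ξ := by
      rw [integral_sub (integrable_const _) (hi.const_mul _), integral_const_mul, integral_H₁ hα]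
      simp
    rw [← e]
    refine integral_mono_of_nonneg (ae_of_all _ fun y => ?_)
      ((integrable_const _).sub (hi.const_mul _)) (ae_of_all _ hpt)
    exact sub_nonneg.2 (Real.one_le_cosh _)
  refine hint.trans ?_
  have hlg : 0 ≤ l * g := by positivity
  -- The restoring rate is `2ε`: one half absorbs the mean field at `s`, the other remains as
  -- contraction. By `hM`, the residue `drift(s)²/ε` is of order `g`, hence of order `g²` after
  -- multiplication by the step.
  have h2 : l * g * (ε * (W - 1) - drift α ν s ^ 2 / ε) ≤ l * g * (drift α ν ξ * S) := by
    gcongr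
    linarith
  have h3 : l * g * (drift α ν s ^ 2 / ε) ≤ l * g * (M * g / ε) := by gcongr
  have h4 : 0 ≤ M * g := (sq_nonneg _).trans hM
  have h5 : 0 ≤ l * g * (M * g / ε) * (W - 1) := by
    have : 0 ≤ W - 1 := by linarith
    positivity
  have e1 : l * g * (M * g / ε) = l * M / ε * g ^ 2 := by ring
  rw [e1] at h3 h5
  nlinarith

end Law

/-! ### Mean square rate of the VaR iterates -/

section MomentBound

variable {Ω : Type*} [MeasurableSpace Ω] {P : Measure Ω} [IsProbabilityMeasure P]
  {ξ₀ : Ω → ℝ} {x : ℕ → Ω → ℝ} {ν : Measure ℝ} {α : ℝ} {γ : ℕ → ℝ}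

omit [IsProbabilityMeasure P] in
lemma Run.integrable_cosh (R : Run P ξ₀ x ν) (hα : α ∈ Set.Ioo (0 : ℝ) 1) {l s : ℝ} (hl : 0 < l)
    (hexp : Integrable (fun ω => Real.exp (l * |ξ₀ ω|)) P) (k : ℕ) :
    Integrable (fun ω => Real.cosh (l * (xiProc α γ ξ₀ x k ω - s))) P := by
  set C := (1 / (1 - α)) * ∑ j ∈ Finset.range k, |γ (j + 1)| with hC
  refine (hexp.const_mul (Real.exp (l * (C + |s|)))).mono'
    (Real.measurable_cosh.comp (((R.measurable_xiProc k).sub_const s).const_mul l)).aestronglyMeasurable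
    (ae_of_all _ fun ω => ?_)
  rw [Real.norm_eq_abs, abs_of_pos (Real.cosh_pos _), ← Real.exp_add, ← Real.cosh_abs]
  have h1 : ∀ t : ℝ, 0 ≤ t → Real.cosh t ≤ Real.exp t := fun t ht => by
    rw [← Real.cosh_add_sinh]; linarith [Real.sinh_nonneg_iff.2 ht]
  refine (h1 _ (abs_nonneg _)).trans (Real.exp_le_exp.2 ?_)
  rw [abs_mul, abs_of_pos hl]
  have h2 := abs_xiIter_sub_le (γ := γ) hα (ξ₀ ω) (fun k => x k ω) k
  have h3 : |xiProc α γ ξ₀ x k ω - s| ≤ C + |ξ₀ ω| + |s| := by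
    have e : xiProc α γ ξ₀ x k ω - s = (xiProc α γ ξ₀ x k ω - ξ₀ ω) + ξ₀ ω - s := by ring
    rw [e]
    refine (abs_sub _ _).trans (add_le_add_left ((abs_add_le _ _).trans ?_) _)
    gcongr
    exact h2
  nlinarith

omit [IsProbabilityMeasure P] in
lemma Run.memLp_sub (R : Run P ξ₀ x ν) (hα : α ∈ Set.Ioo (0 : ℝ) 1) {l : ℝ} (s : ℝ) (hl : 0 < l)
    (hexp : Integrable (fun ω => Real.exp (l * |ξ₀ ω|)) P) (k : ℕ) :
    MemLp (fun ω => xiProc α γ ξ₀ x k ω - s) 2 P := by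
  have hm : Measurable fun ω => xiProc α γ ξ₀ x k ω - s := (R.measurable_xiProc k).sub_const s
  rw [memLp_two_iff_integrable_sq hm.aestronglyMeasurable]
  refine ((R.integrable_cosh (γ := γ) (s := s) hα hl hexp k).const_mul (2 / l ^ 2)).mono'
    (hm.pow_const 2).aestronglyMeasurable (ae_of_all _ fun ω => ?_)
  rw [Real.norm_eq_abs, abs_of_nonneg (sq_nonneg _)]
  have := sq_le_two_mul_cosh_sub_one (l * (xiProc α γ ξ₀ x k ω - s))
  rw [div_mul_eq_mul_div, le_div_iff₀ (by positivity)]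
  nlinarith

/-- Mean square rate of the VaR iterates, uniform over runs with comparable data. -/
theorem exists_moment_bound (hα : α ∈ Set.Ioo (0 : ℝ) 1) {γ₁ β : ℝ} (hγ₁ : 0 < γ₁) (hβ0 : 0 < β)
    (hβ1 : β < 1) {κ l₀ : ℝ} (hκ : 0 < κ) (hl₀ : 0 < l₀) {M : ℝ} (hM : 0 ≤ M) (A s : ℝ) :
    ∃ B ε : ℝ, 0 ≤ B ∧ 0 < ε ∧ ∀ (ξ₀ : Ω → ℝ) (x : ℕ → Ω → ℝ) (ν : Measure ℝ) (b L : ℝ) (N : ℕ),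
      Run P ξ₀ x ν → LawRegular ν s b L κ →
      Integrable (fun ω => Real.exp (l₀ * |ξ₀ ω|)) P → ∫ ω, Real.exp (l₀ * |ξ₀ ω|) ∂P ≤ A →
      |drift α ν s| ≤ ε → (∀ k < N, drift α ν s ^ 2 ≤ M * stepSize γ₁ β (k + 1)) →
      (∀ k, MemLp (fun ω => xiProc α (stepSize γ₁ β) ξ₀ x k ω - s) 2 P) ∧
      (∫ ω, (xiProc α (stepSize γ₁ β) ξ₀ x 0 ω - s) ^ 2 ∂P ≤ B) ∧
      ∀ k, 1 ≤ k → k ≤ N →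
        ∫ ω, (xiProc α (stepSize γ₁ β) ξ₀ x k ω - s) ^ 2 ∂P ≤ B * stepSize γ₁ β k := by
  have h1 : 0 < 1 - α := by linarith [hα.2]
  have hc : 0 < 1 / (1 - α) := by positivity
  set c := 1 / (1 - α) with hcdef
  -- The first bound keeps the exponential moment of the initial value; the second makes every
  -- scaled increment at most one, as the expansion of `cosh` requires.
  set l := min l₀ (γ₁ * c)⁻¹ with hldef
  have hl : 0 < l := by positivity
  have hll : l ≤ l₀ := min_le_left _ _
  have hlc : l * γ₁ * c ≤ 1 := by
    calc l * γ₁ * c ≤ (γ₁ * c)⁻¹ * γ₁ * c := by gcongr; exact min_le_right _ _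
      _ = 1 := by field_simp
  set ε := c * κ * min 1 l⁻¹ / 2 with hε
  have hε0 : 0 < ε := by positivity
  set A' := A * Real.exp (l * |s|) with hA'
  obtain ⟨B, hB0, hB⟩ := exists_bound_of_recursion hγ₁ hβ0 hβ1 (c₁ := l * ε)
    (C₂ := 2 * l ^ 2 * c ^ 2 + l * M / ε) (by positivity) (by positivity) A'
  refine ⟨2 / l ^ 2 * (B + |A'|), ε, by positivity, hε0,
    fun ξ₀ x ν b L N R hν hexp hA hd hdM => ?_⟩
  have := R.isProbabilityMeasure
  have hexp' : Integrable (fun ω => Real.exp (l * |ξ₀ ω|)) P := by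
    refine hexp.mono' ?_ (ae_of_all _ fun ω => ?_)
    · exact (Real.measurable_exp.comp (R.meas_init.abs.const_mul l)).aestronglyMeasurable
    · rw [Real.norm_eq_abs, Real.abs_exp]; gcongr
  have hmem := fun k => R.memLp_sub (γ := stepSize γ₁ β) hα s hl hexp' k
  have hcosh := fun k => R.integrable_cosh (γ := stepSize γ₁ β) (s := s) hα hl hexp' k
  set a : ℕ → ℝ := fun k => ∫ ω, (Real.cosh (l * (xiProc α (stepSize γ₁ β) ξ₀ x k ω - s)) - 1) ∂P
    with ha
  have hcosh1 : ∀ k, Integrable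
      (fun ω => Real.cosh (l * (xiProc α (stepSize γ₁ β) ξ₀ x k ω - s)) - 1) P :=
    fun k => (hcosh k).sub (integrable_const _)
  have ha0 : ∀ k, 0 ≤ a k := fun k => integral_nonneg fun ω => sub_nonneg.2 (Real.one_le_cosh _)
  have hainit : a 0 ≤ A' := by
    have h2 : ∫ ω, Real.exp (l * |s|) * Real.exp (l₀ * |ξ₀ ω|) ∂P ≤ A' := by
      rw [integral_const_mul, hA', mul_comm]
      gcongr
    refine (integral_mono (hcosh1 0) (hexp.const_mul _) fun ω => ?_).trans h2
    simp only [xiProc, xiIter]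
    rw [← Real.exp_add]
    have h3 : Real.cosh (l * (ξ₀ ω - s)) ≤ Real.exp |l * (ξ₀ ω - s)| := by
      rw [← Real.cosh_abs, ← Real.cosh_add_sinh]
      linarith [Real.sinh_nonneg_iff.2 (abs_nonneg (l * (ξ₀ ω - s)))]
    have h4 : |l * (ξ₀ ω - s)| ≤ l * |s| + l₀ * |ξ₀ ω| := by
      rw [abs_mul, abs_of_pos hl]
      have := abs_sub (ξ₀ ω) s
      nlinarith [abs_nonneg (ξ₀ ω), abs_nonneg s]
    linarith [Real.exp_le_exp.2 h4]
  have hrec : ∀ k < N, a (k + 1) ≤ (1 - l * ε * stepSize γ₁ β (k + 1) +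
      (2 * l ^ 2 * c ^ 2 + l * M / ε) * stepSize γ₁ β (k + 1) ^ 2) * a k
        + (2 * l ^ 2 * c ^ 2 + l * M / ε) * stepSize γ₁ β (k + 1) ^ 2 := by
    intro k hk
    have hg := stepSize_pos (β := β) hγ₁ (Nat.succ_pos k)
    have hg1 := stepSize_le (β := β) hγ₁ hβ0.le (Nat.succ_pos k)
    have hΦm : Measurable fun p : ℝ × ℝ =>
        Real.cosh (l * (p.1 - stepSize γ₁ β (k + 1) * H₁ α p.1 p.2 - s)) - 1 :=
      (Real.measurable_cosh.comp ((((measurable_fst.sub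
        (measurable_H₁.const_mul _))).sub_const s).const_mul l)).sub_const 1
    obtain ⟨i1, i2⟩ := integrable_and_integral_of_indepFun (R.measurable_xiProc k) (R.meas k)
      (R.indepFun_xiProc (α := α) (γ := stepSize γ₁ β) k) hΦm (hcosh1 (k + 1))
    have e : a (k + 1) = ∫ ω, (∫ y, (Real.cosh (l * (xiProc α (stepSize γ₁ β) ξ₀ x k ω
        - stepSize γ₁ β (k + 1) * H₁ α (xiProc α (stepSize γ₁ β) ξ₀ x k ω) y - s)) - 1)
          ∂(P.map (x k))) ∂P := i2
    rw [e]
    have hub : Integrable (fun ω => (1 - l * ε * stepSize γ₁ β (k + 1) +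
      (2 * l ^ 2 * c ^ 2 + l * M / ε) * stepSize γ₁ β (k + 1) ^ 2)
        * (Real.cosh (l * (xiProc α (stepSize γ₁ β) ξ₀ x k ω - s)) - 1)
        + (2 * l ^ 2 * c ^ 2 + l * M / ε) * stepSize γ₁ β (k + 1) ^ 2) P :=
      ((hcosh1 k).const_mul _).add (integrable_const _)
    refine (integral_mono i1 hub fun ω => ?_).trans (le_of_eq ?_)
    · simp only [R.law k]
      exact integral_cosh_step_le hα hκ hl hν hg.le
        (le_trans (by gcongr) hlc) hd (hdM k hk) _
    · rw [integral_add ((hcosh1 k).const_mul _) (integrable_const _), integral_const_mul]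
      simp [ha]
  have hbd := hB N a ha0 hainit hrec
  have hsq : ∀ k, ∫ ω, (xiProc α (stepSize γ₁ β) ξ₀ x k ω - s) ^ 2 ∂P ≤ 2 / l ^ 2 * a k := by
    intro k
    rw [ha, ← integral_const_mul]
    refine integral_mono (hmem k).integrable_sq ((hcosh1 k).const_mul _) fun ω => ?_
    have := sq_le_two_mul_cosh_sub_one (l * (xiProc α (stepSize γ₁ β) ξ₀ x k ω - s))
    simp only
    rw [div_mul_eq_mul_div, le_div_iff₀ (by positivity)]
    nlinarith
  refine ⟨hmem, (hsq 0).trans ?_, fun k hk hkN => (hsq k).trans ?_⟩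
  · gcongr
    linarith [le_abs_self A']
  · have hg := stepSize_pos (β := β) hγ₁ (show 0 < k by lia)
    rw [mul_assoc]
    gcongr
    have := hbd k hk hkN
    nlinarith [abs_nonneg A']

end MomentBound

/-! ### Expansions in `ξ` around `s` -/

section Increments

variable {ν : Measure ℝ} [IsProbabilityMeasure ν] {α s b L κ : ℝ}

lemma measureReal_Ico_min_max (s ξ : ℝ) :
    ν.real (Set.Ico (min s ξ) (max s ξ)) = |ν.real (Set.Iio ξ) - ν.real (Set.Iio s)| := by
  have h : ∀ a b : ℝ, a ≤ b → ν.real (Set.Ico a b) = ν.real (Set.Iio b) - ν.real (Set.Iio a) := by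
    intro a b hab
    rw [← measureReal_sdiff (Set.Iio_subset_Iio hab) measurableSet_Iio]
    congr 1
    ext y
    simp
  rcases le_total s ξ with hs | hs
  · rw [min_eq_left hs, max_eq_right hs, h _ _ hs, abs_of_nonneg]
    exact sub_nonneg.2 (measureReal_mono (Set.Iio_subset_Iio hs))
  · rw [min_eq_right hs, max_eq_left hs, h _ _ hs, abs_sub_comm, abs_of_nonneg]
    exact sub_nonneg.2 (measureReal_mono (Set.Iio_subset_Iio hs))

/-- The indicators differ exactly between `s` and `ξ`. The second moment is therefore only of first
order in `|ξ - s|`, which is the source of the exponent `1 - β/2` in the martingale bound. -/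
lemma sq_H₁_sub_eq (ξ y : ℝ) : (H₁ α ξ y - H₁ α s y) ^ 2 =
    (1 / (1 - α)) ^ 2 * (Set.Ico (min s ξ) (max s ξ)).indicator (fun _ => (1 : ℝ)) y := by
  rcases le_total s ξ with hs | hs
  · rw [min_eq_left hs, max_eq_right hs]
    by_cases h1 : s ≤ y <;> by_cases h2 : ξ ≤ y
    · simp [H₁, h1, h2, not_lt.2 h2]
    · simp [H₁, h1, h2, not_le.1 h2]
    · exact absurd (hs.trans h2) h1
    · simp [H₁, h1, h2]
  · rw [min_eq_right hs, max_eq_left hs]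
    by_cases h1 : s ≤ y <;> by_cases h2 : ξ ≤ y
    · simp [H₁, h1, h2, not_lt.2 h1]
    · exact absurd (hs.trans h1) h2
    · simp [H₁, h1, h2, not_le.1 h1]
    · simp [H₁, h1, h2]

lemma integral_sq_H₁_sub_le (hν : LawRegular ν s b L κ) (ξ : ℝ) :
    ∫ y, (H₁ α ξ y - H₁ α s y) ^ 2 ∂ν ≤ (1 / (1 - α)) ^ 2 * (L * |ξ - s|) := by
  simp_rw [sq_H₁_sub_eq]
  rw [integral_const_mul, integral_indicator measurableSet_Ico]
  have := hν.lip s ξ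
  have e := measureReal_Ico_min_max (ν := ν) s ξ
  simp only [integral_const, measureReal_restrict_apply_univ, smul_eq_mul, mul_one, e]
  gcongr

/-- The integrand `ξ + (1 - α)⁻¹ (y - ξ)⁺` of the objective function. -/
def rho (α ξ y : ℝ) : ℝ := ξ + (1 / (1 - α)) * max (y - ξ) 0

lemma measurable_rho : Measurable fun p : ℝ × ℝ => rho α p.1 p.2 := by
  unfold rho
  fun_prop

lemma abs_rho_sub_le (hα : α ∈ Set.Ioo (0 : ℝ) 1) (ξ y : ℝ) :
    |rho α ξ y - rho α s y| ≤ (1 + 1 / (1 - α)) * |ξ - s| := by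
  have h1 : 0 < 1 - α := by linarith [hα.2]
  have hc : 0 < 1 / (1 - α) := by positivity
  have e : rho α ξ y - rho α s y =
      (ξ - s) + 1 / (1 - α) * (max (y - ξ) 0 - max (y - s) 0) := by simp only [rho]; ring
  rw [e, add_mul, one_mul]
  refine (abs_add_le _ _).trans ?_
  rw [abs_mul, abs_of_pos hc]
  refine add_le_add_right (mul_le_mul_of_nonneg_left ?_ hc.le) _
  have := abs_max_sub_max_le_abs (y - ξ) (y - s) 0
  rwa [show y - ξ - (y - s) = -(ξ - s) by ring, abs_neg] at this

/-- `H₁(s, y)` is the derivative of the piecewise affine map `ξ ↦ rho ξ y` at `s`, up to the value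
at the kink; the first-order expansion is exact unless `y` lies between `s` and `ξ`. -/
lemma abs_rho_sub_sub_le (hα : α ∈ Set.Ioo (0 : ℝ) 1) (ξ y : ℝ) :
    |rho α ξ y - rho α s y - (ξ - s) * H₁ α s y| ≤ 1 / (1 - α) * |ξ - s| *
      (Set.Ico (min s ξ) (max s ξ)).indicator (fun _ => (1 : ℝ)) y := by
  have h1 : 0 < 1 - α := by linarith [hα.2]
  have hc : 0 < 1 / (1 - α) := by positivity
  have e : rho α ξ y - rho α s y - (ξ - s) * H₁ α s y = 1 / (1 - α) *
      (max (y - ξ) 0 - max (y - s) 0 + (ξ - s) * (Set.Ici s).indicator (fun _ => (1 : ℝ)) y) := by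
    simp only [rho, H₁]; ring
  rw [e, abs_mul, abs_of_pos hc, mul_assoc]
  refine mul_le_mul_of_nonneg_left ?_ hc.le
  rcases le_total s ξ with hs | hs
  · rw [min_eq_left hs, max_eq_right hs, abs_of_nonneg (sub_nonneg.2 hs)]
    by_cases h1 : s ≤ y <;> by_cases h2 : ξ ≤ y
    · rw [max_eq_left (by linarith), max_eq_left (by linarith)]
      simp [h1, not_lt.2 h2]
    · rw [max_eq_right (by linarith), max_eq_left (by linarith)]
      simp only [Set.indicator, Set.mem_Ici, Set.mem_Ico, h1, not_le.1 h2, and_self, if_true]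
      rw [abs_of_nonneg (by linarith)]
      linarith
    · exact absurd (hs.trans h2) h1
    · rw [max_eq_right (by linarith), max_eq_right (by linarith)]
      simp [h1]
  · rw [min_eq_right hs, max_eq_left hs, abs_of_nonpos (sub_nonpos.2 hs)]
    by_cases h1 : s ≤ y <;> by_cases h2 : ξ ≤ y
    · rw [max_eq_left (by linarith), max_eq_left (by linarith)]
      simp [h1, not_lt.2 h1]
    · exact absurd (hs.trans h1) h2
    · rw [max_eq_left (by linarith), max_eq_right (by linarith)]
      simp only [Set.indicator, Set.mem_Ici, Set.mem_Ico, h1, h2, not_le.1 h1, and_self, if_true,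
        if_false]
      rw [abs_of_nonneg (by linarith)]
      linarith
    · rw [max_eq_right (by linarith), max_eq_right (by linarith)]
      simp [h1, h2]

/-- The first-order term averages to the mean field at `s`. The error is at most `c|ξ - s|` on an
interval of mass at most `L|ξ - s|`. -/
lemma abs_integral_rho_sub_le (hα : α ∈ Set.Ioo (0 : ℝ) 1) (hν : LawRegular ν s b L κ) (ξ : ℝ) :
    |∫ y, (rho α ξ y - rho α s y) ∂ν| ≤
      |drift α ν s| * |ξ - s| + 1 / (1 - α) * L * (ξ - s) ^ 2 := by
  have h1 : 0 < 1 - α := by linarith [hα.2]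
  have hc : 0 < 1 / (1 - α) := by positivity
  have hm : Measurable fun y => rho α ξ y - rho α s y :=
    (measurable_rho.comp (measurable_const.prodMk measurable_id)).sub
      (measurable_rho.comp (measurable_const.prodMk measurable_id))
  have hi : Integrable (fun y => rho α ξ y - rho α s y) ν :=
    Integrable.of_bound hm.aestronglyMeasurable _ (ae_of_all _ fun y => abs_rho_sub_le hα ξ y)
  have hH := integrable_H₁ (ν := ν) hα s
  have e : ∫ y, (rho α ξ y - rho α s y) ∂ν = (ξ - s) * drift α ν s
      + ∫ y, (rho α ξ y - rho α s y - (ξ - s) * H₁ α s y) ∂ν := by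
    rw [integral_sub hi (hH.const_mul _), integral_const_mul, integral_H₁ hα]
    ring
  rw [e]
  refine (abs_add_le _ _).trans ?_
  rw [abs_mul, mul_comm]
  gcongr
  have hind : Integrable (fun y => 1 / (1 - α) * |ξ - s| *
      (Set.Ico (min s ξ) (max s ξ)).indicator (fun _ => (1 : ℝ)) y) ν :=
    ((integrable_const _).indicator measurableSet_Ico).const_mul _
  refine (norm_integral_le_of_norm_le hind
    (ae_of_all _ fun y => (Real.norm_eq_abs _).trans_le (abs_rho_sub_sub_le hα ξ y))).trans ?_
  rw [integral_const_mul, integral_indicator measurableSet_Ico]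
  have e2 := measureReal_Ico_min_max (ν := ν) s ξ
  simp only [integral_const, measureReal_restrict_apply_univ, smul_eq_mul, mul_one, e2]
  have := hν.lip s ξ
  calc 1 / (1 - α) * |ξ - s| * |ν.real (Set.Iio ξ) - ν.real (Set.Iio s)|
      ≤ 1 / (1 - α) * |ξ - s| * (L * |ξ - s|) := by gcongr
    _ = _ := by rw [← sq_abs (ξ - s)]; ring

omit [IsProbabilityMeasure ν] in
lemma abs_drift_sub_le (hα : α ∈ Set.Ioo (0 : ℝ) 1) (hν : LawRegular ν s b L κ) (ξ : ℝ) :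
    |drift α ν ξ - drift α ν s - 1 / (1 - α) * b * (ξ - s)| ≤
      1 / (1 - α) * L * (ξ - s) ^ 2 := by
  have h1 : 0 < 1 - α := by linarith [hα.2]
  have hc : 0 < 1 / (1 - α) := by positivity
  have e : drift α ν ξ - drift α ν s - 1 / (1 - α) * b * (ξ - s) =
      1 / (1 - α) * (ν.real (Set.Iio ξ) - ν.real (Set.Iio s) - b * (ξ - s)) := by
    simp only [drift]; ring
  rw [e, abs_mul, abs_of_pos hc, mul_assoc]
  gcongr
  exact hν.taylor ξ

end Increments

/-! ### Exact summation identities -/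

section Identities

variable {α : ℝ} {γ : ℕ → ℝ}

/-- The step `1/(n+1)` makes the ES iterates plain averages. -/
lemma mul_chiIter (a : ℝ) (u : ℕ → ℝ) (n : ℕ) :
    n * chiIter α γ a u n = ∑ k ∈ Finset.range n, rho α (xiIter α γ a u k) (u k) := by
  induction n with
  | zero => simp
  | succ n ih =>
    rw [Finset.sum_range_succ, ← ih]
    simp only [chiIter, H₂, rho]
    have : (n : ℝ) + 1 ≠ 0 := by positivity
    push_cast
    field_simp
    ring

lemma sum_range_sub_div (D : ℕ → ℝ) (n : ℕ) :
    ∑ k ∈ Finset.range (n + 1), (D k - D (k + 1)) / γ (k + 1) =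
      D 0 / γ 1 - D (n + 1) / γ (n + 1)
        + ∑ k ∈ Finset.Icc 1 n, D k * ((γ (k + 1))⁻¹ - (γ k)⁻¹) := by
  induction n with
  | zero => simp [sub_div]
  | succ n ih =>
    rw [Finset.sum_range_succ, ih, Finset.sum_Icc_succ_top (by lia)]
    simp only [div_eq_mul_inv]
    ring

end Identities

/-! ### Orders of magnitude at `N = K²` -/

section Rate

variable {β : ℝ}

/-- Order of magnitude of the remainders after `n` iterations. -/
def rate (β : ℝ) (n : ℕ) : ℝ :=
  1 + (n : ℝ) ^ (1 - β) + (n : ℝ) ^ (β / 2) + √(1 + (n : ℝ) ^ (1 - β / 2))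

lemma tendsto_pnat_cast : Tendsto (fun K : ℕ+ => (K : ℝ)) atTop atTop :=
  tendsto_natCast_atTop_atTop.comp tendsto_PNat_val_atTop_atTop

/-- The expression is `K^{2p - 1}`. -/
lemma tendsto_sq_rpow_div {p : ℝ} (hp : p < 1 / 2) :
    Tendsto (fun K : ℕ+ => (K : ℝ)⁻¹ * (((K : ℕ) ^ 2 : ℕ) : ℝ) ^ p) atTop (𝓝 0) := by
  have h := (tendsto_rpow_neg_atTop (y := 1 - 2 * p) (by linarith)).comp tendsto_pnat_cast
  refine h.congr fun K => ?_
  have hK : (0 : ℝ) < K := by exact_mod_cast K.pos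
  simp only [Function.comp_apply]
  push_cast
  rw [← Real.rpow_natCast, ← Real.rpow_mul hK.le, ← Real.rpow_neg_one, ← Real.rpow_add hK]
  congr 1
  push_cast
  ring

/-- The expression is `K^{-β}`. One factor `1/K` is the normalization, the other comes from the size
of the mean field at `s`. -/
lemma tendsto_inv_sq_mul_rpow (hβ : β ∈ Set.Ioo (1 / 2 : ℝ) 1) :
    Tendsto (fun K : ℕ+ => (K : ℝ)⁻¹ * ((K : ℝ)⁻¹ * (((K : ℕ) ^ 2 : ℕ) : ℝ) ^ (1 - β / 2)))
      atTop (𝓝 0) := by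
  refine (tendsto_sq_rpow_div (p := (1 - β) / 2) (by linarith [hβ.1])).congr fun K => ?_
  have hK : (0 : ℝ) < K := by exact_mod_cast K.pos
  congr 1
  push_cast
  rw [← Real.rpow_natCast, ← Real.rpow_mul hK.le, ← Real.rpow_mul hK.le, ← Real.rpow_neg_one,
    ← Real.rpow_add hK]
  congr 1
  push_cast
  ring

/-- The term `N^{1-β}` requires `β > 1/2`, the term `N^{β/2}` requires `β < 1`; the square root
contributes order `K^{-β/2}`. -/
lemma tendsto_inv_mul_rate (hβ : β ∈ Set.Ioo (1 / 2 : ℝ) 1) :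
    Tendsto (fun K : ℕ+ => (K : ℝ)⁻¹ * rate β ((K : ℕ) ^ 2)) atTop (𝓝 0) := by
  have h0 : Tendsto (fun K : ℕ+ => (K : ℝ)⁻¹) atTop (𝓝 0) :=
    tendsto_inv_atTop_zero.comp tendsto_pnat_cast
  have h1 := tendsto_sq_rpow_div (p := 1 - β) (by linarith [hβ.1])
  have h2 := tendsto_sq_rpow_div (p := β / 2) (by linarith [hβ.2])
  have h3 : Tendsto (fun K : ℕ+ => √((K : ℝ)⁻¹ * (K : ℝ)⁻¹
      + (K : ℝ)⁻¹ * ((K : ℝ)⁻¹ * (((K : ℕ) ^ 2 : ℕ) : ℝ) ^ (1 - β / 2)))) atTop (𝓝 0) := by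
    have h4 := tendsto_inv_sq_mul_rpow hβ
    have := ((h0.mul h0).add h4).sqrt
    simpa using this
  have := ((h0.add h1).add h2).add h3
  simp only [add_zero] at this
  refine this.congr fun K => ?_
  have hK : (0 : ℝ) < K := by exact_mod_cast K.pos
  have e : √((K : ℝ)⁻¹ * (K : ℝ)⁻¹
      + (K : ℝ)⁻¹ * ((K : ℝ)⁻¹ * (((K : ℕ) ^ 2 : ℕ) : ℝ) ^ (1 - β / 2)))
      = (K : ℝ)⁻¹ * √(1 + (((K : ℕ) ^ 2 : ℕ) : ℝ) ^ (1 - β / 2)) := by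
    rw [show (K : ℝ)⁻¹ * (K : ℝ)⁻¹ + (K : ℝ)⁻¹ * ((K : ℝ)⁻¹ * (((K : ℕ) ^ 2 : ℕ) : ℝ) ^ (1 - β / 2))
      = (K : ℝ)⁻¹ ^ 2 * (1 + (((K : ℕ) ^ 2 : ℕ) : ℝ) ^ (1 - β / 2)) by ring,
      Real.sqrt_mul (by positivity), Real.sqrt_sq (by positivity)]
  rw [e, rate]
  ring

end Rate

/-! ### Remainders of the linearization, in `L¹` -/

section Remainders

/-- Time zero is kept apart: the initial error is merely bounded and no power of `k` describes it.
-/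
lemma sum_range_le_of_rpow {u : ℕ → ℝ} {A₀ A₁ p : ℝ} {N : ℕ} (hu : ∀ k, 0 ≤ u k) (h0 : u 0 ≤ A₀)
    (hA₁ : 0 ≤ A₁) (hp0 : 0 ≤ p) (hp1 : p < 1)
    (h1 : ∀ k, 1 ≤ k → k ≤ N → u k ≤ A₁ * (k : ℝ) ^ (-p)) :
    ∑ k ∈ Finset.range N, u k ≤ A₀ + A₁ * ((N : ℝ) ^ (1 - p) / (1 - p)) := by
  have hsub : Finset.range N ⊆ insert 0 (Finset.Icc 1 N) := fun k hk => by
    have := Finset.mem_range.1 hk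
    simp only [Finset.mem_insert, Finset.mem_Icc]
    lia
  calc ∑ k ∈ Finset.range N, u k ≤ ∑ k ∈ insert 0 (Finset.Icc 1 N), u k :=
        Finset.sum_le_sum_of_subset_of_nonneg hsub fun k _ _ => hu k
    _ = u 0 + ∑ k ∈ Finset.Icc 1 N, u k := Finset.sum_insert (by simp)
    _ ≤ A₀ + ∑ k ∈ Finset.Icc 1 N, A₁ * (k : ℝ) ^ (-p) := by
        gcongr with k hk
        exact h1 k (Finset.mem_Icc.1 hk).1 (Finset.mem_Icc.1 hk).2
    _ ≤ _ := by
        rw [← Finset.mul_sum]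
        gcongr
        exact sum_rpow_neg_le hp0 hp1 N

variable {Ω : Type*} [MeasurableSpace Ω] {P : Measure Ω} [IsProbabilityMeasure P]
  {ξ₀ : Ω → ℝ} {x : ℕ → Ω → ℝ} {ν : Measure ℝ} {α γ₁ β s b L κ B : ℝ} {N : ℕ}

/-- Mean square control of a run up to time `N`. -/
structure Controlled (P : Measure Ω) (α γ₁ β s B : ℝ) (ξ₀ : Ω → ℝ) (x : ℕ → Ω → ℝ) (N : ℕ) :
    Prop where
  memLp : ∀ k, MemLp (fun ω => xiProc α (stepSize γ₁ β) ξ₀ x k ω - s) 2 P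
  init : ∫ ω, (xiProc α (stepSize γ₁ β) ξ₀ x 0 ω - s) ^ 2 ∂P ≤ B
  le : ∀ k, 1 ≤ k → k ≤ N →
    ∫ ω, (xiProc α (stepSize γ₁ β) ξ₀ x k ω - s) ^ 2 ∂P ≤ B * stepSize γ₁ β k

lemma Controlled.integral_abs_le (h : Controlled P α γ₁ β s B ξ₀ x N) (hγ₁ : 0 < γ₁) (hB : 0 ≤ B)
    {k : ℕ} (hk : 1 ≤ k) (hkN : k ≤ N) :
    ∫ ω, |xiProc α (stepSize γ₁ β) ξ₀ x k ω - s| ∂P ≤ √(B * γ₁) * (k : ℝ) ^ (-(β / 2)) := by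
  refine (integral_abs_le_sqrt (h.memLp k)).trans ?_
  have e : √(B * γ₁) * (k : ℝ) ^ (-(β / 2)) = √(B * stepSize γ₁ β k) := by
    have e2 : √((k : ℝ) ^ (-β)) = (k : ℝ) ^ (-(β / 2)) := by
      rw [Real.sqrt_eq_rpow, ← Real.rpow_mul (by positivity)]
      congr 1
      ring
    rw [stepSize, ← mul_assoc, Real.sqrt_mul (by positivity : 0 ≤ B * γ₁), e2]
  rw [e]
  exact Real.sqrt_le_sqrt (h.le k hk hkN)

lemma Controlled.integral_abs_init_le (h : Controlled P α γ₁ β s B ξ₀ x N) :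
    ∫ ω, |xiProc α (stepSize γ₁ β) ξ₀ x 0 ω - s| ∂P ≤ √B :=
  (integral_abs_le_sqrt (h.memLp 0)).trans (Real.sqrt_le_sqrt h.init)

lemma Controlled.sum_integral_abs_le (h : Controlled P α γ₁ β s B ξ₀ x N) (hγ₁ : 0 < γ₁)
    (hβ : β ∈ Set.Ioo (1 / 2 : ℝ) 1) (hB : 0 ≤ B) :
    ∑ k ∈ Finset.range N, ∫ ω, |xiProc α (stepSize γ₁ β) ξ₀ x k ω - s| ∂P ≤
      (√B + 2 * √(B * γ₁)) * (1 + (N : ℝ) ^ (1 - β / 2)) := by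
  have h1 := sum_range_le_of_rpow (p := β / 2) (N := N)
    (u := fun k => ∫ ω, |xiProc α (stepSize γ₁ β) ξ₀ x k ω - s| ∂P)
    (fun k => integral_nonneg fun ω => abs_nonneg _) h.integral_abs_init_le
    (Real.sqrt_nonneg (B * γ₁)) (by linarith [hβ.1]) (by linarith [hβ.2])
    (fun k hk hkN => h.integral_abs_le hγ₁ hB hk hkN)
  refine h1.trans ?_
  have h2 : (N : ℝ) ^ (1 - β / 2) / (1 - β / 2) ≤ 2 * (N : ℝ) ^ (1 - β / 2) := by
    have h0 : 0 < 1 - β / 2 := by linarith [hβ.2]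
    rw [div_le_iff₀ h0]
    have : 0 ≤ (N : ℝ) ^ (1 - β / 2) := by positivity
    nlinarith [hβ.2]
  have h3 := mul_le_mul_of_nonneg_left h2 (Real.sqrt_nonneg (B * γ₁))
  have h4 : 0 ≤ (N : ℝ) ^ (1 - β / 2) := by positivity
  nlinarith [Real.sqrt_nonneg B, Real.sqrt_nonneg (B * γ₁), mul_nonneg (Real.sqrt_nonneg B) h4]

omit [IsProbabilityMeasure P] in
lemma Controlled.sum_integral_sq_le (h : Controlled P α γ₁ β s B ξ₀ x N) (hγ₁ : 0 < γ₁)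
    (hβ : β ∈ Set.Ioo (1 / 2 : ℝ) 1) (hB : 0 ≤ B) :
    ∑ k ∈ Finset.range N, ∫ ω, (xiProc α (stepSize γ₁ β) ξ₀ x k ω - s) ^ 2 ∂P ≤
      (B + B * γ₁ / (1 - β)) * (1 + (N : ℝ) ^ (1 - β)) := by
  have h0 : 0 < 1 - β := by linarith [hβ.2]
  have h1 := sum_range_le_of_rpow (p := β) (N := N) (A₁ := B * γ₁)
    (u := fun k => ∫ ω, (xiProc α (stepSize γ₁ β) ξ₀ x k ω - s) ^ 2 ∂P)
    (fun k => integral_nonneg fun ω => sq_nonneg _) h.init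
    (by positivity) (by linarith [hβ.1]) hβ.2
    (fun k hk hkN => (h.le k hk hkN).trans (by rw [stepSize, mul_assoc]))
  refine h1.trans ?_
  have h4 : 0 ≤ (N : ℝ) ^ (1 - β) := by positivity
  have e : B * γ₁ * ((N : ℝ) ^ (1 - β) / (1 - β)) = B * γ₁ / (1 - β) * (N : ℝ) ^ (1 - β) := by ring
  rw [e]
  have : 0 ≤ B * γ₁ / (1 - β) := by positivity
  nlinarith [mul_nonneg hB h4]

lemma sqrt_mul_one_add_le {C q t : ℝ} (hC : 0 ≤ C) (h : t ≤ C * (1 + q)) :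
    √t ≤ √C * √(1 + q) := by
  rw [← Real.sqrt_mul hC]
  exact Real.sqrt_le_sqrt h

set_option maxHeartbeats 1000000 in
/-- Linearization of the averaged VaR iterates, with an `L¹` remainder. -/
lemma Controlled.integral_xi_remainder_le (h : Controlled P α γ₁ β s B ξ₀ x N)
    (R : Run P ξ₀ x ν) (hν : LawRegular ν s b L κ) (hα : α ∈ Set.Ioo (0 : ℝ) 1) (hγ₁ : 0 < γ₁)
    (hβ : β ∈ Set.Ioo (1 / 2 : ℝ) 1) (hB : 0 ≤ B) (hL : 0 ≤ L) (hbL : |b| ≤ L) (hN : 1 ≤ N) :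
    ∫ ω, |1 / (1 - α) * b * ∑ k ∈ Finset.Icc 1 N, (xiProc α (stepSize γ₁ β) ξ₀ x k ω - s)
        + ∑ k ∈ Finset.range N, H₁ α s (x k ω)| ∂P ≤
      ((1 / (1 - α) * L + γ₁⁻¹) * (√B + √(B * γ₁)) + 4 * γ₁⁻¹ * √(B * γ₁)
        + 1 / (1 - α) * L * (B + B * γ₁ / (1 - β))
        + √((1 / (1 - α)) ^ 2 * L * (√B + 2 * √(B * γ₁)))) * rate β N := by
  have := R.isProbabilityMeasure
  have h1 : 0 < 1 - α := by linarith [hα.2]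
  have hc : 0 < 1 / (1 - α) := by positivity
  set c := 1 / (1 - α) with hcdef
  obtain ⟨n, rfl⟩ : ∃ n, N = n + 1 := ⟨N - 1, by lia⟩
  set D : ℕ → Ω → ℝ := fun k ω => xiProc α (stepSize γ₁ β) ξ₀ x k ω - s with hD
  have hDm : ∀ k, MemLp (D k) 2 P := h.memLp
  have hDi : ∀ k, Integrable (fun ω => |D k ω|) P := fun k =>
    ((hDm k).integrable one_le_two).abs
  have hDsq : ∀ k, Integrable (fun ω => D k ω ^ 2) P := fun k => (hDm k).integrable_sq
  -- martingale part
  have hψ : Measurable fun p : ℝ × ℝ => H₁ α p.1 p.2 - H₁ α s p.2 :=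
    measurable_H₁.sub (measurable_H₁.comp (measurable_const.prodMk measurable_snd))
  obtain ⟨hM, hM2⟩ := R.integral_sq_centered_sum_le (γ := stepSize γ₁ β) hψ (s := s) (B := 2 * c)
    (fun ξ y => by
      refine (abs_sub _ _).trans ?_
      have h2 := abs_H₁_le hα ξ y
      have h3 := abs_H₁_le hα s y
      rw [← hcdef] at h2 h3
      nlinarith [abs_nonneg (ξ - s)])
    h.memLp (q := fun ξ => c ^ 2 * (L * |ξ - s|)) (fun ξ => integral_sq_H₁_sub_le hν ξ)
    (fun k => ((hDi k).const_mul L).const_mul _) (n + 1)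
  simp only at hM hM2
  set M : Ω → ℝ := fun ω => ∑ k ∈ Finset.range (n + 1),
    (H₁ α (xiProc α (stepSize γ₁ β) ξ₀ x k ω) (x k ω) - H₁ α s (x k ω)
      - ∫ y, (H₁ α (xiProc α (stepSize γ₁ β) ξ₀ x k ω) y - H₁ α s y) ∂ν) with hMdef
  have hpt : ∀ ω, |c * b * ∑ k ∈ Finset.Icc 1 (n + 1), D k ω
        + ∑ k ∈ Finset.range (n + 1), H₁ α s (x k ω)| ≤
      (c * L + γ₁⁻¹) * |D 0 ω| + (c * L + (stepSize γ₁ β (n + 1))⁻¹) * |D (n + 1) ω|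
      + ∑ k ∈ Finset.Icc 1 n, γ₁⁻¹ * (k : ℝ) ^ (β - 1) * |D k ω|
      + c * L * ∑ k ∈ Finset.range (n + 1), D k ω ^ 2 + |M ω| := by
    intro ω
    -- The recursion solved for its own increment; summing it calls for Abel summation.
    have hstep : ∀ k, H₁ α (xiProc α (stepSize γ₁ β) ξ₀ x k ω) (x k ω)
        = (D k ω - D (k + 1) ω) / stepSize γ₁ β (k + 1) := fun k => by
      have hg := stepSize_pos (β := β) hγ₁ (Nat.succ_pos k)
      rw [eq_div_iff hg.ne']
      simp only [hD, xiProc, xiIter]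
      ring
    have hdrift : ∀ k, ∫ y, (H₁ α (xiProc α (stepSize γ₁ β) ξ₀ x k ω) y - H₁ α s y) ∂ν
        = drift α ν (xiProc α (stepSize γ₁ β) ξ₀ x k ω) - drift α ν s := fun k => by
      rw [integral_sub (integrable_H₁ hα _) (integrable_H₁ hα _), integral_H₁ hα, integral_H₁ hα]
    have habel := sum_range_sub_div (γ := stepSize γ₁ β) (fun k => D k ω) n
    -- The average runs over times `1..N`, the recursion over `0..N-1`; the shift leaves the two
    -- boundary terms `D_N` and `D_0`.
    have hsumIcc : ∑ k ∈ Finset.Icc 1 (n + 1), D k ω =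
        ∑ k ∈ Finset.range (n + 1), D k ω + D (n + 1) ω - D 0 ω := by
      have h2 := Finset.sum_range_succ (fun k => D k ω) (n + 1)
      rw [Finset.range_eq_Ico, Finset.sum_eq_sum_Ico_succ_bot (by lia)] at h2
      have h3 : Finset.Ico (0 + 1) (n + 1 + 1) = Finset.Icc 1 (n + 1) := by
        ext k; simp only [Finset.mem_Ico, Finset.mem_Icc]; lia
      rw [h3] at h2
      linarith
    -- The decomposition behind the theorem: boundary shift, telescoped recursion, quadratic error
    -- of the mean field, martingale.
    have hid : c * b * ∑ k ∈ Finset.Icc 1 (n + 1), D k ω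
        + ∑ k ∈ Finset.range (n + 1), H₁ α s (x k ω) =
        c * b * (D (n + 1) ω - D 0 ω)
        + ∑ k ∈ Finset.range (n + 1), (D k ω - D (k + 1) ω) / stepSize γ₁ β (k + 1)
        - ∑ k ∈ Finset.range (n + 1), (drift α ν (xiProc α (stepSize γ₁ β) ξ₀ x k ω) - drift α ν s
            - c * b * D k ω) - M ω := by
      rw [hsumIcc, hMdef]
      simp only [hstep, hdrift, Finset.sum_sub_distrib, ← Finset.mul_sum]
      ring
    rw [hid, habel]
    have b1 : |c * b * (D (n + 1) ω - D 0 ω)| ≤ c * L * |D (n + 1) ω| + c * L * |D 0 ω| := by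
      rw [abs_mul, abs_mul, abs_of_pos hc, ← mul_add]
      gcongr
      exact abs_sub _ _
    have hg1 := stepSize_pos (β := β) hγ₁ (Nat.succ_pos n)
    have b2 : |D 0 ω / stepSize γ₁ β 1| = γ₁⁻¹ * |D 0 ω| := by
      have : stepSize γ₁ β 1 = γ₁ := by simp [stepSize]
      rw [this, abs_div, abs_of_pos hγ₁]; ring
    have b3 : |D (n + 1) ω / stepSize γ₁ β (n + 1)| =
        (stepSize γ₁ β (n + 1))⁻¹ * |D (n + 1) ω| := by
      rw [abs_div, abs_of_pos hg1]; ring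
    have b4 : |∑ k ∈ Finset.Icc 1 n, D k ω * ((stepSize γ₁ β (k + 1))⁻¹ - (stepSize γ₁ β k)⁻¹)| ≤
        ∑ k ∈ Finset.Icc 1 n, γ₁⁻¹ * (k : ℝ) ^ (β - 1) * |D k ω| := by
      refine (Finset.abs_sum_le_sum_abs _ _).trans (Finset.sum_le_sum fun k hk => ?_)
      have hk0 : 0 < k := (Finset.mem_Icc.1 hk).1
      rw [abs_mul, mul_comm]
      gcongr
      rw [abs_of_nonneg]
      · exact inv_stepSize_sub_le hγ₁ hβ.2.le hk0
      · exact sub_nonneg.2 (inv_anti₀ (stepSize_pos hγ₁ (Nat.succ_pos k))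
          (stepSize_antitone hγ₁ (by linarith [hβ.1]) hk0))
    have b5 : |∑ k ∈ Finset.range (n + 1), (drift α ν (xiProc α (stepSize γ₁ β) ξ₀ x k ω)
        - drift α ν s - c * b * D k ω)| ≤ c * L * ∑ k ∈ Finset.range (n + 1), D k ω ^ 2 := by
      rw [Finset.mul_sum]
      refine (Finset.abs_sum_le_sum_abs _ _).trans (Finset.sum_le_sum fun k _ => ?_)
      exact abs_drift_sub_le hα hν _
    refine (abs_sub _ _).trans ?_
    have t1 := abs_sub (c * b * (D (n + 1) ω - D 0 ω) +
      (D 0 ω / stepSize γ₁ β 1 - D (n + 1) ω / stepSize γ₁ β (n + 1) +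
        ∑ k ∈ Finset.Icc 1 n, D k ω * ((stepSize γ₁ β (k + 1))⁻¹ - (stepSize γ₁ β k)⁻¹)))
      (∑ k ∈ Finset.range (n + 1), (drift α ν (xiProc α (stepSize γ₁ β) ξ₀ x k ω)
        - drift α ν s - c * b * D k ω))
    have t2 := abs_add_le (c * b * (D (n + 1) ω - D 0 ω))
      (D 0 ω / stepSize γ₁ β 1 - D (n + 1) ω / stepSize γ₁ β (n + 1) +
        ∑ k ∈ Finset.Icc 1 n, D k ω * ((stepSize γ₁ β (k + 1))⁻¹ - (stepSize γ₁ β k)⁻¹))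
    have t3 := abs_add_le (D 0 ω / stepSize γ₁ β 1 - D (n + 1) ω / stepSize γ₁ β (n + 1))
      (∑ k ∈ Finset.Icc 1 n, D k ω * ((stepSize γ₁ β (k + 1))⁻¹ - (stepSize γ₁ β k)⁻¹))
    have t4 := abs_sub (D 0 ω / stepSize γ₁ β 1) (D (n + 1) ω / stepSize γ₁ β (n + 1))
    linarith
  -- integration
  have i1 : Integrable (fun ω => (c * L + γ₁⁻¹) * |D 0 ω|) P := (hDi 0).const_mul _
  have i2 : Integrable (fun ω => (c * L + (stepSize γ₁ β (n + 1))⁻¹) * |D (n + 1) ω|) P :=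
    (hDi _).const_mul _
  have i3 : Integrable (fun ω => ∑ k ∈ Finset.Icc 1 n, γ₁⁻¹ * (k : ℝ) ^ (β - 1) * |D k ω|) P :=
    integrable_finsetSum _ fun k _ => (hDi k).const_mul _
  have i4 : Integrable (fun ω => c * L * ∑ k ∈ Finset.range (n + 1), D k ω ^ 2) P :=
    (integrable_finsetSum _ fun k _ => hDsq k).const_mul _
  have i5 : Integrable (fun ω => |M ω|) P := (hM.integrable one_le_two).abs
  have i12 : Integrable (fun ω => (c * L + γ₁⁻¹) * |D 0 ω|
    + (c * L + (stepSize γ₁ β (n + 1))⁻¹) * |D (n + 1) ω|) P := i1.add i2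
  have i123 : Integrable (fun ω => (c * L + γ₁⁻¹) * |D 0 ω|
    + (c * L + (stepSize γ₁ β (n + 1))⁻¹) * |D (n + 1) ω|
    + ∑ k ∈ Finset.Icc 1 n, γ₁⁻¹ * (k : ℝ) ^ (β - 1) * |D k ω|) P := i12.add i3
  have i1234 : Integrable (fun ω => (c * L + γ₁⁻¹) * |D 0 ω|
    + (c * L + (stepSize γ₁ β (n + 1))⁻¹) * |D (n + 1) ω|
    + ∑ k ∈ Finset.Icc 1 n, γ₁⁻¹ * (k : ℝ) ^ (β - 1) * |D k ω|
    + c * L * ∑ k ∈ Finset.range (n + 1), D k ω ^ 2) P := i123.add i4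
  have hint := integral_mono_of_nonneg (ae_of_all P fun ω => abs_nonneg _) (i1234.add i5)
    (ae_of_all P hpt)
  refine hint.trans ?_
  simp only [Pi.add_apply]
  rw [integral_add i1234 i5, integral_add i123 i4, integral_add i12 i3, integral_add i1 i2,
    integral_const_mul, integral_const_mul, integral_const_mul,
    integral_finsetSum _ fun k _ => (hDi k).const_mul _, integral_finsetSum _ fun k _ => hDsq k]
  simp_rw [integral_const_mul]
  have e0 := h.integral_abs_init_le
  have eN := h.integral_abs_le hγ₁ hB (k := n + 1) hN le_rfl
  have hsm := h.sum_integral_sq_le hγ₁ hβ hB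
  have hse := h.sum_integral_abs_le hγ₁ hβ hB
  have hn1 : (1 : ℝ) ≤ ((n + 1 : ℕ) : ℝ) := by push_cast; linarith [(Nat.cast_nonneg n : (0:ℝ) ≤ n)]
  have hn0 : (0 : ℝ) < ((n + 1 : ℕ) : ℝ) := by linarith
  set E := (((n + 1 : ℕ) : ℝ)) ^ (β / 2) with hE
  have hE1 : 1 ≤ E := Real.one_le_rpow hn1 (by linarith [hβ.1])
  have eN1 : ∫ ω, |D (n + 1) ω| ∂P ≤ √(B * γ₁) := by
    refine eN.trans (mul_le_of_le_one_right (Real.sqrt_nonneg _) ?_)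
    exact Real.rpow_le_one_of_one_le_of_nonpos hn1 (by linarith [hβ.1])
  -- The last boundary term has size `γ_N⁻¹ √γ_N`, which gives the order `N^{β/2}`.
  have eN2 : (stepSize γ₁ β (n + 1))⁻¹ * ∫ ω, |D (n + 1) ω| ∂P ≤ γ₁⁻¹ * √(B * γ₁) * E := by
    have hg1 := stepSize_pos (β := β) hγ₁ (Nat.succ_pos n)
    calc _ ≤ (stepSize γ₁ β (n + 1))⁻¹ * (√(B * γ₁) * ((n + 1 : ℕ) : ℝ) ^ (-(β / 2))) := by gcongr
      _ = γ₁⁻¹ * √(B * γ₁) *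
          ((((n + 1 : ℕ) : ℝ)) ^ β * ((n + 1 : ℕ) : ℝ) ^ (-(β / 2))) := by
          rw [stepSize, mul_inv, ← Real.rpow_neg hn0.le, neg_neg]; ring
      _ = _ := by
          rw [← Real.rpow_add hn0, hE]; congr 2; ring
  -- The Abel weights `k^{β-1}` against `E|D_k| = O(k^{-β/2})` also sum to order `N^{β/2}`; the
  -- constant `4` bounds `2/β`.
  have eT : ∑ k ∈ Finset.Icc 1 n, γ₁⁻¹ * (k : ℝ) ^ (β - 1) * ∫ ω, |D k ω| ∂P ≤
      4 * γ₁⁻¹ * √(B * γ₁) * E := by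
    calc _ ≤ ∑ k ∈ Finset.Icc 1 n, γ₁⁻¹ * √(B * γ₁) * (k : ℝ) ^ (-(1 - β / 2)) := by
          refine Finset.sum_le_sum fun k hk => ?_
          obtain ⟨hk1, hkn⟩ := Finset.mem_Icc.1 hk
          have hk0 : (0 : ℝ) < k := by exact_mod_cast hk1
          have := h.integral_abs_le hγ₁ hB hk1 (by lia)
          calc _ ≤ γ₁⁻¹ * (k : ℝ) ^ (β - 1) * (√(B * γ₁) * (k : ℝ) ^ (-(β / 2))) := by gcongr
            _ = γ₁⁻¹ * √(B * γ₁) * ((k : ℝ) ^ (β - 1) * (k : ℝ) ^ (-(β / 2))) := by ring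
            _ = _ := by rw [← Real.rpow_add hk0]; congr 2; ring
      _ ≤ γ₁⁻¹ * √(B * γ₁) * ((n : ℝ) ^ (1 - (1 - β / 2)) / (1 - (1 - β / 2))) := by
          rw [← Finset.mul_sum]
          gcongr
          exact sum_rpow_neg_le (by linarith [hβ.2]) (by linarith [hβ.1]) n
      _ ≤ γ₁⁻¹ * √(B * γ₁) * (4 * E) := by
          gcongr
          rw [show 1 - (1 - β / 2) = β / 2 by ring, div_le_iff₀ (by linarith [hβ.1])]
          have : (n : ℝ) ^ (β / 2) ≤ E := by
            rw [hE]
            refine Real.rpow_le_rpow (by positivity) (by push_cast; linarith) (by linarith [hβ.1])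
          nlinarith [hβ.1]
      _ = _ := by ring
  have eM : ∫ ω, |M ω| ∂P ≤ √(c ^ 2 * L * (√B + 2 * √(B * γ₁)))
      * √(1 + (((n + 1 : ℕ) : ℝ)) ^ (1 - β / 2)) := by
    refine (integral_abs_le_sqrt hM).trans
      (sqrt_mul_one_add_le (by positivity) (hM2.trans ?_))
    simp_rw [integral_const_mul, ← Finset.mul_sum]
    calc _ ≤ c ^ 2 * (L * ((√B + 2 * √(B * γ₁)) * (1 + (((n + 1 : ℕ) : ℝ)) ^ (1 - β / 2)))) := by
          gcongr
      _ = _ := by ring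
  have hQ : 0 ≤ (((n + 1 : ℕ) : ℝ)) ^ (1 - β) := by positivity
  have hrE : E ≤ rate β (n + 1) := by
    have := Real.sqrt_nonneg (1 + (((n + 1 : ℕ) : ℝ)) ^ (1 - β / 2))
    simp only [rate]; linarith
  have hr1 : 1 ≤ rate β (n + 1) := hE1.trans hrE
  have hrQ : 1 + (((n + 1 : ℕ) : ℝ)) ^ (1 - β) ≤ rate β (n + 1) := by
    have := Real.sqrt_nonneg (1 + (((n + 1 : ℕ) : ℝ)) ^ (1 - β / 2))
    simp only [rate]; linarith
  have hrS : √(1 + (((n + 1 : ℕ) : ℝ)) ^ (1 - β / 2)) ≤ rate β (n + 1) := by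
    simp only [rate]; linarith
  have h0β : 0 < 1 - β := by linarith [hβ.2]
  have f1 : (c * L + γ₁⁻¹) * ∫ ω, |D 0 ω| ∂P ≤ (c * L + γ₁⁻¹) * √B * rate β (n + 1) := by
    calc _ ≤ (c * L + γ₁⁻¹) * √B := by gcongr
      _ ≤ _ := le_mul_of_one_le_right (by positivity) hr1
  have f2 : (c * L + (stepSize γ₁ β (n + 1))⁻¹) * ∫ ω, |D (n + 1) ω| ∂P ≤
      (c * L + γ₁⁻¹) * √(B * γ₁) * rate β (n + 1) := by
    have g1 : c * L * ∫ ω, |D (n + 1) ω| ∂P ≤ c * L * √(B * γ₁) * rate β (n + 1) := by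
      calc _ ≤ c * L * √(B * γ₁) := by gcongr
        _ ≤ _ := le_mul_of_one_le_right (by positivity) hr1
    have g2 : γ₁⁻¹ * √(B * γ₁) * E ≤ γ₁⁻¹ * √(B * γ₁) * rate β (n + 1) := by gcongr
    nlinarith
  have f3 : 4 * γ₁⁻¹ * √(B * γ₁) * E ≤ 4 * γ₁⁻¹ * √(B * γ₁) * rate β (n + 1) := by gcongr
  have f4 : c * L * ∑ k ∈ Finset.range (n + 1), ∫ ω, D k ω ^ 2 ∂P ≤
      c * L * (B + B * γ₁ / (1 - β)) * rate β (n + 1) := by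
    calc _ ≤ c * L * ((B + B * γ₁ / (1 - β)) * (1 + (((n + 1 : ℕ) : ℝ)) ^ (1 - β))) := by gcongr
      _ ≤ c * L * ((B + B * γ₁ / (1 - β)) * rate β (n + 1)) := by gcongr
      _ = _ := by ring
  have f5 : ∫ ω, |M ω| ∂P ≤ √(c ^ 2 * L * (√B + 2 * √(B * γ₁))) * rate β (n + 1) :=
    eM.trans (by gcongr)
  nlinarith

/-- The expected shortfall iterates compared with the average of the integrands at `s`. -/
lemma Controlled.integral_chi_remainder_le (h : Controlled P α γ₁ β s B ξ₀ x N)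
    (R : Run P ξ₀ x ν) (hν : LawRegular ν s b L κ) (hα : α ∈ Set.Ioo (0 : ℝ) 1) (hγ₁ : 0 < γ₁)
    (hβ : β ∈ Set.Ioo (1 / 2 : ℝ) 1) (hB : 0 ≤ B) (hL : 0 ≤ L) :
    ∫ ω, |N * chiIter α (stepSize γ₁ β) (ξ₀ ω) (fun k => x k ω) N
        - ∑ k ∈ Finset.range N, rho α s (x k ω)| ∂P ≤
      (√((1 + 1 / (1 - α)) ^ 2 * (B + B * γ₁ / (1 - β)))
        + 1 / (1 - α) * L * (B + B * γ₁ / (1 - β))) * rate β N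
      + (√B + 2 * √(B * γ₁)) * (|drift α ν s| * (1 + (N : ℝ) ^ (1 - β / 2))) := by
  have := R.isProbabilityMeasure
  have h1 : 0 < 1 - α := by linarith [hα.2]
  have hc : 0 < 1 / (1 - α) := by positivity
  have h0β : 0 < 1 - β := by linarith [hβ.2]
  set c := 1 / (1 - α) with hcdef
  set D : ℕ → Ω → ℝ := fun k ω => xiProc α (stepSize γ₁ β) ξ₀ x k ω - s with hD
  have hDm : ∀ k, MemLp (D k) 2 P := h.memLp
  have hDi : ∀ k, Integrable (fun ω => |D k ω|) P := fun k =>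
    ((hDm k).integrable one_le_two).abs
  have hDsq : ∀ k, Integrable (fun ω => D k ω ^ 2) P := fun k => (hDm k).integrable_sq
  have hψ : Measurable fun p : ℝ × ℝ => rho α p.1 p.2 - rho α s p.2 :=
    measurable_rho.sub (measurable_rho.comp (measurable_const.prodMk measurable_snd))
  obtain ⟨hM, hM2⟩ := R.integral_sq_centered_sum_le (γ := stepSize γ₁ β) hψ (s := s) (B := 1 + c)
    (fun ξ y => by
      refine (abs_rho_sub_le hα ξ y).trans ?_
      rw [← hcdef]
      nlinarith [abs_nonneg (ξ - s)])
    h.memLp (q := fun ξ => (1 + c) ^ 2 * (ξ - s) ^ 2) (fun ξ => by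
      have hb : ∀ y, (rho α ξ y - rho α s y) ^ 2 ≤ (1 + c) ^ 2 * (ξ - s) ^ 2 := fun y => by
        have := abs_rho_sub_le (s := s) hα ξ y
        rw [← hcdef] at this
        rw [← mul_pow, ← sq_abs, ← sq_abs ((1 + c) * (ξ - s)), abs_mul (1 + c),
          abs_of_pos (by positivity : 0 < 1 + c)]
        gcongr
      have := integral_mono_of_nonneg (μ := ν) (ae_of_all _ fun y => sq_nonneg _)
        (integrable_const _) (ae_of_all _ hb)
      simpa using this)
    (fun k => (hDsq k).const_mul _) N
  simp only at hM hM2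
  set M : Ω → ℝ := fun ω => ∑ k ∈ Finset.range N,
    (rho α (xiProc α (stepSize γ₁ β) ξ₀ x k ω) (x k ω) - rho α s (x k ω)
      - ∫ y, (rho α (xiProc α (stepSize γ₁ β) ξ₀ x k ω) y - rho α s y) ∂ν) with hMdef
  have hpt : ∀ ω, |N * chiIter α (stepSize γ₁ β) (ξ₀ ω) (fun k => x k ω) N
        - ∑ k ∈ Finset.range N, rho α s (x k ω)| ≤
      |M ω| + (|drift α ν s| * ∑ k ∈ Finset.range N, |D k ω|
        + c * L * ∑ k ∈ Finset.range N, D k ω ^ 2) := by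
    intro ω
    have hid : N * chiIter α (stepSize γ₁ β) (ξ₀ ω) (fun k => x k ω) N
        - ∑ k ∈ Finset.range N, rho α s (x k ω) = M ω + ∑ k ∈ Finset.range N,
          ∫ y, (rho α (xiProc α (stepSize γ₁ β) ξ₀ x k ω) y - rho α s y) ∂ν := by
      rw [mul_chiIter, hMdef]
      simp only [Finset.sum_sub_distrib, xiProc]
      ring
    rw [hid]
    refine (abs_add_le _ _).trans (add_le_add_right ?_ _)
    rw [Finset.mul_sum, Finset.mul_sum, ← Finset.sum_add_distrib]
    refine (Finset.abs_sum_le_sum_abs _ _).trans (Finset.sum_le_sum fun k _ => ?_)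
    exact abs_integral_rho_sub_le hα hν _
  have i1 : Integrable (fun ω => |M ω|) P := (hM.integrable one_le_two).abs
  have i2 : Integrable (fun ω => |drift α ν s| * ∑ k ∈ Finset.range N, |D k ω|) P :=
    (integrable_finsetSum _ fun k _ => hDi k).const_mul _
  have i3 : Integrable (fun ω => c * L * ∑ k ∈ Finset.range N, D k ω ^ 2) P :=
    (integrable_finsetSum _ fun k _ => hDsq k).const_mul _
  have i23 : Integrable (fun ω => |drift α ν s| * ∑ k ∈ Finset.range N, |D k ω|
        + c * L * ∑ k ∈ Finset.range N, D k ω ^ 2) P := i2.add i3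
  have hint := integral_mono_of_nonneg (ae_of_all P fun ω => abs_nonneg _) (i1.add i23)
    (ae_of_all P hpt)
  refine hint.trans ?_
  simp only [Pi.add_apply]
  rw [integral_add i1 i23, integral_add i2 i3, integral_const_mul, integral_const_mul,
    integral_finsetSum _ fun k _ => hDi k, integral_finsetSum _ fun k _ => hDsq k]
  have hsm := h.sum_integral_sq_le hγ₁ hβ hB
  have hse := h.sum_integral_abs_le hγ₁ hβ hB
  have hQ : 0 ≤ (N : ℝ) ^ (1 - β) := by positivity
  have hE : 0 ≤ (N : ℝ) ^ (β / 2) := by positivity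
  have hrQ : 1 + (N : ℝ) ^ (1 - β) ≤ rate β N := by
    have := Real.sqrt_nonneg (1 + (N : ℝ) ^ (1 - β / 2))
    simp only [rate]; linarith
  have hrS : √(1 + (N : ℝ) ^ (1 - β)) ≤ rate β N := by
    refine le_trans ?_ hrQ
    rw [Real.sqrt_le_left (by linarith)]
    nlinarith
  -- Since `rho` is Lipschitz in `ξ`, unlike `H₁`, the martingale has second moment of order `∑
  -- E[D_k²]`, smaller than in the VaR component.
  have eM : ∫ ω, |M ω| ∂P ≤ √((1 + c) ^ 2 * (B + B * γ₁ / (1 - β))) * rate β N := by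
    refine le_trans ?_ (mul_le_mul_of_nonneg_left hrS (Real.sqrt_nonneg _))
    refine (integral_abs_le_sqrt hM).trans
      (sqrt_mul_one_add_le (by positivity) (hM2.trans ?_))
    simp_rw [integral_const_mul, ← Finset.mul_sum]
    rw [mul_assoc]
    gcongr
  -- Not of order `rate`: this term is small only because the mean field at `s` is itself `O(1/K)`,
  -- so it is reported separately.
  have f2 : |drift α ν s| * ∑ k ∈ Finset.range N, ∫ ω, |D k ω| ∂P ≤
      (√B + 2 * √(B * γ₁)) * (|drift α ν s| * (1 + (N : ℝ) ^ (1 - β / 2))) := by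
    calc _ ≤ |drift α ν s| * ((√B + 2 * √(B * γ₁)) * (1 + (N : ℝ) ^ (1 - β / 2))) := by gcongr
      _ = _ := by ring
  have f4 : c * L * ∑ k ∈ Finset.range N, ∫ ω, D k ω ^ 2 ∂P ≤
      c * L * (B + B * γ₁ / (1 - β)) * rate β N := by
    calc _ ≤ c * L * ((B + B * γ₁ / (1 - β)) * (1 + (N : ℝ) ^ (1 - β))) := by gcongr
      _ ≤ c * L * ((B + B * γ₁ / (1 - β)) * rate β N) := by gcongr
      _ = _ := by ring
  linarith

end Remainders

/-! ### Regularity of distribution functions from densities -/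

section Density

variable {ν : Measure ℝ} [IsProbabilityMeasure ν] {f : ℝ → ℝ}

omit [IsProbabilityMeasure ν] in
lemma measureReal_Iio_eq_Iic (hν : ν = volume.withDensity fun x => ENNReal.ofReal (f x)) (ξ : ℝ) :
    ν.real (Set.Iio ξ) = ν.real (Set.Iic ξ) := by
  have : NullSingletonClass ν := by
    refine ⟨fun x => ?_⟩
    rw [hν]
    exact withDensity_absolutelyContinuous _ _ (by simp)
  exact measureReal_congr Iio_ae_eq_Iic

lemma measureReal_Iio_sub (hf : Continuous f) (hf0 : ∀ x, 0 ≤ f x)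
    (hν : ν = volume.withDensity fun x => ENNReal.ofReal (f x)) (ξ η : ℝ) :
    ν.real (Set.Iio η) - ν.real (Set.Iio ξ) = ∫ t in ξ..η, f t := by
  have key : ∀ a b : ℝ, a ≤ b → ν.real (Set.Iio b) - ν.real (Set.Iio a) = ∫ t in a..b, f t := by
    intro a b hab
    rw [measureReal_Iio_eq_Iic hν, measureReal_Iio_eq_Iic hν,
      ← measureReal_sdiff (Set.Iic_subset_Iic.2 hab) measurableSet_Iic]
    have e : Set.Iic b \ Set.Iic a = Set.Ioc a b := by ext y; simp [and_comm]
    rw [e, intervalIntegral.integral_of_le hab, measureReal_def, hν,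
      withDensity_apply _ measurableSet_Ioc, integral_eq_lintegral_of_nonneg_ae
        (ae_of_all _ hf0) hf.aestronglyMeasurable]
  rcases le_total ξ η with h | h
  · exact key _ _ h
  · rw [intervalIntegral.integral_symm, ← key _ _ h]
    ring

/-- The Lipschitz density gives the quadratic Taylor error. The lower bound integrates the density
over distance at most one from `s`, inside the ball of radius two; monotonicity of the distribution
function takes over farther away. -/
lemma lawRegular_of_density (hf : Continuous f) (hf0 : ∀ x, 0 ≤ f x)
    (hν : ν = volume.withDensity fun x => ENNReal.ofReal (f x)) {C : NNReal}
    (hC : ∀ x, |f x| ≤ C) (hL : LipschitzWith C f) {s κ : ℝ}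
    (hlow : ∀ ξ ∈ Metric.ball s 2, κ ≤ f ξ) : LawRegular ν s (f s) C κ := by
  have hF := measureReal_Iio_sub hf hf0 hν
  have hmono : ∀ a b : ℝ, a ≤ b → ν.real (Set.Iio a) ≤ ν.real (Set.Iio b) := fun a b h =>
    measureReal_mono (Set.Iio_subset_Iio h)
  refine ⟨fun ξ η => ?_, fun ξ => ?_, fun ξ => ?_⟩
  · rw [hF]
    exact intervalIntegral.norm_integral_le_of_norm_le_const
      fun x _ => (Real.norm_eq_abs _).trans_le (hC x)
  · have e : ∫ t in s..ξ, (f t - f s) = (∫ t in s..ξ, f t) - f s * (ξ - s) := by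
      rw [intervalIntegral.integral_sub (hf.intervalIntegrable _ _) (by simp)]
      simp [mul_comm]
    rw [hF, ← e]
    have := intervalIntegral.norm_integral_le_of_norm_le_const (a := s) (b := ξ)
      (f := fun t => f t - f s) (C := C * |ξ - s|) fun x hx => by
        have h1 := hL.dist_le_mul x s
        rw [Real.dist_eq, Real.dist_eq] at h1
        refine h1.trans (mul_le_mul_of_nonneg_left ?_ C.2)
        rcases le_total s ξ with h | h
        · rw [Set.uIoc_of_le h] at hx
          rw [abs_of_nonneg (by linarith [hx.1]), abs_of_nonneg (by linarith)]
          linarith [hx.2]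
        · rw [Set.uIoc_of_ge h] at hx
          rw [abs_of_nonpos (by linarith [hx.2]), abs_of_nonpos (by linarith)]
          linarith [hx.1]
    refine this.trans (le_of_eq ?_)
    rw [mul_assoc, ← sq, sq_abs]
  · have hsub : ∀ a b : ℝ, s - 1 ≤ a → a ≤ b → b ≤ s + 1 →
        κ * (b - a) ≤ ν.real (Set.Iio b) - ν.real (Set.Iio a) := by
      intro a b h1 h2 h3
      rw [hF]
      have := intervalIntegral.integral_mono_on (μ := volume) (f := fun _ => κ) (g := f) h2
        (by simp) (hf.intervalIntegrable _ _) fun x hx => hlow x (by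
          rw [Metric.mem_ball, Real.dist_eq, abs_lt]
          constructor <;> linarith [hx.1, hx.2])
      simpa [mul_comm] using this
    rcases le_total s ξ with h | h
    · rw [abs_of_nonneg (sub_nonneg.2 h), abs_of_nonneg (sub_nonneg.2 (hmono _ _ h))]
      have h1 := hsub s (s + min (ξ - s) 1) (by linarith)
        (by linarith [le_min (sub_nonneg.2 h) zero_le_one]) (by linarith [min_le_right (ξ - s) 1])
      have h2 := hmono (s + min (ξ - s) 1) ξ (by linarith [min_le_left (ξ - s) 1])
      have e : κ * (s + min (ξ - s) 1 - s) = κ * min (ξ - s) 1 := by ring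
      linarith
    · rw [abs_of_nonpos (sub_nonpos.2 h), abs_of_nonpos (sub_nonpos.2 (hmono _ _ h))]
      have h1 := hsub (s - min (-(ξ - s)) 1) s (by linarith [min_le_right (-(ξ - s)) 1])
        (by linarith [le_min (neg_nonneg.2 (sub_nonpos.2 h)) zero_le_one]) (by linarith)
      have h2 := hmono ξ (s - min (-(ξ - s)) 1) (by linarith [min_le_left (-(ξ - s)) 1])
      have e : κ * (s - (s - min (-(ξ - s)) 1)) = κ * min (-(ξ - s)) 1 := by ring
      linarith

end Density

/-! ### Quantiles, expected shortfall and the objective function -/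

section Quantile

variable {Ω : Type*} [MeasurableSpace Ω] {P : Measure Ω} [IsProbabilityMeasure P] {X : Ω → ℝ}
  {f : ℝ → ℝ}

omit [IsProbabilityMeasure P] in
lemma cdfOf_eq_map (hX : AEMeasurable X P) (ξ : ℝ) : cdfOf P X ξ = (P.map X).real (Set.Iic ξ) := by
  rw [map_measureReal_apply_of_aemeasurable hX measurableSet_Iic]
  rfl

lemma cdfOf_eq_Iio (hX : AEMeasurable X P) (hf : HasContinuousPDF P X f) (ξ : ℝ) :
    cdfOf P X ξ = (P.map X).real (Set.Iio ξ) := by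
  have := Measure.isProbabilityMeasure_map hX
  rw [cdfOf_eq_map hX, measureReal_Iio_eq_Iic hf.map_eq]

lemma cdfOf_sub (hX : AEMeasurable X P) (hf : HasContinuousPDF P X f) (ξ η : ℝ) :
    cdfOf P X η - cdfOf P X ξ = ∫ t in ξ..η, f t := by
  have := Measure.isProbabilityMeasure_map hX
  rw [cdfOf_eq_Iio hX hf, cdfOf_eq_Iio hX hf, measureReal_Iio_sub hf.continuous hf.nonneg hf.map_eq]

lemma strictMono_cdfOf (hX : AEMeasurable X P) (hf : HasContinuousPDF P X f)
    (hpos : ∀ x, 0 < f x) : StrictMono (cdfOf P X) := fun a b hab => by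
  have h1 := cdfOf_sub hX hf a b
  have h2 := intervalIntegral.intervalIntegral_pos_of_pos
    (hf.continuous.intervalIntegrable a b) hpos hab
  linarith

lemma continuous_cdfOf (hX : AEMeasurable X P) (hf : HasContinuousPDF P X f) :
    Continuous (cdfOf P X) := by
  have e : cdfOf P X = fun ξ => cdfOf P X 0 + ∫ t in (0 : ℝ)..ξ, f t := by
    ext ξ
    rw [← cdfOf_sub hX hf]
    ring
  rw [e]
  exact continuous_const.add
    (intervalIntegral.continuous_primitive (fun a b => hf.continuous.intervalIntegrable a b) 0)

lemma exists_cdfOf_eq (hX : AEMeasurable X P) (hf : HasContinuousPDF P X f) {a : ℝ}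
    (ha : a ∈ Set.Ioo (0 : ℝ) 1) : ∃ x, cdfOf P X x = a := by
  have := Measure.isProbabilityMeasure_map hX
  have e : cdfOf P X = cdf (P.map X) := by
    ext ξ
    rw [cdf_eq_real, cdfOf_eq_map hX]
  have hbot : Tendsto (cdfOf P X) atBot (𝓝 0) := e ▸ tendsto_cdf_atBot _
  have htop : Tendsto (cdfOf P X) atTop (𝓝 1) := e ▸ tendsto_cdf_atTop _
  obtain ⟨x, hx⟩ := (hbot.eventually_lt_const ha.1).exists
  obtain ⟨y, hy⟩ := (htop.eventually_const_lt ha.2).exists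
  obtain ⟨z, hz⟩ := mem_range_of_exists_le_of_exists_ge (continuous_cdfOf hX hf)
    ⟨x, hx.le⟩ ⟨y, hy.le⟩
  exact ⟨z, hz⟩

lemma VaR_cdfOf (hX : AEMeasurable X P) (hf : HasContinuousPDF P X f) (hpos : ∀ x, 0 < f x)
    (x : ℝ) : VaR P (cdfOf P X x) X = x := by
  have : {ξ : ℝ | cdfOf P X x ≤ cdfOf P X ξ} = Set.Ici x := by
    ext ξ
    simp [(strictMono_cdfOf hX hf hpos).le_iff_le]
  rw [VaR, this, csInf_Ici]

lemma cdfOf_VaR (hX : AEMeasurable X P) (hf : HasContinuousPDF P X f) (hpos : ∀ x, 0 < f x)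
    {a : ℝ} (ha : a ∈ Set.Ioo (0 : ℝ) 1) : cdfOf P X (VaR P a X) = a := by
  obtain ⟨x, rfl⟩ := exists_cdfOf_eq hX hf ha
  rw [VaR_cdfOf hX hf hpos]

lemma VaR_le_iff (hX : AEMeasurable X P) (hf : HasContinuousPDF P X f) (hpos : ∀ x, 0 < f x)
    {a : ℝ} (ha : a ∈ Set.Ioo (0 : ℝ) 1) (x : ℝ) : VaR P a X ≤ x ↔ a ≤ cdfOf P X x := by
  rw [← (strictMono_cdfOf hX hf hpos).le_iff_le, cdfOf_VaR hX hf hpos ha]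

lemma aemeasurable_VaR (hX : AEMeasurable X P) (hf : HasContinuousPDF P X f)
    (hpos : ∀ x, 0 < f x) :
    AEMeasurable (fun a => VaR P a X) (volume.restrict (Set.Ioo (0 : ℝ) 1)) := by
  refine aemeasurable_restrict_of_monotoneOn measurableSet_Ioo fun a ha b hb hab => ?_
  rw [VaR_le_iff hX hf hpos ha, cdfOf_VaR hX hf hpos hb]
  exact hab

/-- The quantile function transports the uniform distribution to the law of `X`. -/
lemma map_VaR (hX : AEMeasurable X P) (hf : HasContinuousPDF P X f) (hpos : ∀ x, 0 < f x) :
    (volume.restrict (Set.Ioo (0 : ℝ) 1)).map (fun a => VaR P a X) = P.map X := by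
  have := Measure.isProbabilityMeasure_map hX
  have hm := aemeasurable_VaR hX hf hpos
  have hfin : IsFiniteMeasure ((volume.restrict (Set.Ioo (0 : ℝ) 1)).map fun a => VaR P a X) := by
    have : IsFiniteMeasure (volume.restrict (Set.Ioo (0 : ℝ) 1)) := ⟨by simp⟩
    infer_instance
  refine Measure.ext_of_Iic _ _ fun x => ?_
  have hmono := strictMono_cdfOf hX hf hpos
  have h0 : 0 < cdfOf P X x := by
    have h1 := hmono (show x - 1 < x by linarith)
    exact lt_of_le_of_lt measureReal_nonneg h1
  have h1 : cdfOf P X x < 1 := by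
    have h1 := hmono (show x < x + 1 by linarith)
    exact lt_of_lt_of_le h1 measureReal_le_one
  rw [Measure.map_apply_of_aemeasurable hm measurableSet_Iic,
    Measure.restrict_apply₀' measurableSet_Ioo.nullMeasurableSet]
  have e : (fun a => VaR P a X) ⁻¹' Set.Iic x ∩ Set.Ioo (0 : ℝ) 1 = Set.Ioc 0 (cdfOf P X x) := by
    ext a
    simp only [Set.mem_inter_iff, Set.mem_preimage, Set.mem_Iic, Set.mem_Ioc]
    constructor
    · rintro ⟨h2, h3⟩
      exact ⟨h3.1, (VaR_le_iff hX hf hpos h3 x).1 h2⟩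
    · rintro ⟨h2, h3⟩
      have h4 : a ∈ Set.Ioo (0 : ℝ) 1 := ⟨h2, lt_of_le_of_lt h3 h1⟩
      exact ⟨(VaR_le_iff hX hf hpos h4 x).2 h3, h4⟩
  rw [e, Real.volume_Ioc, sub_zero, cdfOf_eq_map hX, ofReal_measureReal]

lemma measureReal_lt (hX : AEMeasurable X P) (ξ : ℝ) :
    P.real {ω | ξ < X ω} = 1 - cdfOf P X ξ := by
  have h : NullMeasurableSet {ω | X ω ≤ ξ} P := hX.nullMeasurableSet_preimage measurableSet_Iic
  have := measureReal_compl₀ h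
  rw [probReal_univ] at this
  rw [cdfOf, ← this]
  congr 1
  ext ω
  simp

lemma integral_indicator_lt_eq (hX : AEMeasurable X P) (hXi : Integrable X P) (s : ℝ) :
    ∫ ω, (Set.Ioi s).indicator (fun y => y) (X ω) ∂P
      = ∫ ω, max (X ω - s) 0 ∂P + s * (1 - cdfOf P X s) := by
  have hset : NullMeasurableSet {ω | s < X ω} P := hX.nullMeasurableSet_preimage measurableSet_Ioi
  have i1 : Integrable (fun ω => max (X ω - s) 0) P := (hXi.sub (integrable_const s)).pos_part
  have i2 : Integrable (fun ω => s * {ω | s < X ω}.indicator (fun _ => (1 : ℝ)) ω) P :=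
    ((integrable_const (1 : ℝ)).indicator₀ hset).const_mul s
  have e : ∀ ω, (Set.Ioi s).indicator (fun y => y) (X ω) =
      max (X ω - s) 0 + s * {ω | s < X ω}.indicator (fun _ => (1 : ℝ)) ω := fun ω => by
    by_cases h : s < X ω
    · simp [h, h.le]
    · simp [h, not_lt.1 h]
  simp_rw [e]
  rw [integral_add i1 i2, integral_const_mul, integral_indicator₀ hset, ← measureReal_lt hX]
  simp

/-- The Rockafellar–Uryasev formula `ES_α(X) = V(VaR_α(X))`. -/
lemma ES_eq_objective (hX : AEMeasurable X P) (hXi : Integrable X P)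
    (hf : HasContinuousPDF P X f) (hpos : ∀ x, 0 < f x) {α : ℝ} (hα : α ∈ Set.Ioo (0 : ℝ) 1) :
    ES P α X = objective P α X (VaR P α X) := by
  have h1α : 0 < 1 - α := by linarith [hα.2]
  set s := VaR P α X with hs
  have hFs : cdfOf P X s = α := cdfOf_VaR hX hf hpos hα
  -- Levels above `α` are exactly those whose quantile exceeds `s`. The integral thus becomes that
  -- of a function of the quantile alone, and the quantile of a uniform level has the law of `X`.
  have e1 : ∫ a in α..1, VaR P a X =
      ∫ a in Set.Ioo (0 : ℝ) 1, (Set.Ioi s).indicator (fun y => y) (VaR P a X) := by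
    rw [intervalIntegral.integral_of_le hα.2.le, integral_Ioc_eq_integral_Ioo,
      ← integral_indicator measurableSet_Ioo, ← integral_indicator measurableSet_Ioo]
    congr 1 with a
    by_cases ha : a ∈ Set.Ioo (0 : ℝ) 1
    · have hlt : s < VaR P a X ↔ α < a := by
        rw [← not_le, VaR_le_iff hX hf hpos ha, hFs, not_le]
      rw [Set.indicator_of_mem ha]
      by_cases h : α < a
      · rw [Set.indicator_of_mem (show a ∈ Set.Ioo α 1 from ⟨h, ha.2⟩),
          Set.indicator_of_mem (show VaR P a X ∈ Set.Ioi s from hlt.2 h)]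
      · rw [Set.indicator_of_notMem (fun h' => h h'.1),
          Set.indicator_of_notMem (s := Set.Ioi s) (fun h' => h (hlt.1 h'))]
    · rw [Set.indicator_of_notMem ha, Set.indicator_of_notMem]
      exact fun h' => ha ⟨hα.1.trans h'.1, h'.2⟩
  have hmi : Measurable ((Set.Ioi s).indicator fun y : ℝ => y) :=
    measurable_id.indicator measurableSet_Ioi
  have e2 : ∫ a in Set.Ioo (0 : ℝ) 1, (Set.Ioi s).indicator (fun y => y) (VaR P a X) =
      ∫ ω, (Set.Ioi s).indicator (fun y => y) (X ω) ∂P := by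
    rw [← integral_map (aemeasurable_VaR hX hf hpos) hmi.aestronglyMeasurable,
      map_VaR hX hf hpos, integral_map hX hmi.aestronglyMeasurable]
  rw [ES, e1, e2, integral_indicator_lt_eq hX hXi, hFs, objective]
  field_simp
  ring

/-- The subgradient inequality `(x - ξ)⁺ ≥ (x - s)⁺ - (ξ - s) 1_{x > s}` in expectation. It makes
the expansion hypotheses, stated at minimizers of the objective, available at the quantile. -/
lemma isMinOn_objective (hX : AEMeasurable X P) (hXi : Integrable X P) {α s : ℝ} (hα : α < 1)
    (hs : cdfOf P X s = α) : IsMinOn (objective P α X) Set.univ s := by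
  have h1α : 0 < 1 - α := by linarith
  intro ξ _
  have hset : NullMeasurableSet {ω | s < X ω} P := hX.nullMeasurableSet_preimage measurableSet_Ioi
  have i1 : ∀ t, Integrable (fun ω => max (X ω - t) 0) P := fun t =>
    (hXi.sub (integrable_const t)).pos_part
  have i2 : Integrable (fun ω => (ξ - s) * {ω | s < X ω}.indicator (fun _ => (1 : ℝ)) ω) P :=
    ((integrable_const (1 : ℝ)).indicator₀ hset).const_mul _
  have h : ∫ ω, (max (X ω - s) 0 - (ξ - s) * {ω | s < X ω}.indicator (fun _ => (1 : ℝ)) ω) ∂P ≤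
      ∫ ω, max (X ω - ξ) 0 ∂P := by
    refine integral_mono ((i1 s).sub i2) (i1 ξ) fun ω => ?_
    by_cases h : s < X ω
    · simp [h, h.le]
    · simp [h, not_lt.1 h]
  rw [integral_sub (i1 s) i2, integral_const_mul, integral_indicator₀ hset] at h
  simp only [integral_const, measureReal_restrict_apply_univ, smul_eq_mul, mul_one,
    measureReal_lt hX, hs] at h
  simp only [Set.mem_ofPred_eq, objective]
  have h2 := mul_le_mul_of_nonneg_left h (show 0 ≤ 1 / (1 - α) by positivity)
  have e : 1 / (1 - α) * (∫ ω, max (X ω - s) 0 ∂P - (ξ - s) * (1 - α)) =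
      1 / (1 - α) * ∫ ω, max (X ω - s) 0 ∂P - (ξ - s) := by field_simp
  linarith

/-- The layer cake formula. It turns differences of objectives into integrals of differences of
distribution functions, to which the expansion in `h` applies. -/
lemma integral_posPart_eq_integral_tail (hX : AEMeasurable X P) (hXi : Integrable X P) (s : ℝ) :
    IntegrableOn (fun t => 1 - cdfOf P X t) (Set.Ioi s) ∧
      ∫ ω, max (X ω - s) 0 ∂P = ∫ t in Set.Ioi s, (1 - cdfOf P X t) := by
  have i1 : Integrable (fun ω => max (X ω - s) 0) P := (hXi.sub (integrable_const s)).pos_part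
  have hnn : 0 ≤ᵐ[P] fun ω => max (X ω - s) 0 := ae_of_all _ fun ω => le_max_right _ _
  have e1 := i1.integral_eq_integral_meas_lt hnn
  have e2 : ∀ t ∈ Set.Ioi (0 : ℝ), P.real {ω | t < max (X ω - s) 0} = 1 - cdfOf P X (s + t) := by
    intro t ht
    rw [← measureReal_lt hX]
    congr 1
    ext ω
    have ht : 0 < t := ht
    simp only [Set.mem_ofPred_eq, lt_max_iff]
    constructor
    · rintro (h | h) <;> linarith
    · intro h; left; linarith
  have mp : MeasurePreserving (fun t : ℝ => s + t) volume volume := measurePreserving_add_left _ s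
  have me : MeasurableEmbedding (fun t : ℝ => s + t) := measurableEmbedding_addLeft s
  have epre : (fun t : ℝ => s + t) ⁻¹' Set.Ioi s = Set.Ioi 0 := by ext t; simp
  have hanti : Antitone fun t => 1 - cdfOf P X t := fun a b hab => by
    have : cdfOf P X a ≤ cdfOf P X b := measureReal_mono fun ω (h : X ω ≤ a) => h.trans hab
    simp only
    linarith
  constructor
  · rw [← mp.integrableOn_comp_preimage me, epre]
    have hfin : ∫⁻ t in Set.Ioi (0 : ℝ), P {ω | t < max (X ω - s) 0} < ⊤ := by
      rw [← lintegral_eq_lintegral_meas_lt P hnn i1.aemeasurable]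
      exact (hasFiniteIntegral_iff_ofReal hnn).1 i1.2
    refine ⟨(hanti.measurable.comp (measurable_const_add s)).aestronglyMeasurable, ?_⟩
    rw [hasFiniteIntegral_iff_ofReal (ae_of_all _ fun t => by
      have : cdfOf P X (s + t) ≤ 1 := measureReal_le_one
      simpa using this)]
    refine lt_of_le_of_lt (le_of_eq ?_) hfin
    refine setLIntegral_congr_fun measurableSet_Ioi fun t ht => ?_
    simp only [Function.comp_apply]
    rw [← e2 t ht, ofReal_measureReal]
  · rw [e1, setIntegral_congr_fun measurableSet_Ioi e2, ← epre]
    exact mp.setIntegral_preimage_emb me (fun t => 1 - cdfOf P X t) _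

end Quantile

/-! ### Nested Monte Carlo approximation -/

section NestedLoss

variable {Ω : Type*} [MeasurableSpace Ω] {P : Measure Ω} [IsProbabilityMeasure P]
  {d q : ℕ} {φ : EuclideanSpace ℝ (Fin d) × EuclideanSpace ℝ (Fin q) → ℝ}
  {Y : Ω → EuclideanSpace ℝ (Fin d)} {Z : Ω → EuclideanSpace ℝ (Fin q)}

lemma memLp_two_of_integrable_rpow {g : Ω → ℝ} (hg : AEStronglyMeasurable g P) {δ : ℝ}
    (hδ : 0 < δ) (h : Integrable (fun ω => |g ω| ^ (2 + δ)) P) : MemLp g 2 P := by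
  rw [memLp_two_iff_integrable_sq hg]
  refine ((integrable_const (1 : ℝ)).add h).mono' (hg.pow 2) (ae_of_all _ fun ω => ?_)
  simp only [Pi.add_apply]
  rw [Real.norm_eq_abs, abs_pow]
  have h0 := abs_nonneg (g ω)
  have h1 : 0 ≤ |g ω| ^ (2 + δ) := by positivity
  rcases le_total |g ω| 1 with h2 | h2
  · nlinarith
  · have := Real.rpow_le_rpow_of_exponent_le h2 (show (2 : ℝ) ≤ 2 + δ by linarith)
    rw [Real.rpow_two] at this
    linarith

/-- The regression function `y ↦ E[φ(y, Z)]`. -/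
def regression (P : Measure Ω) (φ : EuclideanSpace ℝ (Fin d) × EuclideanSpace ℝ (Fin q) → ℝ)
    (Z : Ω → EuclideanSpace ℝ (Fin q)) (y : EuclideanSpace ℝ (Fin d)) : ℝ :=
  ∫ z, φ (y, z) ∂(P.map Z)

lemma measurable_regression (hφ : Measurable φ) : Measurable (regression P φ Z) :=
  (hφ.stronglyMeasurable.integral_prod_right' (ν := P.map Z)).measurable

/-- Fubini under independence verifies the defining property of conditional expectation. An explicit
function of `Y` is needed to center the inner samples. -/
lemma loss_ae_eq (hφ : Measurable φ) (hY : Measurable Y) (hZ : Measurable Z)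
    (hYZ : IndepFun Y Z P) (hi : Integrable (fun ω => φ (Y ω, Z ω)) P) :
    loss P φ Y Z =ᵐ[P] fun ω => regression P φ Z (Y ω) := by
  have hm : MeasurableSpace.comap Y inferInstance ≤ (inferInstance : MeasurableSpace Ω) :=
    hY.comap_le
  have hψ := measurable_regression (P := P) (Z := Z) hφ
  have hψi := (integrable_and_integral_of_indepFun hY hZ hYZ hφ hi).1
  symm
  refine ae_eq_condExp_of_forall_setIntegral_eq hm hi (fun s _ _ => hψi.integrableOn) ?_ ?_
  · rintro s ⟨t, ht, rfl⟩ _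
    have hs := hY ht
    have hΦ : Measurable fun p : EuclideanSpace ℝ (Fin d) × EuclideanSpace ℝ (Fin q) =>
        t.indicator (fun _ => (1 : ℝ)) p.1 * φ p :=
      ((measurable_const.indicator ht).comp measurable_fst).mul hφ
    have e1 : ∀ g : Ω → ℝ, ∀ ω, (Y ⁻¹' t).indicator g ω =
        t.indicator (fun _ => (1 : ℝ)) (Y ω) * g ω := fun g ω => by
      by_cases h : Y ω ∈ t <;> simp [h]
    have hi' : Integrable (fun ω => t.indicator (fun _ => (1 : ℝ)) (Y ω) * φ (Y ω, Z ω)) P := by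
      simp_rw [← e1 fun ω => φ (Y ω, Z ω)]
      exact hi.indicator hs
    have key := (integrable_and_integral_of_indepFun hY hZ hYZ hΦ hi').2
    simp only at key
    rw [← integral_indicator hs, ← integral_indicator hs]
    simp_rw [e1]
    rw [key]
    simp_rw [integral_const_mul]
    rfl
  · refine StronglyMeasurable.aestronglyMeasurable ?_
    exact (hψ.comp (comap_measurable Y)).stronglyMeasurable

omit [IsProbabilityMeasure P] in
lemma measurable_loss (hY : Measurable Y) : Measurable (loss P φ Y Z) :=
  (stronglyMeasurable_condExp.mono hY.comap_le).measurable

omit [IsProbabilityMeasure P] in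
lemma memLp_loss (h : MemLp (fun ω => φ (Y ω, Z ω)) 2 P) : MemLp (loss P φ Y Z) 2 P :=
  MemLp.condExp one_le_two h

variable {Zs : ℕ → Ω → EuclideanSpace ℝ (Fin q)}

lemma identDistrib_pair (hY : Measurable Y) (hYZ : IndepFun Y Z P)
    (hZs_ident : ∀ k, IdentDistrib (Zs k) Z P P)
    (hY_Zs : IndepFun Y (fun ω k => Zs k ω) P) (k : ℕ) :
    IdentDistrib (fun ω => (Y ω, Zs k ω)) (fun ω => (Y ω, Z ω)) P P := by
  have h1 : IndepFun Y (Zs k) P := hY_Zs.comp measurable_id (measurable_pi_apply k)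
  exact (IdentDistrib.refl hY.aemeasurable).prodMk (hZs_ident k) h1 hYZ

lemma measurable_nestedLoss (hφ : Measurable φ) (hY : Measurable Y)
    (hZs_meas : ∀ k, Measurable (Zs k)) (K : ℕ+) : Measurable (nestedLoss φ Y Zs K) :=
  (Finset.measurable_fun_sum _ fun k _ => hφ.comp (hY.prodMk (hZs_meas k))).const_mul _

lemma memLp_nestedLoss (hφ : Measurable φ) (hY : Measurable Y) (hYZ : IndepFun Y Z P)
    (h2 : MemLp (fun ω => φ (Y ω, Z ω)) 2 P) (hZs_ident : ∀ k, IdentDistrib (Zs k) Z P P)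
    (hY_Zs : IndepFun Y (fun ω k => Zs k ω) P) (K : ℕ+) : MemLp (nestedLoss φ Y Zs K) 2 P := by
  have h : ∀ k, MemLp (fun ω => φ (Y ω, Zs k ω)) 2 P := fun k =>
    ((identDistrib_pair hY hYZ hZs_ident hY_Zs k).comp hφ).memLp_iff.2 h2
  exact (memLp_finsetSum _ fun k _ => h k).const_mul _

/-- Mean square rate of the nested Monte Carlo approximation. -/
lemma exists_integral_sq_nestedLoss_sub_le (hφ : Measurable φ) (hY : Measurable Y)
    (hZ : Measurable Z) (hYZ : IndepFun Y Z P) (h2 : MemLp (fun ω => φ (Y ω, Z ω)) 2 P)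
    (hZs_meas : ∀ k, Measurable (Zs k)) (hZs_ident : ∀ k, IdentDistrib (Zs k) Z P P)
    (hZs_indep : iIndepFun Zs P) (hY_Zs : IndepFun Y (fun ω k => Zs k ω) P) :
    ∃ V : ℝ, ∀ K : ℕ+, ∫ ω, (nestedLoss φ Y Zs K ω - loss P φ Y Z ω) ^ 2 ∂P ≤ V * (K : ℝ)⁻¹ := by
  have hψ := measurable_regression (P := P) (Z := Z) hφ
  have hae := loss_ae_eq hφ hY hZ hYZ (h2.integrable one_le_two)
  have hψ2 : MemLp (fun ω => regression P φ Z (Y ω)) 2 P := (memLp_loss h2).ae_eq hae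
  let dv : EuclideanSpace ℝ (Fin d) × EuclideanSpace ℝ (Fin q) → ℝ :=
    fun p => φ p - regression P φ Z p.1
  have hdv : Measurable dv := hφ.sub (hψ.comp measurable_fst)
  have hid := identDistrib_pair hY hYZ hZs_ident hY_Zs
  have hB2 : MemLp (fun ω => dv (Y ω, Z ω)) 2 P := h2.sub hψ2
  have hB : ∀ k, MemLp (fun ω => dv (Y ω, Zs k ω)) 2 P := fun k =>
    ((hid k).comp hdv).memLp_iff.2 hB2
  have hsq : ∀ k, ∫ ω, dv (Y ω, Zs k ω) ^ 2 ∂P = ∫ ω, dv (Y ω, Z ω) ^ 2 ∂P := fun k =>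
    ((hid k).comp (hdv.pow_const 2)).integral_eq
  -- This holds for every `y`: when `φ(y, ·)` is not integrable, neither is `dv(y, ·)`, and the
  -- integral takes its default value zero.
  have hzero : ∀ y, ∫ z, dv (y, z) ∂(P.map Z) = 0 := fun y => by
    have : IsProbabilityMeasure (P.map Z) := Measure.isProbabilityMeasure_map hZ.aemeasurable
    simp only [dv]
    by_cases hi : Integrable (fun z => φ (y, z)) (P.map Z)
    · rw [integral_sub hi (integrable_const _)]
      simp [regression]
    · refine integral_undef fun h => hi ?_
      have := h.add (integrable_const (regression P φ Z y))
      refine this.congr (ae_of_all _ fun z => ?_)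
      simp
  -- Freezing `Y` and one inner sample leaves an independent centered one; hence only the diagonal
  -- survives and the variance is of order `1/K`.
  have hcross : ∀ j k, j ≠ k → ∫ ω, dv (Y ω, Zs j ω) * dv (Y ω, Zs k ω) ∂P = 0 := by
    intro j k hjk
    have hm : Measurable fun s : ℕ → EuclideanSpace ℝ (Fin q) => (s j, s k) :=
      (measurable_pi_apply j).prodMk (measurable_pi_apply k)
    have hpair : IndepFun Y (fun ω => (Zs j ω, Zs k ω)) P :=
      hY_Zs.comp measurable_id hm
    have hind := indepFun_prodMk_of_indepFun hY (hZs_meas j) (hZs_meas k) hpair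
      (hZs_indep.indepFun hjk)
    have hΦ : Measurable fun p : (EuclideanSpace ℝ (Fin d) × EuclideanSpace ℝ (Fin q)) ×
        EuclideanSpace ℝ (Fin q) => dv p.1 * dv (p.1.1, p.2) :=
      (hdv.comp measurable_fst).mul
        (hdv.comp ((measurable_fst.comp measurable_fst).prodMk measurable_snd))
    have key := (integrable_and_integral_of_indepFun (hY.prodMk (hZs_meas j)) (hZs_meas k) hind hΦ
      ((hB j).integrable_mul (hB k))).2
    simp only at key
    rw [key]
    simp_rw [integral_const_mul, (hZs_ident k).map_eq, hzero]
    simp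
  have hsum : ∀ n : ℕ, ∫ ω, (∑ k ∈ Finset.range n, dv (Y ω, Zs k ω)) ^ 2 ∂P
      = n * ∫ ω, dv (Y ω, Z ω) ^ 2 ∂P := by
    intro n
    have hij : ∀ i j, Integrable (fun ω => dv (Y ω, Zs i ω) * dv (Y ω, Zs j ω)) P := fun i j =>
      (hB i).integrable_mul (hB j)
    simp_rw [sq, Finset.sum_mul_sum]
    rw [integral_finsetSum _ fun i _ => integrable_finsetSum _ fun j _ => hij i j]
    simp_rw [integral_finsetSum _ fun j _ => hij _ j]
    have : ∀ i ∈ Finset.range n, ∑ j ∈ Finset.range n,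
        ∫ ω, dv (Y ω, Zs i ω) * dv (Y ω, Zs j ω) ∂P = ∫ ω, dv (Y ω, Z ω) * dv (Y ω, Z ω) ∂P := by
      intro i hi
      rw [Finset.sum_eq_single_of_mem i hi fun j _ hj => hcross i j hj.symm]
      simpa [sq] using hsq i
    rw [Finset.sum_congr rfl this]
    simp
  refine ⟨∫ ω, dv (Y ω, Z ω) ^ 2 ∂P, fun K => le_of_eq ?_⟩
  have hK : (0 : ℝ) < K := by exact_mod_cast K.pos
  have e : (fun ω => (nestedLoss φ Y Zs K ω - loss P φ Y Z ω) ^ 2) =ᵐ[P]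
      fun ω => ((K : ℝ)⁻¹) ^ 2 * (∑ k ∈ Finset.range (K : ℕ), dv (Y ω, Zs k ω)) ^ 2 := by
    filter_upwards [hae] with ω hω
    rw [hω, ← mul_pow]
    congr 1
    simp only [nestedLoss, dv, Finset.sum_sub_distrib, Finset.sum_const, Finset.card_range,
      nsmul_eq_mul]
    field_simp
  rw [integral_congr_ae e, integral_const_mul, hsum]
  field_simp

end NestedLoss

/-! ### Consequences of the standing assumptions -/

section Consequences

variable {Ω : Type*} [MeasurableSpace Ω] {P : Measure Ω} [IsProbabilityMeasure P]
  {α : ℝ} {X0 : Ω → ℝ} {XL : ℕ+ → Ω → ℝ} {f0 v : ℝ → ℝ} {f : ℕ+ → ℝ → ℝ}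

omit [IsProbabilityMeasure P] in
lemma Regularity.pos (h : Regularity P α X0 XL f0 f v) (x : ℝ) : 0 < f0 x := by
  obtain ⟨c, hc, hx⟩ := h.pdf_lower (|x - VaR P α X0| + 1) (by positivity)
  refine hc.trans_le (hx x ?_).1
  rw [Metric.mem_ball, Real.dist_eq]
  linarith

lemma Regularity.lawRegular (h : Regularity P α X0 XL f0 f v) (hX0 : AEMeasurable X0 P)
    (hXL : ∀ K, AEMeasurable (XL K) P) :
    ∃ (C : NNReal) (κ : ℝ), 0 < κ ∧ (∀ K x, |f K x| ≤ C) ∧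
      LawRegular (P.map X0) (VaR P α X0) (f0 (VaR P α X0)) C κ ∧
      ∀ K, κ ≤ f K (VaR P α X0) ∧
        LawRegular (P.map (XL K)) (VaR P α X0) (f K (VaR P α X0)) C κ := by
  obtain ⟨C, ⟨hC0, hL0⟩, hC⟩ := h.pdf_bounded_lipschitz
  obtain ⟨κ, hκ, hlow⟩ := h.pdf_lower 2 two_pos
  have := Measure.isProbabilityMeasure_map (μ := P) hX0
  refine ⟨C, κ, hκ, fun K => (hC K).1, ?_, fun K => ⟨?_, ?_⟩⟩
  · exact lawRegular_of_density h.pdf_zero.continuous h.pdf_zero.nonneg h.pdf_zero.map_eq hC0 hL0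
      fun ξ hξ => (hlow ξ hξ).1
  · exact (hlow _ (Metric.mem_ball_self two_pos)).2 K
  · have := Measure.isProbabilityMeasure_map (μ := P) (hXL K)
    exact lawRegular_of_density (h.pdf K).continuous (h.pdf K).nonneg (h.pdf K).map_eq (hC K).1
      (hC K).2 fun ξ hξ => (hlow ξ hξ).2 K

lemma Regularity.drift_zero (h : Regularity P α X0 XL f0 f v) (hα : α ∈ Set.Ioo (0 : ℝ) 1)
    (hX0 : AEMeasurable X0 P) : drift α (P.map X0) (VaR P α X0) = 0 := by
  rw [drift, ← cdfOf_eq_Iio hX0 h.pdf_zero, cdfOf_VaR hX0 h.pdf_zero h.pos hα, sub_self, mul_zero]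

lemma mul_bias (K : ℕ+) : (K : ℝ) * bias K = 1 := by
  have hK : (0 : ℝ) < K := by exact_mod_cast K.pos
  rw [bias]
  field_simp

/-- As `F_{X_0}(s) = α`, the mean field at `s` is `c` times the cdf error there, of which `v` is the
leading coefficient. -/
lemma Regularity.tendsto_mul_drift (h : Regularity P α X0 XL f0 f v) (hα : α ∈ Set.Ioo (0 : ℝ) 1)
    (hX0 : AEMeasurable X0 P) (hX0i : Integrable X0 P) (hXL : ∀ K, AEMeasurable (XL K) P) :
    Tendsto (fun K : ℕ+ => (K : ℝ) * drift α (P.map (XL K)) (VaR P α X0)) atTop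
      (𝓝 (1 / (1 - α) * v (VaR P α X0))) := by
  obtain ⟨w, hw, hmin⟩ := h.expansion
  have hs := cdfOf_VaR hX0 h.pdf_zero h.pos hα
  obtain ⟨-, hw0, -⟩ := hmin _ (isMinOn_objective hX0 hX0i hα.2 hs)
  have e : ∀ K : ℕ+, (K : ℝ) * drift α (P.map (XL K)) (VaR P α X0) =
      1 / (1 - α) * (v (VaR P α X0) + w (VaR P α X0) K) := fun K => by
    have h1 := hw K (VaR P α X0)
    have h2 := mul_bias K
    rw [drift, ← cdfOf_eq_Iio (hXL K) (h.pdf K)]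
    rw [hs] at h1
    rw [h1]
    linear_combination (1 / (1 - α) * (v (VaR P α X0) + w (VaR P α X0) K)) * h2
  simp_rw [e]
  simpa using (hw0.const_add (v (VaR P α X0))).const_mul (1 / (1 - α))

lemma Regularity.tendsto_mul_objective_sub (h : Regularity P α X0 XL f0 f v)
    (hα : α ∈ Set.Ioo (0 : ℝ) 1) (hX0 : AEMeasurable X0 P) (hX0i : Integrable X0 P)
    (hXL : ∀ K, AEMeasurable (XL K) P) (hXLi : ∀ K, Integrable (XL K) P) :
    Tendsto (fun K : ℕ+ => (K : ℝ) *
      (objective P α (XL K) (VaR P α X0) - objective P α X0 (VaR P α X0))) atTop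
      (𝓝 (-∫ ξ in Set.Ioi (VaR P α X0), v ξ / (1 - α))) := by
  obtain ⟨w, hw, hmin⟩ := h.expansion
  have hs := cdfOf_VaR hX0 h.pdf_zero h.pos hα
  obtain ⟨hv, -, hw0⟩ := hmin _ (isMinOn_objective hX0 hX0i hα.2 hs)
  set s := VaR P α X0
  obtain ⟨i0, e0⟩ := integral_posPart_eq_integral_tail hX0 hX0i s
  have key : ∀ K : ℕ+, (K : ℝ) * (objective P α (XL K) s - objective P α X0 s) =
      -(1 / (1 - α)) * (∫ ξ in Set.Ioi s, v ξ) - 1 / (1 - α) * ∫ ξ in Set.Ioi s, w ξ K := fun K => by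
    obtain ⟨iK, eK⟩ := integral_posPart_eq_integral_tail (hXL K) (hXLi K) s
    have h2 := mul_bias K
    -- Solving the expansion for `w` exhibits it as a combination of integrable functions, which
    -- licenses splitting the integral.
    have ew : ∀ ξ, w ξ K = (K : ℝ) * ((1 - cdfOf P X0 ξ) - (1 - cdfOf P (XL K) ξ)) - v ξ := fun ξ => by
      have h1 := hw K ξ
      linear_combination (K : ℝ) * (-h1) - (v ξ + w ξ K) * h2
    have i1 : IntegrableOn (fun ξ => (1 - cdfOf P X0 ξ) - (1 - cdfOf P (XL K) ξ)) (Set.Ioi s) :=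
      i0.sub iK
    have i2 : IntegrableOn
        (fun ξ => (K : ℝ) * ((1 - cdfOf P X0 ξ) - (1 - cdfOf P (XL K) ξ))) (Set.Ioi s) :=
      i1.const_mul _
    simp_rw [ew]
    rw [integral_sub i2 hv, integral_const_mul, integral_sub i0 iK, ← e0, ← eK, objective, objective]
    ring
  simp_rw [key]
  have h3 := (hw0.const_mul (1 / (1 - α))).const_sub (-(1 / (1 - α)) * (∫ ξ in Set.Ioi s, v ξ))
  convert h3 using 2
  simp_rw [div_eq_inv_mul]
  rw [integral_const_mul]
  ring

/-- The moment condition on the initial values yields uniform exponential moments. -/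
lemma InitialMoment.exists_exp_bound {ξ₀ : ℕ+ → Ω → ℝ} (h : InitialMoment P α f ξ₀)
    (hα : α ∈ Set.Ioo (0 : ℝ) 1) (hξ₀ : ∀ K, Measurable (ξ₀ K)) {C : ℝ}
    (hC : ∀ K x, |f K x| ≤ C) {s : ℝ} (hpos : 0 < f 1 s) :
    ∃ l A : ℝ, 0 < l ∧ ∀ K, Integrable (fun ω => Real.exp (l * |ξ₀ K ω|)) P ∧
      ∫ ω, Real.exp (l * |ξ₀ K ω|) ∂P ≤ A := by
  have h1 : 0 < 1 - α := by linarith [hα.2]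
  set S := ⨆ K' : ℕ+, ⨆ x : ℝ, |f K' x| with hS
  -- Boundedness matters because a real supremum defaults to zero on unbounded families; the
  -- exponent `l` must be positive.
  have hb : ∀ K, BddAbove (Set.range fun x => |f K x|) := fun K =>
    ⟨C, by rintro _ ⟨x, rfl⟩; exact hC K x⟩
  have hb2 : BddAbove (Set.range fun K' : ℕ+ => ⨆ x : ℝ, |f K' x|) :=
    ⟨C, by rintro _ ⟨K, rfl⟩; exact ciSup_le (hC K)⟩
  have hSpos : 0 < S :=
    (hpos.trans_le (le_abs_self _)).trans_le ((le_ciSup (hb 1) s).trans (le_ciSup hb2 1))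
  set l := 4 / (1 - α) * max 1 (α / (1 - α)) * S with hl
  have hm : 0 < max 1 (α / (1 - α)) := lt_max_of_lt_left one_pos
  have hl0 : 0 < l := by positivity
  set T := ⨆ K : ℕ+, ∫⁻ ω, ENNReal.ofReal (|ξ₀ K ω| ^ 2 * Real.exp (l * |ξ₀ K ω|)) ∂P with hT
  have hTtop : T < ⊤ := h
  refine ⟨l, Real.exp l + T.toReal, hl0, fun K => ?_⟩
  have hmeas : Measurable fun ω => |ξ₀ K ω| ^ 2 * Real.exp (l * |ξ₀ K ω|) := by
    have := hξ₀ K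
    fun_prop
  have hnn : ∀ ω, 0 ≤ |ξ₀ K ω| ^ 2 * Real.exp (l * |ξ₀ K ω|) := fun ω => by positivity
  have hle : ∫⁻ ω, ENNReal.ofReal (|ξ₀ K ω| ^ 2 * Real.exp (l * |ξ₀ K ω|)) ∂P ≤ T :=
    le_iSup (fun K : ℕ+ => ∫⁻ ω, ENNReal.ofReal (|ξ₀ K ω| ^ 2 * Real.exp (l * |ξ₀ K ω|)) ∂P) K
  have hi : Integrable (fun ω => |ξ₀ K ω| ^ 2 * Real.exp (l * |ξ₀ K ω|)) P := by
    refine (lintegral_ofReal_ne_top_iff_integrable hmeas.aestronglyMeasurable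
      (ae_of_all _ hnn)).1 (hle.trans_lt hTtop).ne
  have hi2 : Integrable (fun ω => Real.exp l + |ξ₀ K ω| ^ 2 * Real.exp (l * |ξ₀ K ω|)) P :=
    (integrable_const _).add hi
  -- The polynomial weight is below one only where `|ξ₀| < 1`, and there the exponential is at most
  -- `exp l`.
  have hdom : ∀ ω, Real.exp (l * |ξ₀ K ω|) ≤
      Real.exp l + |ξ₀ K ω| ^ 2 * Real.exp (l * |ξ₀ K ω|) := fun ω => by
    rcases le_total |ξ₀ K ω| 1 with h2 | h2
    · have := Real.exp_le_exp.2 (mul_le_of_le_one_right hl0.le h2)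
      linarith [hnn ω]
    · have h3 : 1 ≤ |ξ₀ K ω| ^ 2 := one_le_pow₀ h2
      have h4 := le_mul_of_one_le_left (Real.exp_pos (l * |ξ₀ K ω|)).le h3
      linarith [Real.exp_pos l]
  have hi3 : Integrable (fun ω => Real.exp (l * |ξ₀ K ω|)) P := by
    refine hi2.mono' ?_ (ae_of_all _ fun ω => ?_)
    · have := hξ₀ K
      exact Measurable.aestronglyMeasurable (by fun_prop)
    · rw [Real.norm_of_nonneg (Real.exp_pos _).le]
      exact hdom ω
  refine ⟨hi3, (integral_mono hi3 hi2 hdom).trans ?_⟩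
  rw [integral_add (integrable_const _) hi, integral_const, probReal_univ, one_smul,
    integral_eq_lintegral_of_nonneg_ae (ae_of_all _ hnn) hmeas.aestronglyMeasurable]
  gcongr
  exact hTtop.ne

/-- Uniform mean square control of the runs, for small bias. -/
lemma Regularity.exists_eventually_controlled (h : Regularity P α X0 XL f0 f v)
    (hα : α ∈ Set.Ioo (0 : ℝ) 1) (hX0 : AEMeasurable X0 P) (hX0i : Integrable X0 P)
    (hXL : ∀ K, AEMeasurable (XL K) P) {ξ₀ : ℕ+ → Ω → ℝ} {X : ℕ+ → ℕ → Ω → ℝ}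
    (R : ∀ K, Run P (ξ₀ K) (X K) (P.map (XL K))) (hξ : InitialMoment P α f ξ₀) {γ₁ β : ℝ}
    (hγ₁ : 0 < γ₁) (hβ : β ∈ Set.Ioo (1 / 2 : ℝ) 1) :
    ∃ B : ℝ, 0 ≤ B ∧ ∀ᶠ K : ℕ+ in atTop,
      Controlled P α γ₁ β (VaR P α X0) B (ξ₀ K) (X K) ((K : ℕ) ^ 2) := by
  obtain ⟨C, κ, hκ, hC, -, hK⟩ := h.lawRegular hX0 hXL
  obtain ⟨l, A, hl, hA⟩ := hξ.exists_exp_bound hα (fun K => (R K).meas_init) hC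
    (hκ.trans_le (hK 1).1)
  have hd := h.tendsto_mul_drift hα hX0 hX0i hXL
  set s := VaR P α X0
  -- Adding one gives strict room above the limit, so `K |drift(s)| ≤ G` eventually.
  set G := |1 / (1 - α) * v s| + 1 with hG
  have hG0 : 0 < G := by positivity
  obtain ⟨B, ε, hB, hε, hbound⟩ := exists_moment_bound (P := P) hα hγ₁ (by linarith [hβ.1]) hβ.2 hκ
    hl (M := G ^ 2 / γ₁) (by positivity) A s
  refine ⟨B, hB, ?_⟩
  have h1 := hd.abs.eventually_le_const (show |1 / (1 - α) * v s| < G by rw [hG]; linarith)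
  have h2 : ∀ᶠ K : ℕ+ in atTop, G / ε ≤ (K : ℝ) := tendsto_pnat_cast.eventually_ge_atTop _
  filter_upwards [h1, h2] with K hK1 hK2
  have hKp : (0 : ℝ) < K := by exact_mod_cast K.pos
  rw [abs_mul, abs_of_pos hKp] at hK1
  have hdr : |drift α (P.map (XL K)) s| ≤ ε := by
    rw [div_le_iff₀ hε] at hK2
    exact le_of_mul_le_mul_left (hK1.trans hK2) hKp
  -- The choice of `K²` iterations matters here: `drift(s)² ≤ G²/K² ≤ G²/(k+1) ≤ (G²/γ₁) γ_{k+1}`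
  -- for `k < K²`, so the bias is no larger than the Gronwall recursion tolerates.
  obtain ⟨c1, c2, c3⟩ := hbound (ξ₀ K) (X K) _ _ _ ((K : ℕ) ^ 2) (R K) (hK K).2 (hA K).1 (hA K).2 hdr
    fun k hk => by
      have hk1 : ((k : ℝ) + 1) ≤ (K : ℝ) ^ 2 := by exact_mod_cast hk
      have e1 : ((k : ℝ) + 1)⁻¹ ≤ ((k : ℝ) + 1) ^ (-β) := by
        rw [← Real.rpow_neg_one]
        exact Real.rpow_le_rpow_of_exponent_le (by linarith [k.cast_nonneg (α := ℝ)])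
          (by linarith [hβ.2])
      have e2 : ((K : ℝ) ^ 2)⁻¹ ≤ ((k : ℝ) + 1)⁻¹ := inv_anti₀ (by positivity) hk1
      have e3 : ((K : ℝ) * |drift α (P.map (XL K)) s|) ^ 2 ≤ G ^ 2 :=
        pow_le_pow_left₀ (by positivity) hK1 2
      rw [mul_pow, sq_abs] at e3
      have e4 : drift α (P.map (XL K)) s ^ 2 ≤ G ^ 2 * ((K : ℝ) ^ 2)⁻¹ := by
        rw [← div_eq_mul_inv, le_div_iff₀ (by positivity)]
        linarith
      rw [stepSize]
      push_cast
      have e5 : G ^ 2 / γ₁ * (γ₁ * ((k : ℝ) + 1) ^ (-β)) = G ^ 2 * ((k : ℝ) + 1) ^ (-β) := by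
        field_simp
      rw [e5]
      exact e4.trans (mul_le_mul_of_nonneg_left (e2.trans e1) (by positivity))
  exact ⟨c1, c2, c3⟩

end Consequences

/-! ### Markov's inequality for vanishing remainders -/

section Measure

variable {Ω : Type*} [MeasurableSpace Ω] {P : Measure Ω} [IsProbabilityMeasure P]

lemma tendstoInMeasure_zero_of_integral_le {ι E : Type*} [SeminormedAddCommGroup E] {l : Filter ι}
    {T : ι → Ω → E} {G : ι → Ω → ℝ} {b : ι → ℝ} (hTG : ∀ i ω, ‖T i ω‖ ≤ G i ω)
    (hG : ∀ᶠ i in l, Integrable (G i) P) (hb : ∀ᶠ i in l, ∫ ω, G i ω ∂P ≤ b i)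
    (hb0 : Tendsto b l (𝓝 0)) : TendstoInMeasure P T l (fun _ => 0) := by
  rw [tendstoInMeasure_iff_measureReal_norm]
  intro ε hε
  have hlim : Tendsto (fun i => b i / ε) l (𝓝 0) := by simpa using hb0.div_const ε
  refine tendsto_of_tendsto_of_tendsto_of_le_of_le' tendsto_const_nhds hlim
    (Eventually.of_forall fun i => measureReal_nonneg) ?_
  filter_upwards [hG, hb] with i h1 h2
  rw [le_div_iff₀ hε]
  have h3 := mul_meas_ge_le_integral_of_nonneg
    (ae_of_all P fun ω => (norm_nonneg _).trans (hTG i ω)) h1 ε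
  have h4 : P.real {ω | ε ≤ ‖T i ω - 0‖} ≤ P.real {ω | ε ≤ G i ω} := by
    refine measureReal_mono fun ω hω => ?_
    have : ε ≤ ‖T i ω - 0‖ := hω
    rw [sub_zero] at this
    exact this.trans (hTG i ω)
  nlinarith

end Measure

/-! ### Linearized increments: `L²` continuity in the loss, and covariance -/

section Increments

variable {Ω : Type*} [MeasurableSpace Ω] {P : Measure Ω} [IsProbabilityMeasure P]
  {α s : ℝ} {U W : Ω → ℝ}

lemma measurable_H₁_right : Measurable fun y => H₁ α s y :=
  measurable_H₁.comp (measurable_const.prodMk measurable_id)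

lemma measurable_rho_right : Measurable fun y => rho α s y :=
  measurable_rho.comp (measurable_const.prodMk measurable_id)

lemma integral_H₁_comp (hα : α ∈ Set.Ioo (0 : ℝ) 1) (hU : Measurable U) :
    ∫ ω, H₁ α s (U ω) ∂P = drift α (P.map U) s := by
  have := Measure.isProbabilityMeasure_map (μ := P) hU.aemeasurable
  rw [← integral_H₁ hα, integral_map hU.aemeasurable measurable_H₁_right.aestronglyMeasurable]

lemma memLp_H₁_comp (hα : α ∈ Set.Ioo (0 : ℝ) 1) (hU : Measurable U) :
    MemLp (fun ω => H₁ α s (U ω)) 2 P :=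
  MemLp.of_bound (measurable_H₁_right.comp hU).aestronglyMeasurable _
    (ae_of_all _ fun ω => abs_H₁_le hα s (U ω))

omit [IsProbabilityMeasure P] in
lemma memLp_posPart_comp [IsFiniteMeasure P] (h2 : MemLp U 2 P) :
    MemLp (fun ω => max (U ω - s) 0) 2 P :=
  (h2.sub (memLp_const s)).pos_part

lemma memLp_rho_comp (h2 : MemLp U 2 P) : MemLp (fun ω => rho α s (U ω)) 2 P :=
  (memLp_const s).add ((memLp_posPart_comp h2).const_mul (1 / (1 - α)))

lemma integral_rho_comp (h2 : MemLp U 2 P) :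
    ∫ ω, rho α s (U ω) ∂P = objective P α U s := by
  simp only [rho, objective]
  have i := ((memLp_posPart_comp (s := s) h2).integrable one_le_two).const_mul (1 / (1 - α))
  rw [integral_add (integrable_const s) i, integral_const_mul]
  simp

/-- The two indicators disagree only if `y` is within `ε` of `s` or `x` and `y` are at least `ε`
apart. -/
lemma sq_H₁_sub_le {ε : ℝ} (hε : 0 < ε) (x y : ℝ) :
    (H₁ α s x - H₁ α s y) ^ 2 ≤ (1 / (1 - α)) ^ 2 *
      ((Set.Ico (s - ε) (s + ε)).indicator (fun _ => (1 : ℝ)) y + (x - y) ^ 2 / ε ^ 2) := by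
  have e : (H₁ α s x - H₁ α s y) ^ 2 = (1 / (1 - α)) ^ 2 *
      ((Set.Ici s).indicator (fun _ => (1 : ℝ)) x - (Set.Ici s).indicator (fun _ => 1) y) ^ 2 := by
    simp only [H₁]; ring
  rw [e]
  refine mul_le_mul_of_nonneg_left ?_ (sq_nonneg _)
  have h0 : 0 ≤ (x - y) ^ 2 / ε ^ 2 := by positivity
  have hI : 0 ≤ (Set.Ico (s - ε) (s + ε)).indicator (fun _ => (1 : ℝ)) y :=
    Set.indicator_nonneg (fun _ _ => zero_le_one) _
  by_cases hy : y ∈ Set.Ico (s - ε) (s + ε)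
  · rw [Set.indicator_of_mem hy]
    by_cases h1 : s ≤ x <;> by_cases h2 : s ≤ y <;> simp [h1, h2] <;> linarith
  · have far : (s ≤ x ∧ ¬ s ≤ y ∨ ¬ s ≤ x ∧ s ≤ y) → 1 ≤ (x - y) ^ 2 / ε ^ 2 := by
      intro h
      rw [le_div_iff₀ (by positivity), one_mul, ← sq_abs (x - y)]
      refine pow_le_pow_left₀ hε.le ?_ 2
      rw [Set.mem_Ico, not_and_or, not_le, not_lt] at hy
      rcases h with ⟨h1, h2⟩ | ⟨h1, h2⟩
      · rw [not_le] at h2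
        refine le_trans ?_ (le_abs_self _)
        rcases hy with hy | hy <;> linarith
      · rw [not_le] at h1
        refine le_trans ?_ (neg_le_abs _)
        rcases hy with hy | hy <;> linarith
    by_cases h1 : s ≤ x <;> by_cases h2 : s ≤ y
    · simp only [Set.mem_Ici, h1, h2, Set.indicator_of_mem]
      linarith
    · have := far (Or.inl ⟨h1, h2⟩)
      simp only [Set.mem_Ici, h1, h2, Set.indicator_of_mem, not_false_eq_true,
        Set.indicator_of_notMem]
      linarith
    · have := far (Or.inr ⟨h1, h2⟩)
      simp only [Set.mem_Ici, h1, h2, Set.indicator_of_mem, not_false_eq_true,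
        Set.indicator_of_notMem]
      linarith
    · simp only [Set.mem_Ici, h1, h2, not_false_eq_true, Set.indicator_of_notMem]
      linarith

lemma integral_sq_H₁_comp_sub_le (hα : α ∈ Set.Ioo (0 : ℝ) 1) (hU : Measurable U)
    (hW : Measurable W) (hU2 : MemLp U 2 P) (hW2 : MemLp W 2 P) {b L κ : ℝ}
    (hν : LawRegular (P.map W) s b L κ) {ε : ℝ} (hε : 0 < ε) :
    ∫ ω, (H₁ α s (U ω) - H₁ α s (W ω)) ^ 2 ∂P ≤
      (1 / (1 - α)) ^ 2 * (L * (2 * ε) + (∫ ω, (U ω - W ω) ^ 2 ∂P) / ε ^ 2) := by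
  have := Measure.isProbabilityMeasure_map (μ := P) hW.aemeasurable
  have i1 : Integrable (fun ω => (H₁ α s (U ω) - H₁ α s (W ω)) ^ 2) P :=
    ((memLp_H₁_comp hα hU).sub (memLp_H₁_comp hα hW)).integrable_sq
  have i2 : Integrable
      (fun ω => (Set.Ico (s - ε) (s + ε)).indicator (fun _ => (1 : ℝ)) (W ω)) P :=
    Integrable.of_bound
      ((measurable_const.indicator measurableSet_Ico).comp hW).aestronglyMeasurable 1
      (ae_of_all _ fun ω => by
        refine (norm_indicator_le_norm_self _ _).trans ?_
        simp)
  have i3 : Integrable (fun ω => (U ω - W ω) ^ 2 / ε ^ 2) P :=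
    ((hU2.sub hW2).integrable_sq).div_const _
  have i4 : Integrable (fun ω => (1 / (1 - α)) ^ 2 *
      ((Set.Ico (s - ε) (s + ε)).indicator (fun _ => (1 : ℝ)) (W ω)
        + (U ω - W ω) ^ 2 / ε ^ 2)) P := (i2.add i3).const_mul _
  refine (integral_mono i1 i4 fun ω => sq_H₁_sub_le hε _ _).trans ?_
  rw [integral_const_mul, integral_add i2 i3, integral_div]
  refine mul_le_mul_of_nonneg_left (add_le_add_left ?_ _) (sq_nonneg _)
  have e1 : ∫ ω, (Set.Ico (s - ε) (s + ε)).indicator (fun _ => (1 : ℝ)) (W ω) ∂P =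
      (P.map W).real (Set.Ico (s - ε) (s + ε)) := by
    rw [← integral_map (φ := W) hW.aemeasurable
      (f := (Set.Ico (s - ε) (s + ε)).indicator fun _ => (1 : ℝ))
      (measurable_const.indicator measurableSet_Ico).aestronglyMeasurable,
      integral_indicator measurableSet_Ico]
    simp
  have e2 := measureReal_Ico_min_max (ν := P.map W) (s - ε) (s + ε)
  rw [min_eq_left (by linarith), max_eq_right (by linarith)] at e2
  rw [e1, e2]
  refine (hν.lip _ _).trans (le_of_eq ?_)
  rw [show s + ε - (s - ε) = 2 * ε by ring, abs_of_pos (by positivity)]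

lemma tendsto_integral_sq_H₁_sub (hα : α ∈ Set.Ioo (0 : ℝ) 1) {XL : ℕ+ → Ω → ℝ}
    (hXL : ∀ K, Measurable (XL K)) (hW : Measurable W) (hXL2 : ∀ K, MemLp (XL K) 2 P)
    (hW2 : MemLp W 2 P) {b L κ : ℝ} (hν : LawRegular (P.map W) s b L κ) {V : ℝ}
    (hV : ∀ K : ℕ+, ∫ ω, (XL K ω - W ω) ^ 2 ∂P ≤ V * (K : ℝ)⁻¹) :
    Tendsto (fun K => ∫ ω, (H₁ α s (XL K ω) - H₁ α s (W ω)) ^ 2 ∂P) atTop (𝓝 0) := by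
  have l1 : Tendsto (fun K : ℕ+ => (K : ℝ) ^ (-(1 / 4) : ℝ)) atTop (𝓝 0) :=
    (tendsto_rpow_neg_atTop (by norm_num)).comp tendsto_pnat_cast
  have l2 : Tendsto (fun K : ℕ+ => (K : ℝ) ^ (-(1 / 2) : ℝ)) atTop (𝓝 0) :=
    (tendsto_rpow_neg_atTop (by norm_num)).comp tendsto_pnat_cast
  have l3 := (((l1.const_mul 2).const_mul L).add (l2.const_mul V)).const_mul ((1 / (1 - α)) ^ 2)
  simp only [mul_zero, add_zero] at l3
  refine squeeze_zero (fun K => integral_nonneg fun ω => sq_nonneg _) (fun K => ?_) l3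
  have hK : (0 : ℝ) < K := by exact_mod_cast K.pos
  -- The choice `ε = K^{-1/4}` leaves errors `K^{-1/4}` and `K^{-1/2}`; both vanish because `ε → 0`
  -- and `K ε² → ∞`.
  refine (integral_sq_H₁_comp_sub_le hα (hXL K) hW (hXL2 K) hW2 hν
    (Real.rpow_pos_of_pos hK (-(1 / 4)))).trans ?_
  refine mul_le_mul_of_nonneg_left (add_le_add_right ?_ _) (sq_nonneg _)
  rw [div_le_iff₀ (by positivity)]
  refine (hV K).trans (le_of_eq ?_)
  rw [mul_assoc]
  congr 1
  rw [← Real.rpow_natCast, ← Real.rpow_mul hK.le, ← Real.rpow_add hK, ← Real.rpow_neg_one]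
  norm_num

lemma abs_rho_sub_right_le (hα : α ∈ Set.Ioo (0 : ℝ) 1) (x y : ℝ) :
    |rho α s x - rho α s y| ≤ 1 / (1 - α) * |x - y| := by
  have h1 : 0 < 1 - α := by linarith [hα.2]
  have e : rho α s x - rho α s y = 1 / (1 - α) * (max (x - s) 0 - max (y - s) 0) := by
    simp only [rho]; ring
  rw [e, abs_mul, abs_of_pos (by positivity)]
  refine mul_le_mul_of_nonneg_left ?_ (by positivity)
  have := abs_max_sub_max_le_abs (x - s) (y - s) 0
  rwa [sub_sub_sub_cancel_right] at this

/-- The covariance matrix of the linearized algorithm. -/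
lemma secondMomentMatrix_eq_limitCov (hα : α ∈ Set.Ioo (0 : ℝ) 1) {X0 : Ω → ℝ} {f0 : ℝ → ℝ}
    (hX : Measurable X0) (hX2 : MemLp X0 2 P) (hf : HasContinuousPDF P X0 f0)
    (hpos : ∀ x, 0 < f0 x) :
    secondMomentMatrix P
      (fun ω => -(1 / (1 - α) * f0 (VaR P α X0))⁻¹ * H₁ α (VaR P α X0) (X0 ω))
      (fun ω => rho α (VaR P α X0) (X0 ω) - objective P α X0 (VaR P α X0)) =
      limitCov P α X0 f0 := by
  have h1 : 0 < 1 - α := by linarith [hα.2]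
  have hF : cdfOf P X0 (VaR P α X0) = α := cdfOf_VaR hX.aemeasurable hf hpos hα
  simp only [limitCov]
  set s := VaR P α X0
  have hfs : f0 s ≠ 0 := (hpos s).ne'
  have hd : ∫ ω, H₁ α s (X0 ω) ∂P = 0 := by
    rw [integral_H₁_comp hα hX, drift, ← cdfOf_eq_Iio hX.aemeasurable hf, hF, sub_self, mul_zero]
  set p : Ω → ℝ := fun ω => max (X0 ω - s) 0 with hp
  have hp2 : MemLp p 2 P := memLp_posPart_comp hX2
  have hH2 : MemLp (fun ω => H₁ α s (X0 ω)) 2 P := memLp_H₁_comp hα hX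
  have hHi := hH2.integrable one_le_two
  have hHp : Integrable (fun ω => H₁ α s (X0 ω) * p ω) P := hH2.integrable_mul hp2
  -- Where the positive part is nonzero, `H₁` has the constant value `-α/(1-α)`.
  have ep : ∀ ω, H₁ α s (X0 ω) * p ω = -(α / (1 - α)) * p ω := fun ω => by
    by_cases h : s ≤ X0 ω
    · simp only [H₁, Set.mem_Ici, h, Set.indicator_of_mem]
      field_simp
      ring
    · simp [hp, max_eq_right (by linarith : X0 ω - s ≤ 0)]
  -- `H₁` takes only the values `1` and `-α/(1-α)`, hence satisfies the quadratic equation with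
  -- these roots.
  have eH : ∀ ω, H₁ α s (X0 ω) ^ 2 =
      α / (1 - α) + (1 - 2 * α) / (1 - α) * H₁ α s (X0 ω) := fun ω => by
    by_cases h : s ≤ X0 ω
    · simp only [H₁, Set.mem_Ici, h, Set.indicator_of_mem]
      field_simp
      ring
    · simp only [H₁, Set.mem_Ici, h, not_false_eq_true, Set.indicator_of_notMem]
      field_simp
      ring
  have m11 : ∫ ω, H₁ α s (X0 ω) ^ 2 ∂P = α / (1 - α) := by
    simp_rw [eH]
    rw [integral_add (integrable_const _) (hHi.const_mul _), integral_const_mul, hd]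
    simp
  have eb : ∀ ω, rho α s (X0 ω) - objective P α X0 s = 1 / (1 - α) * (p ω - ∫ ω', p ω' ∂P) :=
    fun ω => by simp only [rho, objective, hp]; ring
  have m12 : ∫ ω, H₁ α s (X0 ω) * (p ω - ∫ ω', p ω' ∂P) ∂P = -(α / (1 - α)) * ∫ ω, p ω ∂P := by
    simp_rw [mul_sub]
    rw [integral_sub hHp (hHi.mul_const _), integral_mul_const, hd]
    simp_rw [ep]
    rw [integral_const_mul]
    ring
  have m22 : ∫ ω, (p ω - ∫ ω', p ω' ∂P) ^ 2 ∂P = variance p P :=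
    (variance_eq_integral hp2.aestronglyMeasurable.aemeasurable).symm
  have hc : 1 - α ≠ 0 := h1.ne'
  rw [secondMomentMatrix]
  have t11 : ∫ ω, (-(1 / (1 - α) * f0 s)⁻¹ * H₁ α s (X0 ω)) ^ 2 ∂P = α * (1 - α) / f0 s ^ 2 := by
    simp_rw [mul_pow]
    rw [integral_const_mul, m11]
    field_simp
  have t12 : ∫ ω, -(1 / (1 - α) * f0 s)⁻¹ * H₁ α s (X0 ω) *
      (rho α s (X0 ω) - objective P α X0 s) ∂P = α / (1 - α) * ((∫ ω, p ω ∂P) / f0 s) := by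
    have : ∀ ω, -(1 / (1 - α) * f0 s)⁻¹ * H₁ α s (X0 ω) * (rho α s (X0 ω) - objective P α X0 s)
        = -(f0 s)⁻¹ * (H₁ α s (X0 ω) * (p ω - ∫ ω', p ω' ∂P)) := fun ω => by
      rw [eb]
      field_simp
    simp_rw [this]
    rw [integral_const_mul, m12]
    field_simp
  have t22 : ∫ ω, (rho α s (X0 ω) - objective P α X0 s) ^ 2 ∂P =
      variance p P / (1 - α) ^ 2 := by
    simp_rw [eb, mul_pow]
    rw [integral_const_mul, m22]
    field_simp
  rw [t11, t12, t22]

end Increments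

/-! ### Iteration count, integrability and measurability of the remainders -/

section LimitTheorem

variable {Ω : Type*} [MeasurableSpace Ω] {P : Measure Ω} [IsProbabilityMeasure P]

lemma numIter_eq (K : ℕ+) : numIter K = (K : ℕ) ^ 2 := by
  have : ((bias K) ^ 2)⁻¹ = (((K : ℕ) ^ 2 : ℕ) : ℝ) := by
    rw [bias]
    push_cast
    simp
  rw [numIter, this, Nat.ceil_natCast]

lemma norm_toLp_pair_le (a b : ℝ) : ‖(!₂[a, b] : EuclideanSpace ℝ (Fin 2))‖ ≤ |a| + |b| := by
  rw [EuclideanSpace.norm_eq, Fin.sum_univ_two]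
  refine Real.sqrt_le_iff.2 ⟨by positivity, ?_⟩
  simp only [Real.norm_eq_abs, Matrix.cons_val_zero, Matrix.cons_val_one]
  nlinarith [mul_nonneg (abs_nonneg a) (abs_nonneg b)]

lemma measurable_toLp_pair {a b : Ω → ℝ} (ha : Measurable a) (hb : Measurable b) :
    Measurable fun ω => (!₂[a ω, b ω] : EuclideanSpace ℝ (Fin 2)) := by
  refine (WithLp.measurable_toLp 2 _).comp (measurable_pi_lambda _ fun i => ?_)
  fin_cases i
  · exact ha
  · exact hb

variable {ξ₀ : Ω → ℝ} {x : ℕ → Ω → ℝ} {ν : Measure ℝ} {α γ₁ β s B : ℝ} {N : ℕ}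

omit [IsProbabilityMeasure P] in
lemma Run.identDistrib {U : Ω → ℝ} (R : Run P ξ₀ x (P.map U)) (hU : Measurable U) (n : ℕ) :
    IdentDistrib (x n) U P P :=
  ⟨(R.meas n).aemeasurable, hU.aemeasurable, R.law n⟩

lemma Controlled.integrable_xi_remainder (h : Controlled P α γ₁ β s B ξ₀ x N)
    (R : Run P ξ₀ x ν) (hα : α ∈ Set.Ioo (0 : ℝ) 1) (a : ℝ) :
    Integrable (fun ω => a * ∑ k ∈ Finset.Icc 1 N, (xiProc α (stepSize γ₁ β) ξ₀ x k ω - s)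
        + ∑ k ∈ Finset.range N, H₁ α s (x k ω)) P :=
  ((integrable_finsetSum _ fun k _ => (h.memLp k).integrable one_le_two).const_mul a).add
    (integrable_finsetSum _ fun k _ => (memLp_H₁_comp hα (R.meas k)).integrable one_le_two)

lemma Controlled.integrable_chi_remainder (h : Controlled P α γ₁ β s B ξ₀ x N)
    (hx : ∀ k, MemLp (x k) 2 P) :
    Integrable (fun ω => N * chiIter α (stepSize γ₁ β) (ξ₀ ω) (fun k => x k ω) N
        - ∑ k ∈ Finset.range N, rho α s (x k ω)) P := by
  simp_rw [mul_chiIter]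
  refine (integrable_finsetSum _ fun k _ => ?_).sub
    (integrable_finsetSum _ fun k _ => (memLp_rho_comp (hx k)).integrable one_le_two)
  have i1 : Integrable (xiProc α (stepSize γ₁ β) ξ₀ x k) P := by
    have := ((h.memLp k).integrable one_le_two).add (integrable_const s)
    refine this.congr (ae_of_all _ fun ω => ?_)
    simp
  exact i1.add ((((hx k).integrable one_le_two).sub i1).pos_part.const_mul (1 / (1 - α)))

omit [IsProbabilityMeasure P] in
lemma Run.measurable_chi (R : Run P ξ₀ x ν) (γ : ℕ → ℝ) (N : ℕ) :
    Measurable fun ω => (N : ℝ) * chiIter α γ (ξ₀ ω) (fun k => x k ω) N := by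
  simp_rw [mul_chiIter]
  exact Finset.measurable_fun_sum _ fun k _ =>
    measurable_rho.comp ((R.measurable_xiProc (α := α) (γ := γ) k).prodMk (R.meas k))

end LimitTheorem

/-! ### Assembly of the limit theorem -/

section Main

variable {Ω : Type*} [MeasurableSpace Ω] {P : Measure Ω} [IsProbabilityMeasure P]

set_option maxHeartbeats 1000000 in
/-- Central limit theorem for the averaged algorithm, for square integrable approximations `XL K`
of `X0` at mean square rate `1 / K`. -/
theorem tendstoInDistribution_averaged {α : ℝ} (hα : α ∈ Set.Ioo (0 : ℝ) 1) {X0 : Ω → ℝ}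
    {XL : ℕ+ → Ω → ℝ} {f0 v : ℝ → ℝ} {f : ℕ+ → ℝ → ℝ} (hX0 : Measurable X0) (hX02 : MemLp X0 2 P)
    (hXL : ∀ K, Measurable (XL K)) (hXL2 : ∀ K, MemLp (XL K) 2 P) {V : ℝ}
    (hV : ∀ K : ℕ+, ∫ ω, (XL K ω - X0 ω) ^ 2 ∂P ≤ V * (K : ℝ)⁻¹)
    (h : Regularity P α X0 XL f0 f v) {ξ₀ : ℕ+ → Ω → ℝ} {X : ℕ+ → ℕ → Ω → ℝ}
    (R : ∀ K, Run P (ξ₀ K) (X K) (P.map (XL K))) (hξ : InitialMoment P α f ξ₀) {γ₁ β : ℝ}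
    (hγ₁ : 0 < γ₁) (hβ : β ∈ Set.Ioo (1 / 2 : ℝ) 1) :
    TendstoInDistribution
      (fun (K : ℕ+) (ω : Ω) =>
        (bias K)⁻¹ •
          !₂[xiAvg α (stepSize γ₁ β) (ξ₀ K ω) (fun n => X K n ω) (numIter K) - VaR P α X0,
             chiIter α (stepSize γ₁ β) (ξ₀ K ω) (fun n => X K n ω) (numIter K) - ES P α X0])
      atTop (id : EuclideanSpace ℝ (Fin 2) → EuclideanSpace ℝ (Fin 2)) (fun _ => P)
      (multivariateGaussian (limitMean P α X0 f0 v) (limitCov P α X0 f0)) := by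
  have h1 : 0 < 1 - α := by linarith [hα.2]
  have hXLa : ∀ K, AEMeasurable (XL K) P := fun K => (hXL K).aemeasurable
  have hX0i := hX02.integrable one_le_two
  have hXLi := fun K => (hXL2 K).integrable one_le_two
  obtain ⟨C, κ, hκ, hC, hν0, hν⟩ := h.lawRegular hX0.aemeasurable hXLa
  obtain ⟨B, hB, hctrl⟩ := h.exists_eventually_controlled hα hX0.aemeasurable hX0i hXLa R hξ hγ₁ hβ
  have hdr := h.tendsto_mul_drift hα hX0.aemeasurable hX0i hXLa
  have hobj := h.tendsto_mul_objective_sub hα hX0.aemeasurable hX0i hXLa hXLi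
  have hES := ES_eq_objective hX0.aemeasurable hX0i h.pdf_zero h.pos hα
  have hcov := secondMomentMatrix_eq_limitCov hα hX0 hX02 h.pdf_zero h.pos
  have hd0 := h.drift_zero hα hX0.aemeasurable
  have hfs : Tendsto (fun K => f K (VaR P α X0)) atTop (𝓝 (f0 (VaR P α X0))) :=
    (tendstoLocallyUniformlyOn_univ.2 h.pdf_tendsto).tendsto_at (Set.mem_univ _)
  have hf0 := h.pos (VaR P α X0)
  rw [hES, ← hcov]
  set s := VaR P α X0 with hs
  have hfK : ∀ K, 0 < f K s := fun K => hκ.trans_le (hν K).1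
  set c := 1 / (1 - α) with hc
  have hc0 : 0 < c := by positivity
  set D : ℕ+ → ℝ := fun K => drift α (P.map (XL K)) s with hD
  set O : ℕ+ → ℝ := fun K => objective P α (XL K) s with hO
  set O0 := objective P α X0 s with hO0
  -- The inverse slope of the mean field at `s`, converting a sum of `H₁(s, ·)` into a displacement
  -- of the averaged iterate.
  set g : ℕ+ → ℝ := fun K => (c * f K s)⁻¹ with hg
  set g0 := (c * f0 s)⁻¹ with hg0
  have hg_pos : ∀ K, 0 < g K := fun K => inv_pos.2 (mul_pos hc0 (hfK K))
  have hg_lim : Tendsto g atTop (𝓝 g0) := (hfs.const_mul c).inv₀ (by positivity)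
  have hKinv : Tendsto (fun K : ℕ+ => (K : ℝ)⁻¹) atTop (𝓝 0) :=
    tendsto_inv_atTop_zero.comp tendsto_pnat_cast
  have hKpos : ∀ K : ℕ+, (0 : ℝ) < K := fun K => by exact_mod_cast K.pos
  have hD_lim : Tendsto D atTop (𝓝 0) := by
    have := hKinv.mul hdr
    rw [zero_mul] at this
    refine this.congr fun K => ?_
    rw [← mul_assoc, inv_mul_cancel₀ (hKpos K).ne', one_mul]
  have hO_lim : Tendsto (fun K => O K - O0) atTop (𝓝 0) := by
    have := hKinv.mul hobj
    rw [zero_mul] at this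
    refine this.congr fun K => ?_
    rw [← mul_assoc, inv_mul_cancel₀ (hKpos K).ne', one_mul]
  have hH2 : ∀ K, MemLp (fun ω => H₁ α s (XL K ω)) 2 P := fun K => memLp_H₁_comp hα (hXL K)
  have hH02 : MemLp (fun ω => H₁ α s (X0 ω)) 2 P := memLp_H₁_comp hα hX0
  have hr2 : ∀ K, MemLp (fun ω => rho α s (XL K ω)) 2 P := fun K => memLp_rho_comp (hXL2 K)
  have hr02 : MemLp (fun ω => rho α s (X0 ω)) 2 P := memLp_rho_comp hX02
  -- convergence in mean square of the linearized increments
  have hla : Tendsto (fun K => ∫ ω, (-g K * (H₁ α s (XL K ω) - D K) -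
      -g0 * H₁ α s (X0 ω)) ^ 2 ∂P) atTop (𝓝 0) := by
    have l1 := tendsto_integral_sq_H₁_sub hα hXL hX0 hXL2 hX02 hν0 hV
    have l2 : Tendsto (fun K => 3 * (g K ^ 2 * ∫ ω, (H₁ α s (XL K ω) - H₁ α s (X0 ω)) ^ 2 ∂P
        + ((g0 - g K) ^ 2 * c ^ 2 + (g K * D K) ^ 2))) atTop
        (𝓝 (3 * (g0 ^ 2 * 0 + ((g0 - g0) ^ 2 * c ^ 2 + (g0 * 0) ^ 2)))) :=
      (((hg_lim.pow 2).mul l1).add ((((hg_lim.const_sub g0).pow 2).mul_const _).add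
        ((hg_lim.mul hD_lim).pow 2))).const_mul 3
    norm_num at l2
    refine squeeze_zero (fun K => integral_nonneg fun ω => sq_nonneg _) (fun K => ?_) l2
    have i1 : Integrable (fun ω => (H₁ α s (XL K ω) - H₁ α s (X0 ω)) ^ 2) P :=
      ((hH2 K).sub hH02).integrable_sq
    have i2 : Integrable (fun ω => 3 * (g K ^ 2 * (H₁ α s (XL K ω) - H₁ α s (X0 ω)) ^ 2
        + ((g0 - g K) ^ 2 * c ^ 2 + (g K * D K) ^ 2))) P :=
      ((i1.const_mul _).add (integrable_const _)).const_mul 3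
    have i3 : Integrable (fun ω => (-g K * (H₁ α s (XL K ω) - D K) -
        -g0 * H₁ α s (X0 ω)) ^ 2) P :=
      ((((hH2 K).sub (memLp_const (D K))).const_mul (-g K)).sub
        (hH02.const_mul (-g0))).integrable_sq
    refine (integral_mono i3 i2 fun ω => ?_).trans (le_of_eq ?_)
    · have e := sq_le_sq' (by linarith [neg_abs_le (H₁ α s (X0 ω)), abs_H₁_le hα s (X0 ω)])
        ((le_abs_self _).trans (abs_H₁_le hα s (X0 ω)))
      have e2 := mul_le_mul_of_nonneg_left e (sq_nonneg (g0 - g K))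
      simp only
      nlinarith [sq_nonneg (-g K * (H₁ α s (XL K ω) - H₁ α s (X0 ω)) - (g0 - g K) * H₁ α s (X0 ω)),
        sq_nonneg (-g K * (H₁ α s (XL K ω) - H₁ α s (X0 ω)) - g K * D K),
        sq_nonneg ((g0 - g K) * H₁ α s (X0 ω) - g K * D K)]
    · rw [integral_const_mul, integral_add (i1.const_mul _) (integrable_const _),
        integral_const_mul, integral_const, probReal_univ, one_smul]
  have hlb : Tendsto (fun K => ∫ ω, (rho α s (XL K ω) - O K - (rho α s (X0 ω) - O0)) ^ 2 ∂P) atTop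
      (𝓝 0) := by
    have l2 : Tendsto (fun K : ℕ+ => 2 * (c ^ 2 * (V * (K : ℝ)⁻¹) + (O K - O0) ^ 2)) atTop
        (𝓝 (2 * (c ^ 2 * (V * 0) + 0 ^ 2))) :=
      (((hKinv.const_mul V).const_mul (c ^ 2)).add (hO_lim.pow 2)).const_mul 2
    norm_num at l2
    refine squeeze_zero (fun K => integral_nonneg fun ω => sq_nonneg _) (fun K => ?_) l2
    have i1 : Integrable (fun ω => (XL K ω - X0 ω) ^ 2) P := ((hXL2 K).sub hX02).integrable_sq
    have i2 : Integrable (fun ω => 2 * (c ^ 2 * (XL K ω - X0 ω) ^ 2 + (O K - O0) ^ 2)) P :=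
      ((i1.const_mul _).add (integrable_const _)).const_mul 2
    have i3 : Integrable (fun ω => (rho α s (XL K ω) - O K - (rho α s (X0 ω) - O0)) ^ 2) P :=
      (((hr2 K).sub (memLp_const (O K))).sub (hr02.sub (memLp_const O0))).integrable_sq
    refine (integral_mono i3 i2 fun ω => ?_).trans ?_
    · have e := pow_le_pow_left₀ (abs_nonneg _) (abs_rho_sub_right_le hα (s := s) (XL K ω) (X0 ω)) 2
      rw [sq_abs, mul_pow, sq_abs] at e
      simp only
      nlinarith [sq_nonneg (rho α s (XL K ω) - rho α s (X0 ω) + (O K - O0))]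
    · rw [integral_const_mul, integral_add (i1.const_mul _) (integrable_const _),
        integral_const_mul, integral_const, probReal_univ, one_smul]
      have := mul_le_mul_of_nonneg_left (hV K) (sq_nonneg c)
      linarith
  have hpair : ∀ K, Measurable fun y : ℝ => (-g K * (H₁ α s y - D K), rho α s y - O K) := fun K =>
    ((measurable_H₁_right.sub_const _).const_mul _).prodMk (measurable_rho_right.sub_const _)
  -- The limiting mean is inserted as a constant shift of centered rows; its discrepancy from the
  -- actual bias is carried by `e₁` and `e₂`.
  have hmain := tendstoInDistribution_rows (P := P)
    (a := fun K ω => -g K * (H₁ α s (XL K ω) - D K)) (b := fun K ω => rho α s (XL K ω) - O K)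
    (a0 := fun ω => -g0 * H₁ α s (X0 ω)) (b0 := fun ω => rho α s (X0 ω) - O0)
    (fun K => ((hH2 K).sub (memLp_const (D K))).const_mul (-g K))
    (fun K => (hr2 K).sub (memLp_const (O K))) (hH02.const_mul (-g0)) (hr02.sub (memLp_const O0))
    (fun K => by
      rw [integral_const_mul, integral_sub ((hH2 K).integrable one_le_two) (integrable_const _),
        integral_H₁_comp hα (hXL K)]
      simp [hD])
    (fun K => by
      rw [integral_sub ((hr2 K).integrable one_le_two) (integrable_const _),
        integral_rho_comp (hXL2 K)]
      simp [hO])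
    (by rw [integral_const_mul, integral_H₁_comp hα hX0, hd0, mul_zero])
    (by
      rw [integral_sub (hr02.integrable one_le_two) (integrable_const _), integral_rho_comp hX02]
      simp [hO0])
    hla hlb (fun K n ω => (-g K * (H₁ α s (X K n ω) - D K), rho α s (X K n ω) - O K))
    (fun K n => (hpair K).comp ((R K).meas n))
    (fun K => (R K).indep.comp _ fun _ => hpair K)
    (fun K n => ((R K).identDistrib (hXL K) n).comp (hpair K))
    (limitMean P α X0 f0 v)
  -- the remainder
  let I₁ : ℕ+ → Ω → ℝ := fun K ω => c * f K s *
      ∑ k ∈ Finset.Icc 1 ((K : ℕ) ^ 2), (xiProc α (stepSize γ₁ β) (ξ₀ K) (X K) k ω - s)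
        + ∑ k ∈ Finset.range ((K : ℕ) ^ 2), H₁ α s (X K k ω)
  let I₂ : ℕ+ → Ω → ℝ := fun K ω => (((K : ℕ) ^ 2 : ℕ) : ℝ) *
      chiIter α (stepSize γ₁ β) (ξ₀ K ω) (fun k => X K k ω) ((K : ℕ) ^ 2)
        - ∑ k ∈ Finset.range ((K : ℕ) ^ 2), rho α s (X K k ω)
  let e₁ : ℕ+ → ℝ := fun K => -g K * ((K : ℝ) * D K) + v s / f0 s
  let e₂ : ℕ+ → ℝ := fun K => (K : ℝ) * (O K - O0) + ∫ ξ in Set.Ioi s, v ξ / (1 - α)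
  let T : ℕ+ → Ω → EuclideanSpace ℝ (Fin 2) := fun K ω =>
    !₂[g K * (K : ℝ)⁻¹ * I₁ K ω + e₁ K, (K : ℝ)⁻¹ * I₂ K ω + e₂ K]
  have he₁ : Tendsto e₁ atTop (𝓝 0) := by
    have := (hg_lim.neg.mul hdr).add_const (v s / f0 s)
    convert this using 2
    rw [hg0]
    field_simp
    ring
  have he₂ : Tendsto e₂ atTop (𝓝 0) := by
    have := hobj.add_const (∫ ξ in Set.Ioi s, v ξ / (1 - α))
    rwa [neg_add_cancel] at this
  have hXm : ∀ K k, MemLp (X K k) 2 P := fun K k =>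
    ((R K).identDistrib (hXL K) k).memLp_iff.2 (hXL2 K)
  have hI₁m : ∀ K, Measurable (I₁ K) := fun K =>
    ((Finset.measurable_fun_sum _ fun k _ =>
      ((R K).measurable_xiProc k).sub_const _).const_mul _).add
      (Finset.measurable_fun_sum _ fun k _ => measurable_H₁_right.comp ((R K).meas k))
  have hI₂m : ∀ K, Measurable (I₂ K) := fun K =>
    ((R K).measurable_chi _ _).sub
      (Finset.measurable_fun_sum _ fun k _ => measurable_rho_right.comp ((R K).meas k))
  have hTm : ∀ K, Measurable (T K) := fun K =>
    measurable_toLp_pair (((hI₁m K).const_mul _).add_const _) (((hI₂m K).const_mul _).add_const _)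
  obtain ⟨A₁, hA₁⟩ : ∃ A₁ : ℝ, ∀ᶠ K : ℕ+ in atTop,
      ∫ ω, |I₁ K ω| ∂P ≤ A₁ * rate β ((K : ℕ) ^ 2) := ⟨_, by
    filter_upwards [hctrl] with K hK
    exact hK.integral_xi_remainder_le (R K) (hν K).2 hα hγ₁ hβ hB C.2 (hC K s)
      (Nat.one_le_pow _ _ K.pos)⟩
  obtain ⟨A₂, A₃, hA₂⟩ : ∃ A₂ A₃ : ℝ, ∀ᶠ K : ℕ+ in atTop,
      ∫ ω, |I₂ K ω| ∂P ≤ A₂ * rate β ((K : ℕ) ^ 2)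
        + A₃ * (|D K| * (1 + (((K : ℕ) ^ 2 : ℕ) : ℝ) ^ (1 - β / 2))) := ⟨_, _, by
    filter_upwards [hctrl] with K hK
    exact hK.integral_chi_remainder_le (R K) (hν K).2 hα hγ₁ hβ hB C.2⟩
  have hT : TendstoInMeasure P T atTop (fun _ => 0) := by
    let b : ℕ+ → ℝ := fun K => (g K * (A₁ * ((K : ℝ)⁻¹ * rate β ((K : ℕ) ^ 2))) + |e₁ K|) +
      (A₂ * ((K : ℝ)⁻¹ * rate β ((K : ℕ) ^ 2)) + A₃ * (|(K : ℝ) * D K| * ((K : ℝ)⁻¹ * (K : ℝ)⁻¹ +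
        (K : ℝ)⁻¹ * ((K : ℝ)⁻¹ * (((K : ℕ) ^ 2 : ℕ) : ℝ) ^ (1 - β / 2)))) + |e₂ K|)
    have hb : Tendsto b atTop (𝓝 0) := by
      have l1 := tendsto_inv_mul_rate hβ
      have l2 := (hg_lim.mul (l1.const_mul A₁)).add he₁.abs
      have l3 := hdr.abs.mul ((hKinv.mul hKinv).add (tendsto_inv_sq_mul_rpow hβ))
      have l4 := l2.add (((l1.const_mul A₂).add (l3.const_mul A₃)).add he₂.abs)
      simp only [mul_zero, abs_zero, add_zero] at l4
      exact l4
    refine tendstoInMeasure_zero_of_integral_le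
      (G := fun K ω => (g K * (K : ℝ)⁻¹ * |I₁ K ω| + |e₁ K|) + ((K : ℝ)⁻¹ * |I₂ K ω| + |e₂ K|))
      (fun K ω => ?_) ?_ ?_ hb
    · refine (norm_toLp_pair_le _ _).trans (add_le_add ?_ ?_)
      · refine (abs_add_le _ _).trans_eq ?_
        rw [abs_mul, abs_of_pos (mul_pos (hg_pos K) (inv_pos.2 (hKpos K)))]
      · refine (abs_add_le _ _).trans_eq ?_
        rw [abs_mul, abs_of_pos (inv_pos.2 (hKpos K))]
    · filter_upwards [hctrl] with K hK
      exact (((hK.integrable_xi_remainder (R K) hα _).abs.const_mul _).add (integrable_const _)).add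
        (((hK.integrable_chi_remainder (hXm K)).abs.const_mul _).add (integrable_const _))
    · filter_upwards [hctrl, hA₁, hA₂] with K hK hK1 hK2
      have i1 : Integrable (fun ω => |I₁ K ω|) P := (hK.integrable_xi_remainder (R K) hα _).abs
      have i2 : Integrable (fun ω => |I₂ K ω|) P := (hK.integrable_chi_remainder (hXm K)).abs
      have i3 : Integrable (fun ω => g K * (K : ℝ)⁻¹ * |I₁ K ω| + |e₁ K|) P :=
        (i1.const_mul _).add (integrable_const _)
      have i4 : Integrable (fun ω => (K : ℝ)⁻¹ * |I₂ K ω| + |e₂ K|) P :=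
        (i2.const_mul _).add (integrable_const _)
      rw [integral_add i3 i4, integral_add (i1.const_mul _) (integrable_const _),
        integral_add (i2.const_mul _) (integrable_const _), integral_const_mul, integral_const_mul]
      simp only [integral_const, probReal_univ, one_smul]
      have k1 := mul_le_mul_of_nonneg_left hK1 (mul_pos (hg_pos K) (inv_pos.2 (hKpos K))).le
      have k2 := mul_le_mul_of_nonneg_left hK2 (inv_pos.2 (hKpos K)).le
      refine add_le_add (add_le_add_left (k1.trans_eq (by ring)) _)
        (add_le_add_left (k2.trans_eq ?_) _)
      rw [abs_mul, abs_of_pos (hKpos K)]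
      have := (hKpos K).ne'
      field_simp
  -- Slutsky. What follows checks, coordinate by coordinate, that the rescaled error is exactly the
  -- shifted row sum plus `T`.
  have hfin := hmain.add_of_tendstoInMeasure_const hT fun K => (hTm K).aemeasurable
  refine hfin.congr (fun K => ae_of_all _ fun ω => ?_) (ae_of_all _ fun z => by simp)
  have hK := (hKpos K).ne'
  have hbK : (bias K)⁻¹ = (K : ℝ) := by rw [bias]; simp
  have hcard : ∑ k ∈ Finset.Icc 1 ((K : ℕ) ^ 2), (xiProc α (stepSize γ₁ β) (ξ₀ K) (X K) k ω - s) =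
      ∑ k ∈ Finset.Icc 1 ((K : ℕ) ^ 2), xiIter α (stepSize γ₁ β) (ξ₀ K ω) (fun n => X K n ω) k
        - (K : ℝ) ^ 2 * s := by
    rw [Finset.sum_sub_distrib]
    simp [xiProc]
  have hgf : g K * (c * f K s) = 1 := inv_mul_cancel₀ (mul_pos hc0 (hfK K)).ne'
  rw [numIter_eq, hbK]
  ext i
  fin_cases i
  · change (K : ℝ)⁻¹ * ∑ k ∈ Finset.range ((K : ℕ) ^ 2), -g K * (H₁ α s (X K k ω) - D K)
      + -(v s / f0 s) + (g K * (K : ℝ)⁻¹ * I₁ K ω + e₁ K) = (K : ℝ) * (1 / (((K : ℕ) ^ 2 : ℕ) : ℝ) *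
        ∑ k ∈ Finset.Icc 1 ((K : ℕ) ^ 2), xiIter α (stepSize γ₁ β) (ξ₀ K ω) (fun n => X K n ω) k - s)
    simp only [I₁, e₁, hcard]
    rw [← Finset.mul_sum, Finset.sum_sub_distrib, Finset.sum_const, Finset.card_range, nsmul_eq_mul]
    generalize ∑ k ∈ Finset.Icc 1 ((K : ℕ) ^ 2),
      xiIter α (stepSize γ₁ β) (ξ₀ K ω) (fun n => X K n ω) k = S
    generalize ∑ k ∈ Finset.range ((K : ℕ) ^ 2), H₁ α s (X K k ω) = S'
    have e : g K * (K : ℝ)⁻¹ * (c * f K s * (S - (K : ℝ) ^ 2 * s) + S') =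
        (K : ℝ)⁻¹ * (S - (K : ℝ) ^ 2 * s) + g K * (K : ℝ)⁻¹ * S' := by
      linear_combination ((K : ℝ)⁻¹ * (S - (K : ℝ) ^ 2 * s)) * hgf
    rw [e]
    push_cast
    field_simp
    ring
  · change (K : ℝ)⁻¹ * ∑ k ∈ Finset.range ((K : ℕ) ^ 2), (rho α s (X K k ω) - O K)
      + -(∫ ξ in Set.Ioi s, v ξ / (1 - α)) + ((K : ℝ)⁻¹ * I₂ K ω + e₂ K) =
        (K : ℝ) * (chiIter α (stepSize γ₁ β) (ξ₀ K ω) (fun n => X K n ω) ((K : ℕ) ^ 2) - O0)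
    simp only [I₂, e₂]
    rw [Finset.sum_sub_distrib, Finset.sum_const, Finset.card_range, nsmul_eq_mul]
    push_cast
    field_simp
    ring

end Main

end NestedSA


end

theorem corollary2p3
    {Ω : Type*} [MeasurableSpace Ω] (P : Measure Ω) [IsProbabilityMeasure P]
    (α : ℝ) (hα : α ∈ Set.Ioo (0 : ℝ) 1)
    -- the model: `Y`, `Z` independent, `φ` measurable
    {d q : ℕ} (φ : EuclideanSpace ℝ (Fin d) × EuclideanSpace ℝ (Fin q) → ℝ) (hφ : Measurable φ)
    (Y : Ω → EuclideanSpace ℝ (Fin d)) (hY : Measurable Y)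
    (Z : Ω → EuclideanSpace ℝ (Fin q)) (hZ : Measurable Z)
    (hYZ : IndepFun Y Z P)
    (δ : ℝ) (hδ : 0 < δ)
    (hmoment : Integrable (fun ω => |φ (Y ω, Z ω)| ^ (2 + δ)) P)
    -- the inner samples: i.i.d. copies of `Z`, independent of `Y`
    (Zs : ℕ → Ω → EuclideanSpace ℝ (Fin q))
    (hZs_meas : ∀ k, Measurable (Zs k))
    (hZs_ident : ∀ k, IdentDistrib (Zs k) Z P P)
    (hZs_indep : iIndepFun Zs P)
    (hY_Zs : IndepFun Y (fun ω k => Zs k ω) P)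
    -- the regularity assumptions on the losses
    (f0 : ℝ → ℝ) (f : ℕ+ → ℝ → ℝ) (v : ℝ → ℝ)
    (hreg : NestedSA.Regularity P α (NestedSA.loss P φ Y Z) (NestedSA.nestedLoss φ Y Zs) f0 f v)
    -- for each `h`, the innovations: i.i.d. copies of `X_h`
    (X : ℕ+ → ℕ → Ω → ℝ)
    (hX_meas : ∀ K n, Measurable (X K n))
    (hX_ident : ∀ K n, IdentDistrib (X K n) (NestedSA.nestedLoss φ Y Zs K) P P)
    (hX_indep : ∀ K, iIndepFun (X K) P)
    -- the initial values, independent of the innovations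
    (ξ₀ : ℕ+ → Ω → ℝ) (hξ₀ : ∀ K, Measurable (ξ₀ K))
    (hξ₀_indep : ∀ K, IndepFun (ξ₀ K) (fun ω n => X K n ω) P)
    (hξ₀_moment : NestedSA.InitialMoment P α f ξ₀)
    -- the learning rate
    (γ₁ : ℝ) (hγ₁ : 0 < γ₁) (β : ℝ) (hβ : β ∈ Set.Ioo (1 / 2 : ℝ) 1) :
    TendstoInDistribution
      (fun (K : ℕ+) (ω : Ω) =>
        (NestedSA.bias K)⁻¹ •
          !₂[NestedSA.xiAvg α (NestedSA.stepSize γ₁ β) (ξ₀ K ω) (fun n => X K n ω)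
                (NestedSA.numIter K) - NestedSA.VaR P α (NestedSA.loss P φ Y Z),
             NestedSA.chiIter α (NestedSA.stepSize γ₁ β) (ξ₀ K ω) (fun n => X K n ω)
                (NestedSA.numIter K) - NestedSA.ES P α (NestedSA.loss P φ Y Z)])
      atTop (id : EuclideanSpace ℝ (Fin 2) → EuclideanSpace ℝ (Fin 2)) (fun _ => P)
      (multivariateGaussian
        (NestedSA.limitMean P α (NestedSA.loss P φ Y Z) f0 v)
        (NestedSA.limitCov P α (NestedSA.loss P φ Y Z) f0)) := by
  have h2 : MemLp (fun ω => φ (Y ω, Z ω)) 2 P :=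
    NestedSA.memLp_two_of_integrable_rpow
      (hφ.comp (hY.prodMk hZ)).aestronglyMeasurable hδ hmoment
  obtain ⟨V, hV⟩ := NestedSA.exists_integral_sq_nestedLoss_sub_le hφ hY hZ hYZ h2 hZs_meas hZs_ident
    hZs_indep hY_Zs
  exact NestedSA.tendstoInDistribution_averaged hα (NestedSA.measurable_loss hY)
    (NestedSA.memLp_loss h2) (NestedSA.measurable_nestedLoss hφ hY hZs_meas)
    (NestedSA.memLp_nestedLoss hφ hY hYZ h2 hZs_ident hY_Zs) hV hreg
    (fun K => ⟨hξ₀ K, hX_meas K, hX_indep K, hξ₀_indep K, fun n => (hX_ident K n).map_eq⟩)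
    hξ₀_moment hγ₁ hβ
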